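/- **Machine model.** The Real RAM executes a fixed finite program. It stores integers and exact real numbers in registers and arrays (array cells are addressed by integers). In one step each it can execute $+$ and truncated $-$ on integers, $+,-,\times,/,\sqrt{\cdot}$ on reals, a comparison of two integers or of two reals, a conversion of an integer into a real, and a move between memory and registers (division by $0$ and roots of negative numbers are not allowed). All these steps are counted below as operations. **AFMM.** Let $\xi\ge 1$. An AFMM with exponent $\xi$ is a black box which takes as input an accuracy $\delta\in(0,1/2)$, a kernel $k(x)\in\{\log|x|,\ 1/x,\ 1/x^2\}$, a constant $C>0$, evaluation points $x_1,\dots,x_{M}$, weights $c_1,\dots,c_N$ and sources $y_1,\dots,y_N$, where $N\ge1$ and $M\le N$, all of absolute value less than $C$, such that $|x_i-y_j|\ge a(\delta/N)^{p}$ for all $i,j$, where $a>0$ and $p\in\mathbb{N}$ are constants. It returns $\tilde f(x_1),\dots,\tilde f(x_M)$ with $|\tilde f(x_i)-\sum_{j=1}^{N}c_j\,k(x_i-y_j)|\le\delta$ for all $i$, at a cost of $O(N\log^{\xi}(N/\delta))$ operations, where the implied constant may depend on $C,a,p$ but not on $\delta$ and $N$. (That is, the box is a $(\delta,\xi,N)$-AFMM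 for all $\delta$ and $N$.) A program may call the AFMM; a call costs one step plus the operations of the AFMM. **Theorem.** Let $\alpha\in\mathbb{R}$, $z\in\mathbb{R}^{n-1}$, let $D=\operatorname{diag}(d_1,\dots,d_{n-1})$ be real, and let $$H=\begin{pmatrix}\alpha & z^\top\\ z & D\end{pmatrix}\in\mathbb{R}^{n\times n},\qquad n\ge 1,$$ be an arrowhead matrix with spectral norm $\|H\|\le 1$. Assume that an AFMM with exponent $\xi\ge1$ is given. The programs below do not depend on the input, on $\xi$ or on the AFMM, and the constants implied by $O(\cdot)$ depend only on the AFMM and $\xi$. (i) Let $\epsilon\in(0,1)$ (and $\epsilon\le 1/2$ if $n=1$), $r\ge1$, and let $B\in\mathbb{R}^{n\times r}$ have columns of Euclidean norm at most $1$. There is a program which, on input $n,r,\epsilon,\alpha,z,d,B$, computes with at most $O\big(nr\log^{\xi+1}(n/\epsilon)\big)$ operations a diagonal matrix $\tilde\Lambda\in\mathbb{R}^{n\times n}$ and a matrix $\tilde Q_B\in\mathbb{R}^{n\times r}$ such that, for some exactly orthogonal matrix $Q\in\mathbb{R}^{n\times n}$, $$\|H-Q\tilde\Lambda Q^\top\|\le\epsilon\qquad\text{and}\qquad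 \big|(Q^\top B-\tilde Q_B)_{i,j}\big|\le \epsilon/n^2\quad\text{for all } i,j.$$ (ii) Let $\epsilon\in(0,1/2]$. There is a program which, on input $n,\epsilon,\alpha,z,d$, computes with at most $O\big(n\log(1/\epsilon)\log^{\xi}(n/\epsilon)\big)$ operations values $\tilde\lambda_1,\dots,\tilde\lambda_n$ such that $|\lambda_i(H)-\tilde\lambda_i|\le\epsilon$ for all $i$, where $\lambda_1(H)\le\dots\le\lambda_n(H)$ are the eigenvalues of $H$ with multiplicities. -/

import Mathlib

/-! ## Approximate fast multipole method (AFMM) -/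

/-- The three admissible kernels `log |x|`, `1 / x`, `1 / x ^ 2`. -/
inductive Kernel where
  | log
  | inv
  | invSq

/-- The value of a kernel. `Real.log x` is `log |x|`. -/
noncomputable def Kernel.fn : Kernel → ℝ → ℝ
  | .log, x => Real.log x
  | .inv, x => 1 / x
  | .invSq, x => 1 / x ^ 2

/-- The input of one AFMM call: a kernel, the accuracy `acc`, the bound `bound` on the magnitude of
all data, `m` evaluation points `x`, and `n` sources `y` with weights `c`. -/
structure Query where
  kernel : Kernel
  acc : ℝ
  bound : ℝ
  m : ℕ
  n : ℕ
  x : Fin m → ℝ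
  c : Fin n → ℝ
  y : Fin n → ℝ

/-- The exact sums `f (x i) = ∑ j, c j * k (x i - y j)`. -/
noncomputable def Query.exact (q : Query) (i : Fin q.m) : ℝ :=
  ∑ j, q.c j * q.kernel.fn (q.x i - q.y j)

/-- The inputs on which an AFMM has to work, for the constant `C` and for the separation threshold
`a * (acc / n) ^ k`, which is polynomial in `acc / n`. -/
structure Query.Admissible (q : Query) (C a : ℝ) (k : ℕ) : Prop where
  acc_pos : 0 < q.acc
  acc_lt : q.acc < 1 / 2
  n_pos : 1 ≤ q.n
  m_le : q.m ≤ q.n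
  bound_eq : q.bound = C
  x_lt : ∀ i, |q.x i| < q.bound
  c_lt : ∀ j, |q.c j| < q.bound
  y_lt : ∀ j, |q.y j| < q.bound
  separated : ∀ i j, a * (q.acc / q.n) ^ k ≤ |q.x i - q.y j|

/-- A black box that answers queries, together with the number of arithmetic operations that it
uses for each of them. -/
structure BlackBox where
  eval : (q : Query) → Fin q.m → ℝ
  cost : Query → ℕ

/-- The black box is an `(ε, ξ, n)`-AFMM, for all accuracies `ε` and all sizes `n`: on all inputs
with data bounded by a constant `C` and points that are polynomially separated in `ε / n`, it
returns all sums up to `ε`, using `O(n log^ξ (n / ε))` operations. The implied constant may depend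
on `C` and on the polynomial, but not on `ε` and `n`. -/
def BlackBox.IsAFMM (F : BlackBox) (ξ : ℝ) : Prop :=
  ∀ C a : ℝ, 0 < C → 0 < a → ∀ k : ℕ, ∃ K : ℝ, ∀ q : Query, q.Admissible C a k →
    (∀ i, |F.eval q i - q.exact i| ≤ q.acc) ∧
    (F.cost q : ℝ) ≤ K * (q.n * Real.log (q.n / q.acc) ^ ξ)

/-! ## The Real RAM

Programs are finite texts that do not depend on the input. The memory consists of integer and real
registers and of integer and real arrays, all named by constants of the program; array cells are
addressed by the contents of integer registers. Only `+` and truncated `-` are available on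
integers. Real numbers are stored exactly; the operations on them are `+`, `-`, `*`, `/`, `√` and
comparisons. Integers can be converted into reals, but not conversely. -/

/-- The memory of the machine. -/
structure State where
  /-- integer registers -/
  iv : ℕ → ℕ
  /-- integer arrays -/
  im : ℕ → ℕ → ℕ
  /-- real registers -/
  rv : ℕ → ℝ
  /-- real arrays -/
  rm : ℕ → ℕ → ℝ

/-- The binary arithmetic operations on reals. -/
inductive ROp where
  | add
  | sub
  | mul
  | div

/-- The value of an arithmetic operation. -/
noncomputable def ROp.fn : ROp → ℝ → ℝ → ℝ
  | .add, a, b => a + b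
  | .sub, a, b => a - b
  | .mul, a, b => a * b
  | .div, a, b => a / b

/-- The instructions. The first argument is the target, except for `istore` and `rstore`. -/
inductive Instr where
  /-- integer register `p := k` -/
  | iconst (p k : ℕ)
  /-- integer register `p := a + b` -/
  | iadd (p a b : ℕ)
  /-- integer register `p := a - b`, which is `0` if `a < b` -/
  | isub (p a b : ℕ)
  /-- integer register `p := A[a]`, where `A` is an integer array -/
  | iload (p A a : ℕ)
  /-- `A[a] := p`, where `A` is an integer array -/
  | istore (A a p : ℕ)
  /-- real register `u :=` the integer in register `a` -/
  | rcast (u a : ℕ)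
  /-- real register `u := v op w` -/
  | rop (u : ℕ) (op : ROp) (v w : ℕ)
  /-- real register `u := √v` -/
  | rsqrt (u v : ℕ)
  /-- real register `u := A[a]`, where `A` is a real array -/
  | rload (u A a : ℕ)
  /-- `A[a] := u`, where `A` is a real array -/
  | rstore (A a u : ℕ)
  /-- A call of the AFMM with kernel `κ`: the real registers `e` and `b` hold the accuracy and the
  bound, the integer registers `p` and `q` hold the numbers of evaluation points and of sources,
  the real arrays `X`, `W`, `Y` hold the evaluation points, the weights and the sources, and the
  results are written to the real array `O`. -/
  | fmm (κ : Kernel) (e b p q X W Y O : ℕ)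

/-- The query of an AFMM call. -/
def State.query (s : State) (κ : Kernel) (e b p q X W Y : ℕ) : Query where
  kernel := κ
  acc := s.rv e
  bound := s.rv b
  m := s.iv p
  n := s.iv q
  x := fun i => s.rm X i
  c := fun j => s.rm W j
  y := fun j => s.rm Y j

/-- An instruction is only defined if it does not divide by zero and does not take the square root
of a negative number; otherwise the machine gets stuck. -/
def Instr.Defined (s : State) : Instr → Prop
  | .rop _ .div _ w => s.rv w ≠ 0
  | .rsqrt _ v => 0 ≤ s.rv v
  | _ => True

/-- The effect of an instruction on the memory. -/
noncomputable def Instr.run (F : BlackBox) (s : State) : Instr → State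
  | .iconst p k => { s with iv := Function.update s.iv p k }
  | .iadd p a b => { s with iv := Function.update s.iv p (s.iv a + s.iv b) }
  | .isub p a b => { s with iv := Function.update s.iv p (s.iv a - s.iv b) }
  | .iload p A a => { s with iv := Function.update s.iv p (s.im A (s.iv a)) }
  | .istore A a p =>
      { s with im := Function.update s.im A (Function.update (s.im A) (s.iv a) (s.iv p)) }
  | .rcast u a => { s with rv := Function.update s.rv u (s.iv a : ℝ) }
  | .rop u op v w => { s with rv := Function.update s.rv u (op.fn (s.rv v) (s.rv w)) }
  | .rsqrt u v => { s with rv := Function.update s.rv u (Real.sqrt (s.rv v)) }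
  | .rload u A a => { s with rv := Function.update s.rv u (s.rm A (s.iv a)) }
  | .rstore A a u =>
      { s with rm := Function.update s.rm A (Function.update (s.rm A) (s.iv a) (s.rv u)) }
  | .fmm κ e b p q X W Y O =>
      { s with
        rm := Function.update s.rm O (fun i =>
          if h : i < s.iv p then F.eval (s.query κ e b p q X W Y) ⟨i, h⟩ else s.rm O i) }

/-- Every instruction costs one step; an AFMM call costs in addition the operations of the AFMM. -/
def Instr.cost (F : BlackBox) (s : State) : Instr → ℕ
  | .fmm κ e b p q X W Y _ => F.cost (s.query κ e b p q X W Y) + 1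
  | _ => 1

/-- The tests: comparison of two integer registers or of two real registers. -/
inductive Test where
  | ilt (a b : ℕ)
  | rlt (u v : ℕ)

/-- The outcome of a test. -/
def Test.Holds (s : State) : Test → Prop
  | .ilt a b => s.iv a < s.iv b
  | .rlt u v => s.rv u < s.rv v

/-- Programs. -/
inductive Prog where
  | instr (i : Instr)
  | seq (P Q : Prog)
  | ite (T : Test) (P Q : Prog)
  | loop (T : Test) (P : Prog)

/-- `Exec F P s s' t`: started in the memory `s`, the program `P` with the AFMM `F` terminates with
the memory `s'` after `t` steps. All steps are counted: arithmetic operations, comparisons, moves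
between memory and registers, index computations, and the operations of the AFMM. The program
`loop T P` repeats `P` as long as `T` holds. -/
inductive Exec (F : BlackBox) : Prog → State → State → ℕ → Prop where
  | instr {i : Instr} {s : State} (h : i.Defined s) :
      Exec F (.instr i) s (i.run F s) (i.cost F s)
  | seq {P Q : Prog} {s₁ s₂ s₃ : State} {t u : ℕ} (hP : Exec F P s₁ s₂ t)
      (hQ : Exec F Q s₂ s₃ u) : Exec F (.seq P Q) s₁ s₃ (t + u)
  | ite_true {T : Test} {P Q : Prog} {s s' : State} {t : ℕ} (hT : T.Holds s)
      (hP : Exec F P s s' t) : Exec F (.ite T P Q) s s' (t + 1)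
  | ite_false {T : Test} {P Q : Prog} {s s' : State} {t : ℕ} (hT : ¬ T.Holds s)
      (hQ : Exec F Q s s' t) : Exec F (.ite T P Q) s s' (t + 1)
  | loop_done {T : Test} {P : Prog} {s : State} (hT : ¬ T.Holds s) :
      Exec F (.loop T P) s s 1
  | loop_step {T : Test} {P : Prog} {s₁ s₂ s₃ : State} {t u : ℕ} (hT : T.Holds s₁)
      (hP : Exec F P s₁ s₂ t) (hL : Exec F (.loop T P) s₂ s₃ u) :
      Exec F (.loop T P) s₁ s₃ (t + u + 1)

/-! ## Arrowhead matrices -/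

/-- The arrowhead matrix with corner `α`, shaft `z` and diagonal `d`. Its size is `m + 1`. -/
def arrowhead {m : ℕ} (α : ℝ) (z d : Fin m → ℝ) : Matrix (Fin (m + 1)) (Fin (m + 1)) ℝ :=
  Matrix.of (Fin.cons (Fin.cons α z) (fun i => Fin.cons (z i) (Matrix.diagonal d i)))

/-- The spectral norm of a real square matrix. -/
noncomputable def specNorm {n : ℕ} (A : Matrix (Fin n) (Fin n) ℝ) : ℝ :=
  ‖Matrix.toEuclideanCLM (n := Fin n) (𝕜 := ℝ) A‖

/-- A finite sequence as the content of an array. -/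
def toArray {n : ℕ} (v : Fin n → ℝ) (a : ℕ) : ℝ :=
  if h : a < n then v ⟨a, h⟩ else 0

/-- The initial memory for the arrowhead matrix with data `α`, `z`, `d` and the accuracy `ε`: the
size is in integer register `0`, `ε` and `α` are in the real registers `0` and `1`, `z` and `d` are
in the real arrays `0` and `1`. Everything else is zero. -/
def eigInput {m : ℕ} (ε α : ℝ) (z d : Fin m → ℝ) : State where
  iv := Function.update (fun _ => 0) 0 (m + 1)
  im := fun _ _ => 0
  rv := Function.update (Function.update (fun _ => 0) 0 ε) 1 α
  rm := Function.update (Function.update (fun _ _ => 0) 0 (toArray z)) 1 (toArray d)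

/-- As `eigInput`, with in addition the number `r` of columns of `B` in integer register `1`, and
the matrix `B`, row by row, in the real array `2`: the entry `B i j` is in cell `j + r * i`. -/
def diagInput {m r : ℕ} (ε α : ℝ) (z d : Fin m → ℝ) (B : Matrix (Fin (m + 1)) (Fin r) ℝ) :
    State where
  iv := Function.update (eigInput ε α z d).iv 1 r
  im := (eigInput ε α z d).im
  rv := (eigInput ε α z d).rv
  rm := Function.update (eigInput ε α z d).rm 2
    (toArray (fun a => B (finProdFinEquiv.symm a).1 (finProdFinEquiv.symm a).2))

/-- The vector in the first `n` cells of the real array `3`. -/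
def outVector (s : State) (n : ℕ) : Fin n → ℝ :=
  fun i => s.rm 3 i

/-- The `n × r` matrix that is stored row by row in the real array `4`. -/
def outMatrix (s : State) (n r : ℕ) : Matrix (Fin n) (Fin r) ℝ :=
  Matrix.of fun i j => s.rm 4 (j + r * i)

/-- `lam` lists the eigenvalues of `A` with multiplicities in increasing order. -/
def IsSortedSpectrum {n : ℕ} (A : Matrix (Fin n) (Fin n) ℝ) (lam : Fin n → ℝ) : Prop :=
  Monotone lam ∧ A.charpoly = ∏ i, (Polynomial.X - Polynomial.C (lam i))

/-! The eigenvalues of an arrowhead matrix with distinct poles `d_j` and nonzero shaft entries `z_j`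
are the roots of the secular function `f x = α - x + ∑ z_j ^ 2 / (x - d_j)`, one in each interval
cut out by the poles, and `(1, z_j / (x - d_j))` is an eigenvector for the root `x`. Everything
reduces to sums that an AFMM evaluates, once poles and roots are quantitatively separated.

Separation is bought by a perturbation of norm at most `ε / 8` (`EigResult.specNorm_sub_le`). With
`σ = ε / (64 n)`, the shaft entries are pushed away from zero by `σ`, and every diagonal entry is
moved within its dyadic cell, whose width lies between `ε / 32` and `ε / 16`: the points of one cell
are placed at distances `σ, 2 σ, ...` from its left end (`spread_lt`). A binary tree of counters
finds the cells by doubling and comparing, and later finds the `k`-th pole by its rank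
(`count_spread`). This takes `O(n log (1 / ε))` steps and avoids the `n log n` of sorting. The roots
are then at least `σ ^ 4` away from the poles (`exists_secularRoots`).

Bisection runs in all `n` intervals at once, with one AFMM call per round. Between poles `f` has
slope at most `-1`, so `|f x|` is at least the distance of `x` to the root, and a value with error
`δ = σ ^ 32` can have the wrong sign only within `δ` of the root. Hence errors do not accumulate
(`IsBracket.halve`). For the eigenvalues alone, width `ε / 8` suffices, which takes `O(log (1 / ε))`
rounds, and Weyl's inequality (`Diagonalizes.abs_sub_le`) passes to `H`. For the diagonalization the
width is `σ ^ 32`, after `O(log (n / ε))` rounds.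

In (i), `Q` consists of the exact normalized eigenvectors of the perturbed matrix, orthogonal
because the roots are distinct. An entry of `Qᵀ B` is a `1 / x` sum divided by the root of a `1 / x
^ 2` sum (`normalized_transpose_mul`). Approximate roots change both sums only by high powers of `σ`
(`abs_inv_sub_le`), and the quotient is stable because it is at most `1` (`abs_div_sqrt_sub_le`). -/

/-! ## A program logic with costs -/

/-- The memory unit that an instruction writes, as a pair of its kind (integer register, integer
array, real register, real array) and its name. -/
def Instr.target : Instr → ℕ × ℕ
  | .iconst p _ => (0, p)
  | .iadd p _ _ => (0, p)
  | .isub p _ _ => (0, p)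
  | .iload p _ _ => (0, p)
  | .istore A _ _ => (1, A)
  | .rcast u _ => (2, u)
  | .rop u _ _ _ => (2, u)
  | .rsqrt u _ => (2, u)
  | .rload u _ _ => (2, u)
  | .rstore A _ _ => (3, A)
  | .fmm _ _ _ _ _ _ _ _ O => (3, O)

/-- The memory units that a program may write. -/
def Prog.targets : Prog → List (ℕ × ℕ)
  | .instr i => [i.target]
  | .seq P Q => P.targets ++ Q.targets
  | .ite _ P Q => P.targets ++ Q.targets
  | .loop _ P => P.targets

/-- Two memories agree outside the memory units that a program may write. -/
structure Frame (P : Prog) (s s' : State) : Prop where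
  iv : ∀ a, (0, a) ∉ P.targets → s'.iv a = s.iv a
  im : ∀ a, (1, a) ∉ P.targets → s'.im a = s.im a
  rv : ∀ a, (2, a) ∉ P.targets → s'.rv a = s.rv a
  rm : ∀ a, (3, a) ∉ P.targets → s'.rm a = s.rm a

theorem Frame.refl (P : Prog) (s : State) : Frame P s s :=
  ⟨fun _ _ => rfl, fun _ _ => rfl, fun _ _ => rfl, fun _ _ => rfl⟩

theorem Frame.trans {P : Prog} {s₁ s₂ s₃ : State} (h : Frame P s₁ s₂) (h' : Frame P s₂ s₃) :
    Frame P s₁ s₃ :=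
  ⟨fun a ha => (h'.iv a ha).trans (h.iv a ha), fun a ha => (h'.im a ha).trans (h.im a ha),
    fun a ha => (h'.rv a ha).trans (h.rv a ha), fun a ha => (h'.rm a ha).trans (h.rm a ha)⟩

theorem Frame.mono {P Q : Prog} (hPQ : ∀ x ∈ P.targets, x ∈ Q.targets) {s s' : State}
    (h : Frame P s s') : Frame Q s s' :=
  ⟨fun a ha => h.iv a fun h' => ha (hPQ _ h'), fun a ha => h.im a fun h' => ha (hPQ _ h'),
    fun a ha => h.rv a fun h' => ha (hPQ _ h'), fun a ha => h.rm a fun h' => ha (hPQ _ h')⟩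

theorem frame_loop {T : Test} {P : Prog} {s s' : State} :
    Frame (.loop T P) s s' ↔ Frame P s s' :=
  ⟨fun h => ⟨h.iv, h.im, h.rv, h.rm⟩, fun h => ⟨h.iv, h.im, h.rv, h.rm⟩⟩

theorem frame_instr (F : BlackBox) (i : Instr) (s : State) : Frame (.instr i) s (i.run F s) := by
  constructor <;> intro a ha <;> cases i <;>
    simp_all [Prog.targets, Instr.target, Instr.run]

/-- Preservation of untouched memory becomes a decidable check on the program text, so
postconditions need only mention what changes. -/
theorem Exec.frame {F : BlackBox} {P : Prog} {s s' : State} {t : ℕ} (h : Exec F P s s' t) :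
    Frame P s s' := by
  induction h with
  | instr h => exact frame_instr F _ _
  | seq _ _ h₁ h₂ =>
    exact (h₁.mono fun x hx => List.mem_append_left _ hx).trans
      (h₂.mono fun x hx => List.mem_append_right _ hx)
  | ite_true _ _ h => exact h.mono fun x hx => List.mem_append_left _ hx
  | ite_false _ _ h => exact h.mono fun x hx => List.mem_append_right _ hx
  | loop_done _ => exact Frame.refl _ _
  | loop_step _ _ _ h₁ h₂ => exact (frame_loop.2 h₁).trans h₂

/-- Started in `s`, the program terminates after at most `c` steps in a memory that satisfies
`Q`. -/
def Reach (F : BlackBox) (P : Prog) (s : State) (c : ℕ) (Q : State → Prop) : Prop :=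
  ∃ s' t, Exec F P s s' t ∧ t ≤ c ∧ Q s'

theorem Reach.mono {F : BlackBox} {P : Prog} {s : State} {c c' : ℕ} {Q Q' : State → Prop}
    (h : Reach F P s c Q) (hc : c ≤ c') (hQ : ∀ s', Q s' → Frame P s s' → Q' s') :
    Reach F P s c' Q' := by
  obtain ⟨s', t, he, ht, hs⟩ := h
  exact ⟨s', t, he, ht.trans hc, hQ s' hs he.frame⟩

theorem Reach.instr {F : BlackBox} {i : Instr} {s : State} {c : ℕ} {Q : State → Prop}
    (hd : i.Defined s) (hc : i.cost F s ≤ c) (hQ : Q (i.run F s)) : Reach F (.instr i) s c Q :=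
  ⟨_, _, .instr hd, hc, hQ⟩

theorem Reach.seq {F : BlackBox} {P P' : Prog} {s : State} {Q R : State → Prop} (c₁ c₂ : ℕ) {c : ℕ}
    (h : Reach F P s c₁ Q) (hc : c₁ + c₂ ≤ c)
    (h' : ∀ s', Q s' → Frame P s s' → Reach F P' s' c₂ R) : Reach F (.seq P P') s c R := by
  obtain ⟨s', t, he, ht, hs⟩ := h
  obtain ⟨s'', t', he', ht', hs'⟩ := h' s' hs he.frame
  exact ⟨s'', _, .seq he he', by omega, hs'⟩

theorem Reach.ite {F : BlackBox} {T : Test} {P P' : Prog} {s : State} {Q : State → Prop} (c' : ℕ)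
    {c : ℕ} (hc : c' + 1 ≤ c) (h : T.Holds s → Reach F P s c' Q)
    (h' : ¬ T.Holds s → Reach F P' s c' Q) : Reach F (.ite T P P') s c Q := by
  by_cases hT : T.Holds s
  · obtain ⟨s', t, he, ht, hs⟩ := h hT
    exact ⟨s', _, .ite_true hT he, by omega, hs⟩
  · obtain ⟨s', t, he, ht, hs⟩ := h' hT
    exact ⟨s', _, .ite_false hT he, by omega, hs⟩

/-- The rule for loops, for an invariant that depends on the number of rounds. -/
theorem Reach.loop {F : BlackBox} {T : Test} {P : Prog} {s : State} (I : ℕ → State → Prop)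
    (N c : ℕ) {c' : ℕ} (hc : N * (c + 1) + 1 ≤ c') (h0 : I 0 s)
    (hN : ∀ i s', Frame P s s' → I i s' → i ≤ N → T.Holds s' → i < N)
    (hP : ∀ i s', i < N → Frame P s s' → I i s' → T.Holds s' → Reach F P s' c (I (i + 1)))
    : Reach F (.loop T P) s c' (fun s' => ∃ i ≤ N, I i s' ∧ ¬ T.Holds s') := by
  -- The induction is on the number `k` of rounds still allowed, because the starting memory differs
  -- from round to round.
  suffices H : ∀ k i s', i + k = N → Frame P s s' → I i s' →
      Reach F (.loop T P) s' (k * (c + 1) + 1) (fun s' => ∃ i ≤ N, I i s' ∧ ¬ T.Holds s') from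
    (H N 0 s (by omega) (Frame.refl _ _) h0).mono hc fun _ h _ => h
  intro k
  induction k with
  | zero =>
    intro i s' hi hf hI
    have hT : ¬ T.Holds s' := fun hT => by have := hN i s' hf hI (by omega) hT; omega
    exact ⟨s', 1, .loop_done hT, by omega, i, by omega, hI, hT⟩
  | succ k ih =>
    intro i s' hi hf hI
    by_cases hT : T.Holds s'
    · obtain ⟨s₂, t, he, ht, hs⟩ := hP i s' (by omega) hf hI hT
      obtain ⟨s₃, u, he', hu, hs'⟩ := ih (i + 1) s₂ (by omega) (hf.trans he.frame) hs
      exact ⟨s₃, _, .loop_step hT he he', by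
        have : (k + 1) * (c + 1) = k * (c + 1) + (c + 1) := by ring
        omega, hs'⟩
    · exact ⟨s', 1, .loop_done hT, by omega, i, by omega, hI, hT⟩

/-- Counting loops: the register `p` counts the rounds up to the content of register `b`. -/
theorem Reach.count {F : BlackBox} {p b : ℕ} {P : Prog} {s : State} (I : ℕ → State → Prop)
    (N c : ℕ) {c' : ℕ} (hc : N * (c + 1) + 1 ≤ c') (hp : s.iv p = 0) (hb : s.iv b = N)
    (hbP : (0, b) ∉ P.targets) (h0 : I 0 s)
    (hP : ∀ i s', i < N → Frame P s s' → I i s' → s'.iv p = i →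
      Reach F P s' c (fun s'' => s''.iv p = i + 1 ∧ I (i + 1) s'')) :
    Reach F (.loop (.ilt p b) P) s c' (I N) := by
  have hb' : ∀ s', Frame P s s' → s'.iv b = N := fun s' hf => (hf.iv b hbP).trans hb
  refine (Reach.loop (fun i s' => s'.iv p = i ∧ I i s') N c hc ⟨hp, h0⟩ ?_ ?_).mono le_rfl ?_
  · intro i s' hf hI hi hT
    simp only [Test.Holds, hI.1, hb' s' hf] at hT
    exact hT
  · intro i s' hi hf hI hT
    exact hP i s' hi hf hI.2 hI.1
  · rintro s' ⟨i, hi, ⟨h1, h2⟩, hT⟩ hf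
    simp only [Test.Holds, h1, hb' s' (frame_loop.1 hf), not_lt] at hT
    obtain rfl : i = N := le_antisymm hi hT
    exact h2

/-- A sequence of instructions. -/
def block (i : Instr) : List Instr → Prog
  | [] => .instr i
  | j :: l => .seq (.instr i) (block j l)

/-- The weakest precondition of a sequence of instructions without AFMM calls. -/
def blockWP (F : BlackBox) (Q : State → Prop) : List Instr → State → Prop
  | [], s => Q s
  | i :: l, s => i.Defined s ∧ i.cost F s = 1 ∧ blockWP F Q l (i.run F s)

theorem Reach.block {F : BlackBox} {Q : State → Prop} {i : Instr} {l : List Instr} {s : State}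
    {c : ℕ} (hc : l.length + 1 ≤ c) (h : blockWP F Q (i :: l) s) :
    Reach F (block i l) s c Q := by
  induction l generalizing i s c with
  | nil => exact Reach.instr h.1 (by simp at hc; rw [h.2.1]; omega) h.2.2
  | cons j l ih =>
    obtain ⟨s', t, he, ht, hs⟩ := ih le_rfl h.2.2
    refine ⟨s', _, .seq (.instr h.1) he, ?_, hs⟩
    rw [h.2.1]; simp at hc; omega

/-! ## The program

Integer registers: `0` is `n`, `1` is `r`, `2` is `1`, `3` is `n - 1`, `4` is the depth of the
tree, `5` and `6` are loop counters, `7` is a node of the tree, `8` and `10` are temporary, `9` is a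
rank, and `11` is an index. Real registers: `0` is `ε`, `1` is `α`, `2` is the separation, `3` is
the accuracy of the AFMM calls, `4` is their bound, `5` is the final width of the bisection, `6` is
the width of the leaves of the tree, and the others are constants or temporary. Real arrays: `0` is
`z`, `1` is `d`, `2` is `B`, `3` and `5` are the left and right ends of the intervals, `4` is the
output, `6` are the poles, `7` their weights, `8` the perturbed shaft, `9` the evaluation points,
`10` the answers of the AFMM, `11` the norms and `12` the weights for a column of `B`. The integer
array `0` holds the numbers of poles below the nodes of the tree. -/

/-- An instruction that only writes a junk register. -/
def skipProg : Prog := .instr (.iconst 10 0)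

/-- The constants, and the depth of the tree. -/
def setupProg (setWidth : Instr) : Prog :=
  .seq (block (.iconst 2 1) [.isub 3 0 2, .iconst 4 0, .iconst 10 2, .rcast 8 10, .iconst 10 6,
    .rcast 7 10, .iconst 10 4, .rcast 12 10, .rcast 6 10, .iconst 10 8, .rcast 13 10,
    .iconst 10 16, .rcast 14 10, .iconst 10 32, .rcast 4 10, .iconst 10 0, .rcast 9 10,
    .iconst 10 64, .rcast 11 10, .rcast 15 0, .rop 11 .mul 11 15, .rop 2 .div 0 11,
    .rop 3 .mul 2 2, .rop 3 .mul 3 3, .rop 3 .mul 3 3, .rop 3 .mul 3 3, .rop 3 .mul 3 3,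
    setWidth, .rop 16 .div 0 14])
  (.loop (.rlt 16 6) (block (.rop 6 .div 6 8) [.iadd 4 4 2]))

/-- The insertion of the `i`-th pole into the tree: one level. -/
def insertLevelProg : Prog :=
  .seq (block (.rop 17 .mul 17 8) [.iadd 7 7 7, .iadd 8 7 2, .rcast 18 8])
  (.seq (.ite (.rlt 17 18) skipProg (.instr (.iadd 7 7 2)))
    (block (.iload 8 0 7) [.iadd 8 8 2, .istore 0 7 8, .iadd 6 6 2]))

/-- The insertion of the `i`-th pole into the tree; its perturbation, and that of the shaft. -/
def insertStepProg : Prog :=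
  .seq (block (.rload 17 1 5) [.rop 17 .add 17 7, .rop 17 .div 17 12, .iconst 7 1, .iconst 6 0])
  (.seq (.loop (.ilt 6 4) insertLevelProg)
  (.seq (block (.iload 8 0 7) [.rcast 18 8, .rop 18 .mul 18 2, .rcast 19 7, .rop 19 .mul 19 6,
    .rop 19 .sub 19 7, .rop 19 .add 19 18, .rstore 6 5 19, .rload 17 0 5])
  (.seq (.ite (.rlt 17 9) (.instr (.rop 17 .sub 17 2)) (.instr (.rop 17 .add 17 2)))
    (block (.rstore 8 5 17) [.rop 17 .mul 17 17, .rstore 7 5 17, .iadd 5 5 2]))))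

/-- The insertion of all poles. -/
def insertProg : Prog :=
  .seq (.instr (.iconst 5 0)) (.loop (.ilt 5 3) insertStepProg)

/-- One level of the search for the `k`-th smallest pole. -/
def searchLevelProg : Prog :=
  .seq (block (.iadd 7 7 7) [.iload 8 0 7])
  (.seq (.ite (.ilt 9 8) skipProg (block (.isub 9 9 8) [.iadd 7 7 2]))
    (.instr (.iadd 6 6 2)))

/-- The search for the `k`-th smallest pole. -/
def searchStepProg : Prog :=
  .seq (block (.iconst 10 0) [.iadd 9 5 10, .iconst 7 1, .iconst 6 0])
  (.seq (.loop (.ilt 6 4) searchLevelProg)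
    (block (.iadd 9 9 2) [.rcast 18 9, .rop 18 .mul 18 2, .rcast 19 7, .rop 19 .mul 19 6,
      .rop 19 .sub 19 7, .rop 19 .add 19 18, .rstore 5 5 19, .iadd 5 5 2, .rstore 3 5 19]))

/-- The initial intervals of the bisection, and an additional source of weight zero. -/
def searchProg : Prog :=
  .seq (block (.iconst 5 0) [.rop 19 .sub 9 13, .rstore 3 5 19])
  (.seq (.loop (.ilt 5 3) searchStepProg)
    (block (.rstore 5 3 13) [.rop 19 .sub 9 14, .rstore 6 3 19, .rstore 7 3 9]))

/-- The midpoint of an interval. -/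
def midpointProg : Prog :=
  block (.rload 17 3 5) [.rload 18 5 5, .rop 17 .add 17 18, .rop 17 .div 17 8, .rstore 9 5 17,
    .iadd 5 5 2]

/-- The choice of a half of an interval. -/
def halveProg : Prog :=
  .seq (block (.rload 17 9 5) [.rop 18 .sub 1 17, .rload 19 10 5, .rop 18 .add 18 19])
  (.seq (.ite (.rlt 9 18) (.instr (.rstore 3 5 17)) (.instr (.rstore 5 5 17)))
    (.instr (.iadd 5 5 2)))

/-- One round of the simultaneous bisection. -/
def bisectStepProg : Prog :=
  .seq (block (.rop 20 .div 20 8) [.iconst 5 0])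
  (.seq (.loop (.ilt 5 0) midpointProg)
  (.seq (.instr (.fmm .inv 3 4 0 0 9 7 6 10))
  (.seq (.instr (.iconst 5 0)) (.loop (.ilt 5 0) halveProg))))

/-- The simultaneous bisection. -/
def bisectProg : Prog :=
  .seq (.instr (.rop 20 .add 14 9)) (.loop (.rlt 5 20) bisectStepProg)

/-- The program for the eigenvalues. -/
def eigProg (setWidth : Instr) : Prog :=
  .seq (setupProg setWidth) (.seq insertProg (.seq searchProg bisectProg))

/-- The norm of an eigenvector. -/
def normStepProg : Prog :=
  block (.rload 17 10 5) [.rop 17 .add 17 18, .rsqrt 17 17, .rstore 11 5 17, .iadd 5 5 2]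

/-- The norms of the eigenvectors. -/
def normProg : Prog :=
  .seq (.instr (.fmm .invSq 3 4 0 0 3 7 6 10))
  (.seq (block (.iconst 5 0) [.rcast 18 2]) (.loop (.ilt 5 0) normStepProg))

/-- A weight for a column of `B`. -/
def weightStepProg : Prog :=
  block (.rload 17 8 5) [.rload 18 2 11, .rop 17 .mul 17 18, .rstore 12 5 17, .iadd 11 11 1,
    .iadd 5 5 2]

/-- An entry of a column of the output. -/
def entryStepProg : Prog :=
  block (.rload 17 10 5) [.rop 17 .add 17 19, .rload 18 11 5, .rop 17 .div 17 18, .rstore 4 11 17,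
    .iadd 11 11 1, .iadd 5 5 2]

/-- A column of the output. -/
def columnStepProg : Prog :=
  .seq (block (.rload 19 2 6) [.iadd 11 6 1, .iconst 5 0])
  (.seq (.loop (.ilt 5 3) weightStepProg)
  (.seq (.instr (.rstore 12 3 9))
  (.seq (.instr (.fmm .inv 3 4 0 0 3 12 6 10))
  (.seq (block (.iconst 5 0) [.iadd 11 6 5])
  (.seq (.loop (.ilt 5 0) entryStepProg)
    (.instr (.iadd 6 6 2)))))))

/-- The columns of the output. -/
def columnsProg : Prog :=
  .seq (.instr (.iconst 6 0)) (.loop (.ilt 6 1) columnStepProg)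

/-- The program for the diagonalization. -/
def diagProg (setWidth : Instr) : Prog :=
  .seq (eigProg setWidth) (.seq normProg columnsProg)

/-- The memory units that hold constants after the setup. -/
def constTargets : List (ℕ × ℕ) :=
  [(0, 0), (0, 1), (0, 2), (0, 3), (0, 4), (2, 1), (2, 2), (2, 3), (2, 4), (2, 5), (2, 6), (2, 7),
    (2, 8), (2, 9), (2, 12), (2, 13), (2, 14)]

/-- The constants after the setup. -/
structure Consts (m r L : ℕ) (α σ h η : ℝ) (s : State) : Prop where
  size : s.iv 0 = m + 1
  cols : s.iv 1 = r
  one : s.iv 2 = 1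
  shaft : s.iv 3 = m
  depth : s.iv 4 = L
  corner : s.rv 1 = α
  sep : s.rv 2 = σ
  acc : s.rv 3 = σ ^ 32
  bound : s.rv 4 = 32
  width : s.rv 5 = η
  cell : s.rv 6 = h
  six : s.rv 7 = 6
  two : s.rv 8 = 2
  zero : s.rv 9 = 0
  four : s.rv 12 = 4
  eight : s.rv 13 = 8
  sixteen : s.rv 14 = 16

/-- The default argument decides that the program writes none of the constants, so they are carried
through every step without proof. -/
theorem Consts.frame {m r L : ℕ} {α σ h η : ℝ} {P : Prog} {s s' : State}
    (hs : Consts m r L α σ h η s) (hf : Frame P s s')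
    (hP : ∀ x ∈ constTargets, x ∉ P.targets := by decide) : Consts m r L α σ h η s' where
  size := (hf.iv 0 (hP _ (by decide))).trans hs.size
  cols := (hf.iv 1 (hP _ (by decide))).trans hs.cols
  one := (hf.iv 2 (hP _ (by decide))).trans hs.one
  shaft := (hf.iv 3 (hP _ (by decide))).trans hs.shaft
  depth := (hf.iv 4 (hP _ (by decide))).trans hs.depth
  corner := (hf.rv 1 (hP _ (by decide))).trans hs.corner
  sep := (hf.rv 2 (hP _ (by decide))).trans hs.sep
  acc := (hf.rv 3 (hP _ (by decide))).trans hs.acc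
  bound := (hf.rv 4 (hP _ (by decide))).trans hs.bound
  width := (hf.rv 5 (hP _ (by decide))).trans hs.width
  cell := (hf.rv 6 (hP _ (by decide))).trans hs.cell
  six := (hf.rv 7 (hP _ (by decide))).trans hs.six
  two := (hf.rv 8 (hP _ (by decide))).trans hs.two
  zero := (hf.rv 9 (hP _ (by decide))).trans hs.zero
  four := (hf.rv 12 (hP _ (by decide))).trans hs.four
  eight := (hf.rv 13 (hP _ (by decide))).trans hs.eight
  sixteen := (hf.rv 14 (hP _ (by decide))).trans hs.sixteen

/-! ## The tree of dyadic intervals -/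

/-- The node of the tree at level `l` that contains `y ∈ [1, 2)`. -/
noncomputable def node (y : ℝ) (l : ℕ) : ℕ := ⌊y * 2 ^ l⌋₊

theorem node_zero {y : ℝ} (h1 : 1 ≤ y) (h2 : y < 2) : node y 0 = 1 := by
  rw [node, Nat.floor_eq_iff (by linarith)]
  constructor <;> norm_num <;> linarith

/-- Doubling a real number doubles its floor, plus one exactly if the doubled number reaches the
next odd integer. A single comparison thus replaces the real-to-integer conversion that the machine
does not have. -/
theorem node_succ {y : ℝ} (hy : 0 ≤ y) (l : ℕ) :
    node y (l + 1) = node y l + node y l +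
      (if y * 2 ^ l * 2 < (node y l + node y l + 1 : ℕ) then 0 else 1) := by
  have h0 : 0 ≤ y * 2 ^ l := by positivity
  have h1 := Nat.floor_le h0
  have h2 := Nat.lt_floor_add_one (y * 2 ^ l)
  rw [node, Nat.floor_eq_iff (by positivity), pow_succ, ← mul_assoc]
  unfold node
  split_ifs with h
  · push_cast at *
    constructor <;> linarith
  · push_cast at *
    constructor <;> linarith

theorem node_half {y : ℝ} (hy : 0 ≤ y) (l : ℕ) : node y (l + 1) / 2 = node y l := by
  rw [node_succ hy]; split_ifs <;> omega

/-- Heap numbering: the levels occupy disjoint ranges of integers, so that one array stores the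
counters of all levels. -/
theorem node_bounds {y : ℝ} (h1 : 1 ≤ y) (h2 : y < 2) (l : ℕ) :
    2 ^ l ≤ node y l ∧ node y l < 2 ^ (l + 1) := by
  have hp : (0 : ℝ) < 2 ^ l := by positivity
  constructor
  · apply Nat.le_floor; push_cast; nlinarith
  · rw [node, Nat.floor_lt (by positivity)]; push_cast; rw [pow_succ]; nlinarith

/-- The contents of the tree after the insertion of `i` points. -/
noncomputable def treeCount (y : ℕ → ℝ) (L i v : ℕ) : ℕ :=
  ∑ j ∈ Finset.range i, ∑ l ∈ Finset.range L, if node (y j) (l + 1) = v then 1 else 0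

/-- The number of a node determines its level, so only one term of the inner sum can be nonzero. -/
theorem treeCount_eq {y : ℕ → ℝ} {L m l v : ℕ} (h1 : ∀ j < m, 1 ≤ y j) (h2 : ∀ j < m, y j < 2)
    (hl : l < L) (hv : 2 ^ (l + 1) ≤ v) (hv' : v < 2 ^ (l + 2)) :
    treeCount y L m v = Nat.count (fun j => node (y j) (l + 1) = v) m := by
  rw [Nat.count_eq_card_filter_range, Finset.card_filter, treeCount]
  refine Finset.sum_congr rfl fun j hj => ?_
  rw [Finset.sum_eq_single l]
  · intro l' _ hne
    rw [if_neg]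
    rintro rfl
    obtain ⟨h3, h4⟩ := node_bounds (h1 j (Finset.mem_range.1 hj)) (h2 j (Finset.mem_range.1 hj))
      (l' + 1)
    have h5 := (Nat.pow_lt_pow_iff_right (a := 2) (by norm_num)).1 (h3.trans_lt hv')
    have h6 := (Nat.pow_lt_pow_iff_right (a := 2) (by norm_num)).1 (hv.trans_lt h4)
    omega
  · intro h; exact absurd (Finset.mem_range.2 hl) h

/-- The nodes to the left of `2 * v` are exactly the children of the nodes to the left of `v`.
Together with `count_node_split` this gives the rank update when the search moves to a child. -/
theorem count_node_even {y : ℕ → ℝ} {m l v : ℕ} (h0 : ∀ j, 0 ≤ y j) :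
    Nat.count (fun j => node (y j) (l + 1) < 2 * v) m = Nat.count (fun j => node (y j) l < v) m := by
  have : ∀ j, (node (y j) (l + 1) < 2 * v ↔ node (y j) l < v) := fun j => by
    rw [← node_half (h0 j) l]; omega
  simp only [this]

theorem count_lt_succ (g : ℕ → ℕ) (m v : ℕ) :
    Nat.count (fun j => g j < v + 1) m =
      Nat.count (fun j => g j < v) m + Nat.count (fun j => g j = v) m := by
  induction m with
  | zero => simp
  | succ m ih =>
    simp only [Nat.count_succ, ih]
    split_ifs <;> omega

theorem count_node_split {y : ℕ → ℝ} {m l v : ℕ} (h0 : ∀ j, 0 ≤ y j) :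
    Nat.count (fun j => node (y j) l = v) m = Nat.count (fun j => node (y j) (l + 1) = 2 * v) m +
      Nat.count (fun j => node (y j) (l + 1) = 2 * v + 1) m := by
  induction m with
  | zero => simp
  | succ m ih =>
    have := node_half (h0 m) l
    simp only [Nat.count_succ, ih]
    split_ifs <;> omega

/-! ## Insertion -/

theorem insertLevel_spec {F : BlackBox} {m r L : ℕ} {α σ h η : ℝ} {s : State}
    (hs : Consts m r L α σ h η s) :
    Reach F insertLevelProg s 10 (fun s' =>
      s'.iv 6 = s.iv 6 + 1 ∧ s'.rv 17 = s.rv 17 * 2 ∧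
      s'.iv 7 = s.iv 7 + s.iv 7 + (if s.rv 17 * 2 < (s.iv 7 + s.iv 7 + 1 : ℕ) then 0 else 1) ∧
      s'.im 0 = Function.update (s.im 0) (s'.iv 7) (s.im 0 (s'.iv 7) + 1)) := by
  refine Reach.seq 4 6
    (Q := fun s' => s'.rv 17 = s.rv 17 * 2 ∧ s'.iv 7 = s.iv 7 + s.iv 7 ∧
      s'.rv 18 = (s.iv 7 + s.iv 7 + 1 : ℕ))
    (Reach.block (by simp) ?_) (by simp) ?_
  · simp [blockWP, Instr.Defined, Instr.cost, Instr.run, ROp.fn, hs.two, hs.one]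
  rintro s1 ⟨h1, h2, h3⟩ hf1
  have hs1 := hs.frame hf1
  refine Reach.seq 2 4
    (Q := fun s' => s'.iv 7 =
      s.iv 7 + s.iv 7 + (if s.rv 17 * 2 < (s.iv 7 + s.iv 7 + 1 : ℕ) then 0 else 1))
    (Reach.ite 1 (by simp) ?_ ?_) (by simp) ?_
  · intro hT
    simp only [Test.Holds, h1, h3] at hT
    exact Reach.instr (by simp [Instr.Defined]) (by simp [Instr.cost])
      (by rw [if_pos hT]; simp [Instr.run, h2])
  · intro hT
    simp only [Test.Holds, h1, h3] at hT
    exact Reach.instr (by simp [Instr.Defined]) (by simp [Instr.cost])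
      (by rw [if_neg hT]; simp [Instr.run, h2, hs1.one])
  rintro s2 h4 hf2
  have hs2 := hs1.frame hf2
  refine Reach.block (by simp) ?_
  have e6 : s2.iv 6 = s.iv 6 := (hf2.iv 6 (by decide)).trans (hf1.iv 6 (by decide))
  have e17 : s2.rv 17 = s.rv 17 * 2 := (hf2.rv 17 (by decide)).trans h1
  have e0 : s2.im 0 = s.im 0 := (hf2.im 0 (by decide)).trans (hf1.im 0 (by decide))
  simp [blockWP, Instr.Defined, Instr.cost, Instr.run, hs2.one, h4, e6, e17, e0]

theorem insertLevels_spec {F : BlackBox} {m r L : ℕ} {α σ h η : ℝ} {s : State} {y : ℝ}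
    (hs : Consts m r L α σ h η s) (h6 : s.iv 6 = 0) (h7 : s.iv 7 = 1) (h17 : s.rv 17 = y)
    (h1 : 1 ≤ y) (h2 : y < 2) :
    Reach F (.loop (.ilt 6 4) insertLevelProg) s (L * 11 + 1) (fun s' =>
      s'.iv 7 = node y L ∧ ∀ v, s'.im 0 v =
        s.im 0 v + ∑ l ∈ Finset.range L, if node y (l + 1) = v then 1 else 0) := by
  -- Real register 17 carries `y * 2 ^ l`, whose floor is the current node.
  refine (Reach.count (fun l s' => s'.iv 7 = node y l ∧ s'.rv 17 = y * 2 ^ l ∧ ∀ v, s'.im 0 v =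
    s.im 0 v + ∑ l ∈ Finset.range l, if node y (l + 1) = v then 1 else 0)
    L 10 le_rfl h6 hs.depth (by decide) ⟨by rw [h7, node_zero h1 h2], by simp [h17], by simp⟩
    ?_).mono le_rfl fun s' hs' _ => ⟨hs'.1, hs'.2.2⟩
  rintro l s1 hl hf ⟨h3, h4, h5⟩ h6
  refine (insertLevel_spec (hs.frame hf)).mono le_rfl ?_
  rintro s2 ⟨e1, e2, e3, e4⟩ _
  have e5 : s2.iv 7 = node y (l + 1) := by rw [e3, h3, h4, node_succ (by linarith)]
  refine ⟨by rw [e1, h6], e5, by rw [e2, h4]; ring, fun v => ?_⟩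
  rw [e4, e5, Finset.sum_range_succ, Function.update_apply, h5, h5]
  split_ifs with h h'
  · subst h; ring
  · exact absurd h.symm h'
  · exact absurd (Eq.symm ‹_›) h
  · ring

/-- The entry `x`, moved away from zero by `σ`. -/
noncomputable def pushAway (σ x : ℝ) : ℝ := if x < 0 then x - σ else x + σ

theorem insertStep_spec {F : BlackBox} {m r L i : ℕ} {α σ h η : ℝ} {s : State} {y : ℝ}
    (hs : Consts m r L α σ h η s) (hi : s.iv 5 = i) (hy : y = (s.rm 1 i + 6) / 4)
    (h1 : 1 ≤ y) (h2 : y < 2) :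
    Reach F insertStepProg s (L * 11 + 21) (fun s' =>
      s'.iv 5 = i + 1 ∧
      (∀ v, s'.im 0 v = s.im 0 v + ∑ l ∈ Finset.range L, if node y (l + 1) = v then 1 else 0) ∧
      s'.rm 6 = Function.update (s.rm 6) i
        ((node y L : ℝ) * h - 6 + s'.im 0 (node y L) * σ) ∧
      s'.rm 8 = Function.update (s.rm 8) i (pushAway σ (s.rm 0 i)) ∧
      s'.rm 7 = Function.update (s.rm 7) i (pushAway σ (s.rm 0 i) ^ 2)) := by
  refine Reach.seq 5 (L * 11 + 16)
    (Q := fun s' => s'.rv 17 = y ∧ s'.iv 7 = 1 ∧ s'.iv 6 = 0)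
    (Reach.block (by simp) ?_) (by omega) ?_
  · simp [blockWP, Instr.Defined, Instr.cost, Instr.run, ROp.fn, hs.six, hs.four, hi, hy]
  rintro s1 ⟨a1, a2, a3⟩ hf1
  have hs1 := hs.frame hf1
  refine Reach.seq (L * 11 + 1) 15 (insertLevels_spec hs1 a3 a2 a1 h1 h2) (by omega) ?_
  rintro s2 ⟨b1, b2⟩ hf2
  have hs2 := hs1.frame hf2
  have e5 : s2.iv 5 = i := ((hf2.iv 5 (by decide)).trans (hf1.iv 5 (by decide))).trans hi
  have er : ∀ A, s2.rm A = s.rm A := fun A =>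
    (hf2.rm A (by simp [Prog.targets, insertLevelProg, block, Instr.target, skipProg])).trans
      (hf1.rm A (by simp [Prog.targets, block, Instr.target]))
  -- The counter is read after it was incremented for this point, so the first point of a leaf gets
  -- the offset `σ` and not `0`.
  refine Reach.seq 9 6
    (Q := fun s' => s'.rv 17 = s.rm 0 i ∧ s'.rm 6 = Function.update (s.rm 6) i
        ((node y L : ℝ) * h - 6 + s2.im 0 (node y L) * σ))
    (Reach.block (by simp) ?_) (by omega) ?_
  · simp [blockWP, Instr.Defined, Instr.cost, Instr.run, ROp.fn, hs2.six, hs2.cell, hs2.sep, e5,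
      b1, er]
  rintro s3 ⟨c1, c2⟩ hf3
  have hs3 := hs2.frame hf3
  refine Reach.seq 2 4 (Q := fun s' => s'.rv 17 = pushAway σ (s.rm 0 i))
    (Reach.ite 1 (by simp) ?_ ?_) (by simp) ?_
  · intro hT
    simp only [Test.Holds, c1, hs3.zero] at hT
    exact Reach.instr (by simp [Instr.Defined]) (by simp [Instr.cost])
      (by rw [pushAway, if_pos hT]; simp [Instr.run, c1, hs3.sep, ROp.fn])
  · intro hT
    simp only [Test.Holds, c1, hs3.zero] at hT
    exact Reach.instr (by simp [Instr.Defined]) (by simp [Instr.cost])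
      (by rw [pushAway, if_neg hT]; simp [Instr.run, c1, hs3.sep, ROp.fn])
  rintro s4 d1 hf4
  have hs4 := hs3.frame hf4
  have f5 : s4.iv 5 = i := ((hf4.iv 5 (by decide)).trans (hf3.iv 5 (by decide))).trans e5
  have f0 : s4.im 0 = s2.im 0 := (hf4.im 0 (by decide)).trans (hf3.im 0 (by decide))
  have f6 : s4.rm 6 = s3.rm 6 := hf4.rm 6 (by decide)
  have f7 : s4.rm 7 = s.rm 7 := ((hf4.rm 7 (by decide)).trans (hf3.rm 7 (by decide))).trans (er 7)
  have f8 : s4.rm 8 = s.rm 8 := ((hf4.rm 8 (by decide)).trans (hf3.rm 8 (by decide))).trans (er 8)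
  have b2' : ∀ v, s2.im 0 v =
      s.im 0 v + ∑ l ∈ Finset.range L, if node y (l + 1) = v then 1 else 0 := by
    rw [← hf1.im 0 (by decide)]; exact b2
  refine Reach.block (by simp) ?_
  simp only [blockWP, Instr.Defined, Instr.cost, Instr.run, ROp.fn, hs4.one, d1, f0, f5]
  refine ⟨trivial, trivial, trivial, trivial, trivial, trivial, trivial, trivial, ?_, b2', ?_, ?_, ?_⟩
  · simp
  · simp [f6, c2]
  · simp [f8]
  · simp [f7, pow_two]

theorem insert_spec {F : BlackBox} {m r L : ℕ} {α σ h η : ℝ} {s : State} {y : ℕ → ℝ}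
    (hs : Consts m r L α σ h η s) (hy : ∀ i, y i = (s.rm 1 i + 6) / 4)
    (h1 : ∀ i < m, 1 ≤ y i) (h2 : ∀ i < m, y i < 2) (h0 : ∀ v, s.im 0 v = 0) :
    Reach F insertProg s (m * (L * 11 + 22) + 2) (fun s' =>
      s'.im 0 = treeCount y L m ∧
      (∀ i < m, s'.rm 6 i =
        (node (y i) L : ℝ) * h - 6 + treeCount y L (i + 1) (node (y i) L) * σ) ∧
      (∀ i < m, s'.rm 8 i = pushAway σ (s.rm 0 i)) ∧
      ∀ i < m, s'.rm 7 i = pushAway σ (s.rm 0 i) ^ 2) := by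
  refine Reach.seq 1 (m * (L * 11 + 22) + 1) (Q := fun s' => s'.iv 5 = 0)
    (Reach.instr trivial (by simp [Instr.cost]) (by simp [Instr.run])) (by omega) ?_
  intro s1 a1 hf1
  have hs1 := hs.frame hf1
  refine (Reach.count (fun i s' => (∀ v, s'.im 0 v = treeCount y L i v) ∧
      (∀ j < i, s'.rm 6 j =
        (node (y j) L : ℝ) * h - 6 + treeCount y L (j + 1) (node (y j) L) * σ) ∧
      (∀ j < i, s'.rm 8 j = pushAway σ (s.rm 0 j)) ∧
      ∀ j < i, s'.rm 7 j = pushAway σ (s.rm 0 j) ^ 2) m (L * 11 + 21) le_rfl a1 hs1.shaft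
      (by decide) ?_ ?_).mono le_rfl fun s' hs' _ => ⟨funext hs'.1, hs'.2⟩
  · simp [hf1.im 0 (by decide), h0, treeCount]
  rintro i s2 hi hf2 ⟨b1, b2, b3, b4⟩ h5
  have er1 : s2.rm 1 = s.rm 1 := (hf2.rm 1 (by decide)).trans (hf1.rm 1 (by decide))
  have er0 : s2.rm 0 = s.rm 0 := (hf2.rm 0 (by decide)).trans (hf1.rm 0 (by decide))
  refine (insertStep_spec (hs1.frame hf2) h5 (by rw [hy, er1]) (h1 i hi) (h2 i hi)).mono le_rfl ?_
  rintro s3 ⟨c1, c2, c3, c4, c5⟩ _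
  have c2' : ∀ v, s3.im 0 v = treeCount y L (i + 1) v := fun v => by
    rw [c2, b1, treeCount, treeCount, Finset.sum_range_succ]
  refine ⟨c1, c2', ?_, ?_, ?_⟩ <;> intro j hj <;>
    [rw [c3, Function.update_apply]; rw [c4, Function.update_apply, er0];
      rw [c5, Function.update_apply, er0]] <;>
    split_ifs with h
  · rw [h, c2']
  · exact b2 j (by omega)
  · rw [h]
  · exact b3 j (by omega)
  · rw [h]
  · exact b4 j (by omega)

/-! ## Search -/

/-- The `k`-th smallest point lies in the node `v` at level `l`, with rank `q` there. -/
def HasRank (y : ℕ → ℝ) (m k l v q : ℕ) : Prop :=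
  Nat.count (fun j => node (y j) l < v) m + q = k ∧ q < Nat.count (fun j => node (y j) l = v) m

theorem HasRank.bounds {y : ℕ → ℝ} {m k l v q : ℕ} (h1 : ∀ j, 1 ≤ y j) (h2 : ∀ j, y j < 2)
    (h : HasRank y m k l v q) : 2 ^ l ≤ v ∧ v < 2 ^ (l + 1) := by
  have h3 := h.2
  rw [Nat.count_eq_card_filter_range] at h3
  obtain ⟨j, hj⟩ := Finset.card_pos.1 (Nat.zero_lt_of_lt h3)
  rw [Finset.mem_filter] at hj
  rw [← hj.2]
  exact node_bounds (h1 j) (h2 j) l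

theorem hasRank_zero {y : ℕ → ℝ} {m k : ℕ} (h1 : ∀ j, 1 ≤ y j) (h2 : ∀ j, y j < 2)
    (hk : k < m) : HasRank y m k 0 1 k := by
  have h : ∀ j, node (y j) 0 = 1 := fun j => node_zero (h1 j) (h2 j)
  simp [HasRank, h, Nat.count_true, hk]

/-- The counter of the left child is compared with the rank. A smaller rank stays unchanged on the
left; otherwise the points of the left child are passed over and their number is subtracted on the
right. -/
theorem searchLevel_spec {F : BlackBox} {m r L k l v q : ℕ} {α σ h η : ℝ} {s : State} {y : ℕ → ℝ}
    (hs : Consts m r L α σ h η s) (h1 : ∀ j, 1 ≤ y j) (h2 : ∀ j, y j < 2)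
    (ht : s.im 0 = treeCount y L m) (hl : l < L) (h7 : s.iv 7 = v) (h9 : s.iv 9 = q)
    (hr : HasRank y m k l v q) :
    Reach F searchLevelProg s 6 (fun s' =>
      s'.iv 6 = s.iv 6 + 1 ∧ HasRank y m k (l + 1) (s'.iv 7) (s'.iv 9)) := by
  have h0 : ∀ j, 0 ≤ y j := fun j => by linarith [h1 j]
  obtain ⟨hv, hv'⟩ := hr.bounds h1 h2
  have hc : s.im 0 (v + v) = Nat.count (fun j => node (y j) (l + 1) = 2 * v) m := by
    rw [ht, ← two_mul, treeCount_eq (fun j _ => h1 j) (fun j _ => h2 j) hl] <;>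
      simp only [pow_succ] at * <;> omega
  have e1 := count_node_even (m := m) (l := l) (v := v) h0
  have e2 := count_node_split (m := m) (l := l) (v := v) h0
  have e3 := count_lt_succ (fun j => node (y j) (l + 1)) m (2 * v)
  obtain ⟨hr1, hr2⟩ := hr
  refine Reach.seq 2 4
    (Q := fun s' => s'.iv 7 = v + v ∧ s'.iv 8 = s.im 0 (v + v))
    (Reach.block (by simp) ?_) (by simp) ?_
  · simp [blockWP, Instr.Defined, Instr.cost, Instr.run, h7]
  rintro s1 ⟨a1, a2⟩ hf1
  have hs1 := hs.frame hf1
  have e9 : s1.iv 9 = q := (hf1.iv 9 (by decide)).trans h9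
  refine Reach.seq 3 1
    (Q := fun s' => HasRank y m k (l + 1) (s'.iv 7) (s'.iv 9))
    (Reach.ite 2 (by simp) ?_ ?_) (by simp) ?_
  · intro hT
    simp only [Test.Holds, a2, e9, hc] at hT
    refine Reach.instr (by simp [Instr.Defined]) (by simp [Instr.cost]) ?_
    simp only [Instr.run, HasRank, Function.update_apply, a1, e9, ← two_mul]
    simp only [Nat.reduceEqDiff, if_false]
    omega
  · intro hT
    simp only [Test.Holds, a2, e9, hc] at hT
    refine Reach.block (by simp) ?_
    simp only [blockWP, Instr.Defined, Instr.cost, Instr.run, HasRank, Function.update_apply, a1,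
      a2, e9, ← two_mul, hs1.one]
    simp only [Nat.reduceEqDiff, if_false, if_true, true_and]
    rw [← two_mul] at hc
    rw [hc]
    omega
  rintro s2 b1 hf2
  have hs2 := hs1.frame hf2
  refine Reach.instr (by simp [Instr.Defined]) (by simp [Instr.cost]) ?_
  have e6 : s2.iv 6 = s.iv 6 := (hf2.iv 6 (by decide)).trans (hf1.iv 6 (by decide))
  simp [Instr.run, hs2.one, e6, b1]

theorem searchStep_spec {F : BlackBox} {m r L k : ℕ} {α σ h η : ℝ} {s : State} {y : ℕ → ℝ}
    (hs : Consts m r L α σ h η s) (h1 : ∀ j, 1 ≤ y j) (h2 : ∀ j, y j < 2)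
    (ht : s.im 0 = treeCount y L m) (hk : k < m) (h5 : s.iv 5 = k) :
    Reach F searchStepProg s (L * 7 + 15) (fun s' => s'.iv 5 = k + 1 ∧
      ∃ v q : ℕ, HasRank y m k L v q ∧
        s'.rm 5 = Function.update (s.rm 5) k ((v : ℝ) * h - 6 + (q + 1 : ℕ) * σ) ∧
        s'.rm 3 = Function.update (s.rm 3) (k + 1) ((v : ℝ) * h - 6 + (q + 1 : ℕ) * σ)) := by
  refine Reach.seq 4 (L * 7 + 11)
    (Q := fun s' => s'.iv 9 = k ∧ s'.iv 7 = 1 ∧ s'.iv 6 = 0)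
    (Reach.block (by simp) ?_) (by omega) ?_
  · simp [blockWP, Instr.Defined, Instr.cost, Instr.run, h5]
  rintro s1 ⟨a1, a2, a3⟩ hf1
  have hs1 := hs.frame hf1
  refine Reach.seq (L * 7 + 1) 10 (Q := fun s' => HasRank y m k L (s'.iv 7) (s'.iv 9)) ?_
    (by omega) ?_
  · refine (Reach.count (fun l s' => HasRank y m k l (s'.iv 7) (s'.iv 9)) L 6 le_rfl a3 hs1.depth
      (by decide) (by rw [a1, a2]; exact hasRank_zero h1 h2 hk) ?_)
    intro l s2 hl hf2 hr h6
    refine (searchLevel_spec (hs1.frame hf2) h1 h2 ?_ hl rfl rfl hr).mono le_rfl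
      fun s3 h3 _ => ⟨by rw [h3.1, h6], h3.2⟩
    rw [hf2.im 0 (by decide), hf1.im 0 (by decide), ht]
  rintro s2 hr hf2
  have hs2 := hs1.frame hf2
  have e5 : s2.iv 5 = k := ((hf2.iv 5 (by decide)).trans (hf1.iv 5 (by decide))).trans h5
  have g3 : s2.rm 3 = s.rm 3 := (hf2.rm 3 (by decide)).trans (hf1.rm 3 (by decide))
  have g5 : s2.rm 5 = s.rm 5 := (hf2.rm 5 (by decide)).trans (hf1.rm 5 (by decide))
  refine (Reach.block (by simp) (Q := fun s' => s'.iv 5 = k + 1 ∧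
    s'.rm 5 = Function.update (s.rm 5) k ((s2.iv 7 : ℝ) * h - 6 + (s2.iv 9 + 1 : ℕ) * σ) ∧
    s'.rm 3 = Function.update (s.rm 3) (k + 1)
      ((s2.iv 7 : ℝ) * h - 6 + (s2.iv 9 + 1 : ℕ) * σ)) ?_).mono le_rfl
      fun s' h' _ => ⟨h'.1, _, _, hr, h'.2⟩
  simp [blockWP, Instr.Defined, Instr.cost, Instr.run, ROp.fn, hs2.one, hs2.sep, hs2.cell, hs2.six,
    e5, g3, g5]

/-- The `m` poles cut `m + 1` intervals, but an AFMM call may not have more evaluation points than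
sources. The dummy source at `-16` of weight `0` makes up for this. The outer ends `-8` and `8`
enclose all roots. -/
theorem search_spec {F : BlackBox} {m r L : ℕ} {α σ h η : ℝ} {s : State} {y : ℕ → ℝ}
    (hs : Consts m r L α σ h η s) (h1 : ∀ j, 1 ≤ y j) (h2 : ∀ j, y j < 2)
    (ht : s.im 0 = treeCount y L m) :
    Reach F searchProg s (m * (L * 7 + 16) + 8) (fun s' =>
      (∀ k < m, ∃ v q : ℕ, HasRank y m k L v q ∧
        s'.rm 5 k = (v : ℝ) * h - 6 + (q + 1 : ℕ) * σ ∧ s'.rm 3 (k + 1) = s'.rm 5 k) ∧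
      s'.rm 3 0 = -8 ∧ s'.rm 5 m = 8 ∧ s'.rm 6 = Function.update (s.rm 6) m (-16) ∧
      s'.rm 7 = Function.update (s.rm 7) m 0) := by
  refine Reach.seq 3 (m * (L * 7 + 16) + 5)
    (Q := fun s' => s'.iv 5 = 0 ∧ s'.rm 3 0 = -8)
    (Reach.block (by simp) ?_) (by omega) ?_
  · simp [blockWP, Instr.Defined, Instr.cost, Instr.run, ROp.fn, hs.zero, hs.eight]
  rintro s1 ⟨a1, a2⟩ hf1
  have hs1 := hs.frame hf1
  refine Reach.seq (m * (L * 7 + 16) + 1) 4 (Q := fun s' => (∀ k < m, ∃ v q : ℕ,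
      HasRank y m k L v q ∧
        s'.rm 5 k = (v : ℝ) * h - 6 + (q + 1 : ℕ) * σ ∧ s'.rm 3 (k + 1) = s'.rm 5 k) ∧
      s'.rm 3 0 = -8) ?_
    (by omega) ?_
  · refine (Reach.count (fun i s' => (∀ k < i, ∃ v q : ℕ, HasRank y m k L v q ∧
        s'.rm 5 k = (v : ℝ) * h - 6 + (q + 1 : ℕ) * σ ∧ s'.rm 3 (k + 1) = s'.rm 5 k) ∧
      s'.rm 3 0 = -8) m (L * 7 + 15) le_rfl a1 hs1.shaft (by decide) ⟨by simp, a2⟩ ?_)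
    rintro i s2 hi hf2 ⟨b1, b2⟩ h5
    refine (searchStep_spec (hs1.frame hf2) h1 h2 ?_ hi h5).mono le_rfl ?_
    · rw [hf2.im 0 (by decide), hf1.im 0 (by decide), ht]
    rintro s3 ⟨c1, v, q, hr, c2, c3⟩ _
    refine ⟨c1, fun k hk => ?_, by simp [c3, b2]⟩
    by_cases hki : k = i
    · subst hki; exact ⟨v, q, hr, by simp [c2], by simp [c2, c3]⟩
    · obtain ⟨v, q, hr, d1, d2⟩ := b1 k (by omega)
      exact ⟨v, q, hr, by simp [c2, hki, d1], by simp [c2, c3, hki, d2]⟩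
  rintro s2 ⟨b1, b2⟩ hf2
  have hs2 := hs1.frame hf2
  have g6 : s2.rm 6 = s.rm 6 := (hf2.rm 6 (by decide)).trans (hf1.rm 6 (by decide))
  have g7 : s2.rm 7 = s.rm 7 := (hf2.rm 7 (by decide)).trans (hf1.rm 7 (by decide))
  refine Reach.block (by simp) ?_
  simp only [blockWP, Instr.Defined, Instr.cost, Instr.run, ROp.fn, hs2.shaft, hs2.eight, hs2.zero,
    hs2.sixteen]
  refine ⟨trivial, trivial, trivial, trivial, trivial, trivial, trivial, trivial, ?_⟩
  refine ⟨fun k hk => ?_, by simp [b2], by simp, by simp [g6], by simp [g7, hs2.zero]⟩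
  obtain ⟨v, q, hr, d1, d2⟩ := b1 k hk
  exact ⟨v, q, hr, by simp [hk.ne, d1], by simp [hk.ne, d2]⟩

/-- The point of rank `q` in a leaf is the one whose insertion is the `q + 1`-st at that leaf. -/
theorem exists_count_eq (p : ℕ → Prop) [DecidablePred p] {m q : ℕ} (hq : q < Nat.count p m) :
    ∃ i < m, p i ∧ Nat.count p i = q := by
  induction m with
  | zero => simp at hq
  | succ m ih =>
    rw [Nat.count_succ] at hq
    by_cases h : q < Nat.count p m
    · obtain ⟨i, hi, h'⟩ := ih h
      exact ⟨i, by omega, h'⟩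
    · split_ifs at hq with hp
      · exact ⟨m, by omega, hp, by omega⟩
      · omega

/-! ## Bisection -/

/-- The black box answers all queries with `n` sources and accuracy `δ` correctly, at cost at most
`Φ`. -/
def FmmBound (F : BlackBox) (n : ℕ) (δ : ℝ) (Φ : ℕ) : Prop :=
  ∀ q : Query, q.Admissible 32 1 2 → q.n = n → q.acc = δ →
    (∀ i, |F.eval q i - q.exact i| ≤ δ) ∧ F.cost q ≤ Φ

/-- An AFMM call with `n` evaluation points and `n` sources. -/
theorem fmm_spec {F : BlackBox} {n Φ : ℕ} {δ : ℝ} (hF : FmmBound F n δ Φ) {s : State} {κ : Kernel}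
    {p X W Y O : ℕ} (hn : 1 ≤ n) (hδ : 0 < δ) (hδ' : δ < 1 / 2) (h3 : s.rv 3 = δ)
    (h4 : s.rv 4 = 32) (h0 : s.iv p = n) (hX : ∀ i < n, |s.rm X i| < 32)
    (hW : ∀ i < n, |s.rm W i| < 32) (hY : ∀ i < n, |s.rm Y i| < 32)
    (hXY : ∀ i < n, ∀ j < n, δ ^ 2 ≤ |s.rm X i - s.rm Y j|) :
    Reach F (.instr (.fmm κ 3 4 p p X W Y O)) s (Φ + 1) (fun s' => ∀ i < n,
      |s'.rm O i - ∑ j ∈ Finset.range n, s.rm W j * κ.fn (s.rm X i - s.rm Y j)| ≤ δ) := by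
  subst h0
  have hn' : (1 : ℝ) ≤ s.iv p := by exact_mod_cast hn
  have hq : (s.query κ 3 4 p p X W Y).Admissible 32 1 2 := by
    refine ⟨?_, ?_, ?_, le_rfl, h4, ?_, ?_, ?_, ?_⟩ <;> simp only [State.query, h3, h4]
    · exact hδ
    · exact hδ'
    · exact hn
    · exact fun i => hX i i.2
    · exact fun i => hW i i.2
    · exact fun i => hY i i.2
    · intro i j
      -- The threshold `(δ / n) ^ 2` of the query is weaker than the separation `δ ^ 2` that is
      -- available.
      refine le_trans ?_ (hXY i i.2 j j.2)
      rw [one_mul, div_pow]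
      exact div_le_self (by positivity) (one_le_pow₀ hn')
  obtain ⟨h1, h2⟩ := hF _ hq rfl h3
  refine Reach.instr trivial (by simpa [Instr.cost] using h2) fun i hi => ?_
  have := h1 ⟨i, hi⟩
  simp only [Instr.run, Function.update_self, dif_pos hi]
  convert this using 3
  simp only [Query.exact, State.query]
  rw [Finset.sum_range]
  rfl

theorem midpoints_spec {F : BlackBox} {m r L : ℕ} {α σ h η : ℝ} {s : State}
    (hs : Consts m r L α σ h η s) (h5 : s.iv 5 = 0) :
    Reach F (.loop (.ilt 5 0) midpointProg) s ((m + 1) * 7 + 1) (fun s' =>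
      ∀ i < m + 1, s'.rm 9 i = (s.rm 3 i + s.rm 5 i) / 2) := by
  refine Reach.count (fun k s' => ∀ i < k, s'.rm 9 i = (s.rm 3 i + s.rm 5 i) / 2) (m + 1) 6
    le_rfl h5 hs.size (by decide) (by simp) ?_
  intro k s1 hk hf1 a1 e5
  have hs1 := hs.frame hf1
  have g3 : s1.rm 3 = s.rm 3 := hf1.rm 3 (by decide)
  have g5 : s1.rm 5 = s.rm 5 := hf1.rm 5 (by decide)
  refine Reach.block (by simp) ?_
  simp only [blockWP, Instr.Defined, Instr.cost, Instr.run, ROp.fn]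
  simp only [Function.update_self, ne_eq, Nat.reduceEqDiff, not_false_eq_true,
    Function.update_of_ne, e5, g3, g5, hs1.two, hs1.one, true_and]
  refine ⟨two_ne_zero, fun i hi => ?_⟩
  rw [Function.update_apply]
  split_ifs with h
  · rw [h]
  · exact a1 i (by omega)

theorem halves_spec {F : BlackBox} {m r L : ℕ} {α σ h η : ℝ} {s : State}
    (hs : Consts m r L α σ h η s) (h5 : s.iv 5 = 0) :
    Reach F (.loop (.ilt 5 0) halveProg) s ((m + 1) * 8 + 1) (fun s' => ∀ i < m + 1,
      (0 < α - s.rm 9 i + s.rm 10 i → s'.rm 3 i = s.rm 9 i ∧ s'.rm 5 i = s.rm 5 i) ∧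
      (¬ 0 < α - s.rm 9 i + s.rm 10 i → s'.rm 3 i = s.rm 3 i ∧ s'.rm 5 i = s.rm 9 i)) := by
  refine (Reach.count (fun k s' => (∀ i < k,
      (0 < α - s.rm 9 i + s.rm 10 i → s'.rm 3 i = s.rm 9 i ∧ s'.rm 5 i = s.rm 5 i) ∧
      (¬ 0 < α - s.rm 9 i + s.rm 10 i → s'.rm 3 i = s.rm 3 i ∧ s'.rm 5 i = s.rm 9 i)) ∧
      ∀ i, k ≤ i → s'.rm 3 i = s.rm 3 i ∧ s'.rm 5 i = s.rm 5 i) (m + 1) 7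
    le_rfl h5 hs.size (by decide) (by simp) ?_).mono le_rfl fun _ h _ => h.1
  rintro k s1 hk hf1 ⟨a1, a2⟩ e5
  have hs1 := hs.frame hf1
  have g9 : s1.rm 9 = s.rm 9 := hf1.rm 9 (by decide)
  have g10 : s1.rm 10 = s.rm 10 := hf1.rm 10 (by decide)
  refine Reach.seq 4 3 (Q := fun s' => s'.rv 17 = s.rm 9 k ∧
    s'.rv 18 = α - s.rm 9 k + s.rm 10 k) (Reach.block (by simp) ?_) (by simp) ?_
  · simp [blockWP, Instr.Defined, Instr.cost, Instr.run, ROp.fn, hs1.corner, e5, g9, g10]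
  rintro s2 ⟨b1, b2⟩ hf2
  have hs2 := hs1.frame hf2
  have e5' : s2.iv 5 = k := (hf2.iv 5 (by decide)).trans e5
  have g3 : s2.rm 3 = s1.rm 3 := hf2.rm 3 (by decide)
  have g5 : s2.rm 5 = s1.rm 5 := hf2.rm 5 (by decide)
  refine Reach.seq 2 1 (Q := fun s' => (∀ i, i ≠ k →
        s'.rm 3 i = s1.rm 3 i ∧ s'.rm 5 i = s1.rm 5 i) ∧
      (0 < α - s.rm 9 k + s.rm 10 k → s'.rm 3 k = s.rm 9 k ∧ s'.rm 5 k = s.rm 5 k) ∧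
      (¬ 0 < α - s.rm 9 k + s.rm 10 k → s'.rm 3 k = s.rm 3 k ∧ s'.rm 5 k = s.rm 9 k))
    (Reach.ite 1 (by simp) ?_ ?_) (by simp) ?_
  · intro hT
    simp only [Test.Holds, b2, hs2.zero] at hT
    refine Reach.instr trivial (by simp [Instr.cost]) ?_
    have := (a2 k le_rfl).2
    simp +contextual [Instr.run, hT, e5', b1, g3, g5, this]
  · intro hT
    simp only [Test.Holds, b2, hs2.zero] at hT
    refine Reach.instr trivial (by simp [Instr.cost]) ?_
    have := (a2 k le_rfl).1
    simp +contextual [Instr.run, hT, e5', b1, g3, g5, this]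
  rintro s3 ⟨c1, c2⟩ hf3
  have hs3 := hs2.frame hf3
  refine Reach.instr trivial (by simp [Instr.cost]) ?_
  have e5'' : s3.iv 5 = k := (hf3.iv 5 (by decide)).trans e5'
  simp only [Instr.run, Function.update_self, e5'', hs3.one, true_and]
  refine ⟨fun i hi => ?_, fun i hi => ?_⟩
  · by_cases h : i = k
    · rw [h]; exact c2
    · rw [(c1 i h).1, (c1 i h).2]; exact a1 i (by omega)
  · rw [(c1 i (by omega)).1, (c1 i (by omega)).2]; exact a2 i (by omega)

/-! ### Bisection of the secular function with inexact values -/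

/-- The secular function with poles `Y` and weights `W`. -/
noncomputable def secular (m : ℕ) (α : ℝ) (W Y : ℕ → ℝ) (x : ℝ) : ℝ :=
  α - x + ∑ j ∈ Finset.range (m + 1), W j * (1 / (x - Y j))

/-- The numbers `lam k` are roots of the secular function in the intervals between the poles, whose
ends are the numbers `e k`. -/
structure SecularRoots (m : ℕ) (α σ : ℝ) (e W Y lam : ℕ → ℝ) : Prop where
  gap : ∀ k ≤ m, e k + σ ≤ e (k + 1)
  lower : ∀ k ≤ m, -8 ≤ e k
  upper : ∀ k ≤ m, e (k + 1) ≤ 8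
  pole : ∀ k ≤ m, ∀ j ≤ m, ∀ x, ∀ g, e k + g ≤ x → x + g ≤ e (k + 1) → g ≤ |x - Y j|
  left : ∀ k ≤ m, ∀ x, e k < x → x ≤ lam k → lam k - x ≤ secular m α W Y x
  right : ∀ k ≤ m, ∀ x, x < e (k + 1) → lam k ≤ x → secular m α W Y x ≤ lam k - x
  mem : ∀ k ≤ m, e k ≤ lam k ∧ lam k ≤ e (k + 1)
  weight : ∀ j ≤ m, |W j| < 32
  pole_lt : ∀ j ≤ m, |Y j| < 32

/-- The interval `k` after `t` rounds of the bisection. -/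
structure IsBracket (e lam : ℕ → ℝ) (σ δ : ℝ) (t k : ℕ) (lo hi : ℝ) : Prop where
  left : e k ≤ lo
  right : hi ≤ e (k + 1)
  long : σ / 2 ^ t ≤ hi - lo
  short : hi - lo ≤ 16 / 2 ^ t
  lower : lo - δ ≤ lam k
  upper : lam k ≤ hi + δ

/-- If the computed value is positive but the root lies below `x - δ`, then slope at most `-1` gives
a true value below `-δ`, so the computed value is negative, a contradiction. The other half is
symmetric. The slack `δ` is the same after every round. -/
theorem IsBracket.halve {m t k : ℕ} {α σ δ lo hi x g : ℝ} {e W Y lam : ℕ → ℝ}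
    (hr : SecularRoots m α σ e W Y lam) (h : IsBracket e lam σ δ t k lo hi) (hk : k ≤ m)
    (hσ : 0 < σ) (hx : x = (lo + hi) / 2)
    (hg : |g - ∑ j ∈ Finset.range (m + 1), W j * Kernel.inv.fn (x - Y j)| ≤ δ) :
    (0 < α - x + g → IsBracket e lam σ δ (t + 1) k x hi) ∧
    (¬ 0 < α - x + g → IsBracket e lam σ δ (t + 1) k lo x) := by
  have hp : (0 : ℝ) < σ / 2 ^ t := by positivity
  obtain ⟨h1, h2, h3, h4, h5, h6⟩ := h
  have e1 : σ / 2 ^ (t + 1) = σ / 2 ^ t / 2 := by rw [pow_succ]; field_simp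
  have e2 : (16 : ℝ) / 2 ^ (t + 1) = 16 / 2 ^ t / 2 := by rw [pow_succ]; field_simp
  have hg' := abs_le.1 hg
  have hf : secular m α W Y x =
    α - x + ∑ j ∈ Finset.range (m + 1), W j * Kernel.inv.fn (x - Y j) := rfl
  have hl := hr.left k hk x (by linarith)
  have hr := hr.right k hk x (by linarith)
  refine ⟨fun h0 => ⟨by linarith, h2, by rw [e1]; linarith, by rw [e2]; linarith, ?_, h6⟩,
    fun h0 => ⟨h1, by linarith, by rw [e1]; linarith, by rw [e2]; linarith, h5, ?_⟩⟩
  · by_contra! hc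
    have := hr (by linarith [(abs_nonneg _).trans hg])
    linarith
  · by_contra! hc
    have := hl (by linarith [(abs_nonneg _).trans hg])
    linarith

theorem bisectStep_spec {F : BlackBox} {m r L t Φ : ℕ} {α σ h η : ℝ} {s : State}
    {e W Y lam : ℕ → ℝ} (hs : Consts m r L α σ h η s) (hF : FmmBound F (m + 1) (σ ^ 32) Φ)
    (hr : SecularRoots m α σ e W Y lam) (hσ : 0 < σ) (hσ' : σ ≤ 1 / 32) (hη : σ ^ 32 ≤ η)
    (ht : η < 16 / 2 ^ t) (h6 : ∀ j ≤ m, s.rm 6 j = Y j) (h7 : ∀ j ≤ m, s.rm 7 j = W j)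
    (hb : ∀ k ≤ m, IsBracket e lam σ (σ ^ 32) t k (s.rm 3 k) (s.rm 5 k)) :
    Reach F bisectStepProg s (Φ + 15 * (m + 1) + 6) (fun s' => s'.rv 20 = s.rv 20 / 2 ∧
      ∀ k ≤ m, IsBracket e lam σ (σ ^ 32) (t + 1) k (s'.rm 3 k) (s'.rm 5 k)) := by
  refine Reach.seq 2 (Φ + 15 * (m + 1) + 4) (Q := fun s' => s'.rv 20 = s.rv 20 / 2 ∧ s'.iv 5 = 0)
    (Reach.block (by simp) ?_) (by omega) ?_
  · simp [blockWP, Instr.Defined, Instr.cost, Instr.run, ROp.fn, hs.two]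
  rintro s1 ⟨a1, a2⟩ hf1
  have hs1 := hs.frame hf1
  refine Reach.seq _ (Φ + 8 * (m + 1) + 3) (midpoints_spec hs1 a2) (by omega) ?_
  rintro s2 b1 hf2
  have hs2 := hs1.frame hf2
  have g1 : ∀ A, s1.rm A = s.rm A := fun A =>
    hf1.rm A (by simp [Prog.targets, block, Instr.target])
  have g2 : ∀ A, A ≠ 9 → s2.rm A = s.rm A := fun A hA =>
    (hf2.rm A (by simp [midpointProg, Prog.targets, block, Instr.target, hA])).trans (g1 A)
  rw [g1, g1] at b1
  have hδ : 0 < σ ^ 32 := by positivity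
  have hδ' : σ ^ 32 < 1 / 2 :=
    (pow_le_pow_left₀ hσ.le hσ' 32).trans_lt (by norm_num)
  -- An interval that is still being halved has `2 ^ (-t) > σ ^ 32 / 16`, so its midpoint is at
  -- least `σ ^ 33 / 32 ≥ σ ^ 34` away from the ends. The AFMM needs only `δ ^ 2 = σ ^ 64`.
  have hx : ∀ k ≤ m, e k + σ ^ 64 ≤ s2.rm 9 k ∧ s2.rm 9 k + σ ^ 64 ≤ e (k + 1) := by
    intro k hk
    obtain ⟨h1, h2, h3, -, -, -⟩ := hb k hk
    rw [b1 k (by omega)]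
    have : σ ^ 64 ≤ σ / 2 ^ t / 2 := by
      have h4 : σ ^ 32 / 16 ≤ 1 / 2 ^ t := by
        have : (16 : ℝ) / 2 ^ t = 16 * (1 / 2 ^ t) := by ring
        linarith
      have h5 : σ ^ 64 ≤ σ ^ 34 := pow_le_pow_of_le_one hσ.le (by linarith) (by norm_num)
      have h6 : σ ^ 34 = σ ^ 32 * σ * σ := by ring
      have h7 : σ ^ 32 * σ * σ ≤ σ ^ 32 * σ * (1 / 32) :=
        mul_le_mul_of_nonneg_left hσ' (by positivity)
      have h8 : σ ^ 32 / 16 * σ ≤ 1 / 2 ^ t * σ := mul_le_mul_of_nonneg_right h4 hσ.le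
      have h9 : σ / 2 ^ t = 1 / 2 ^ t * σ := by ring
      rw [h9]; linarith
    constructor <;> linarith
  refine Reach.seq (Φ + 1) (8 * (m + 1) + 2)
    (fmm_spec hF (by omega) hδ hδ' hs2.acc hs2.bound hs2.size ?_ ?_ ?_ ?_) (by omega) ?_
  · intro k hk
    have h1 := hx k (by omega)
    have h2 := hr.lower k (by omega)
    have h3 := hr.upper k (by omega)
    have : 0 < σ ^ 64 := by positivity
    rw [abs_lt]; constructor <;> linarith
  · intro j hj; rw [g2 7 (by norm_num), h7 j (by omega)]; exact hr.weight j (by omega)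
  · intro j hj; rw [g2 6 (by norm_num), h6 j (by omega)]; exact hr.pole_lt j (by omega)
  · intro k hk j hj
    rw [g2 6 (by norm_num), h6 j (by omega), ← pow_mul]
    exact hr.pole k (by omega) j (by omega) _ _ (hx k (by omega)).1 (hx k (by omega)).2
  rintro s3 c1 hf3
  have hs3 := hs2.frame hf3
  refine Reach.seq 1 (8 * (m + 1) + 1)  (Q := fun s' => s'.iv 5 = 0)
    (Reach.instr trivial (by simp [Instr.cost]) (by simp [Instr.run])) (by omega) ?_
  intro s4 d1 hf4
  have hs4 := hs3.frame hf4
  refine (halves_spec hs4 d1).mono (by omega) ?_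
  intro s5 h5 hf5
  refine ⟨?_, fun k hk => ?_⟩
  · rw [hf5.rv 20 (by decide), hf4.rv 20 (by decide), hf3.rv 20 (by decide),
      hf2.rv 20 (by decide), a1]
  have k3 : s4.rm 3 = s.rm 3 := by
    rw [hf4.rm 3 (by decide), hf3.rm 3 (by decide), g2 3 (by norm_num)]
  have k5 : s4.rm 5 = s.rm 5 := by
    rw [hf4.rm 5 (by decide), hf3.rm 5 (by decide), g2 5 (by norm_num)]
  have k9 : s4.rm 9 = s2.rm 9 := by
    rw [hf4.rm 9 (by decide), hf3.rm 9 (by decide)]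
  have k10 : s4.rm 10 = s3.rm 10 := hf4.rm 10 (by decide)
  have := h5 k (by omega)
  rw [k3, k5, k9, k10] at this
  obtain ⟨h1, h2⟩ := IsBracket.halve hr (hb k hk) hk hσ (b1 k (by omega)) (g := s3.rm 10 k) (by
    refine le_trans (le_of_eq ?_) (c1 k (by omega))
    congr 2
    refine Finset.sum_congr rfl fun j hj => ?_
    rw [Finset.mem_range] at hj
    rw [g2 6 (by norm_num), g2 7 (by norm_num), h6 j (by omega), h7 j (by omega)])
  by_cases hc : 0 < α - s2.rm 9 k + s3.rm 10 k
  · rw [(this.1 hc).1, (this.1 hc).2]; exact h1 hc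
  · rw [(this.2 hc).1, (this.2 hc).2]; exact h2 hc

theorem bisect_spec {F : BlackBox} {m r L N Φ : ℕ} {α σ h η : ℝ} {s : State}
    {e W Y lam : ℕ → ℝ} (hs : Consts m r L α σ h η s) (hF : FmmBound F (m + 1) (σ ^ 32) Φ)
    (hr : SecularRoots m α σ e W Y lam) (hσ : 0 < σ) (hσ' : σ ≤ 1 / 32) (hη : σ ^ 32 ≤ η)
    (hN : 16 / 2 ^ N ≤ η) (h6 : ∀ j ≤ m, s.rm 6 j = Y j) (h7 : ∀ j ≤ m, s.rm 7 j = W j)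
    (h3 : ∀ k ≤ m, s.rm 3 k = e k) (h5 : ∀ k ≤ m, s.rm 5 k = e (k + 1)) :
    Reach F bisectProg s (N * (Φ + 15 * (m + 1) + 7) + 2) (fun s' =>
      ∀ k ≤ m, |s'.rm 3 k - lam k| ≤ η + σ ^ 32) := by
  refine Reach.seq 1 (N * (Φ + 15 * (m + 1) + 7) + 1) (Q := fun s' => s'.rv 20 = 16)
    (Reach.instr trivial (by simp [Instr.cost])
      (by simp [Instr.run, ROp.fn, hs.zero, hs.sixteen])) (by omega) ?_
  rintro s1 a1 hf1
  have hs1 := hs.frame hf1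
  have hδ : 0 < σ ^ 32 := by positivity
  -- Real register 20 is a common upper bound for the lengths of all intervals. The loop stops once
  -- it is at most `η`, and then the left end is within `η + σ ^ 32` of the root.
  refine (Reach.loop (fun t s' => s'.rv 20 = 16 / 2 ^ t ∧
    ∀ k ≤ m, IsBracket e lam σ (σ ^ 32) t k (s'.rm 3 k) (s'.rm 5 k)) N
    (Φ + 15 * (m + 1) + 6) le_rfl ⟨by simp [a1], fun k hk => ?_⟩ ?_ ?_).mono le_rfl ?_
  · rw [hf1.rm 3 (by decide), hf1.rm 5 (by decide), h3 k hk, h5 k hk]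
    have := hr.gap k hk
    have := hr.mem k hk
    have := hr.lower k hk
    have := hr.upper k hk
    constructor <;> linarith
  · rintro t s2 hf2 ⟨h1, -⟩ ht hT
    have hs2 := hs1.frame hf2
    simp only [Test.Holds, h1, hs2.width] at hT
    refine lt_of_le_of_ne ht ?_
    rintro rfl
    linarith
  · rintro t s2 ht hf2 ⟨h1, h2⟩ hT
    have hs2 := hs1.frame hf2
    simp only [Test.Holds, h1, hs2.width] at hT
    refine (bisectStep_spec hs2 hF hr hσ hσ' hη hT ?_ ?_ h2).mono le_rfl
      fun s3 hs3 _ => ⟨by rw [hs3.1, h1, pow_succ]; field_simp, hs3.2⟩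
    · rw [hf2.rm 6 (by decide), hf1.rm 6 (by decide)]; exact h6
    · rw [hf2.rm 7 (by decide), hf1.rm 7 (by decide)]; exact h7
  · rintro s2 ⟨t, ht, ⟨h1, h2⟩, hT⟩ hf2 k hk
    have hs2 := hs1.frame hf2
    simp only [Test.Holds, h1, hs2.width, not_lt] at hT
    obtain ⟨-, -, c3, c4, c5, c6⟩ := h2 k hk
    have : 0 < σ / 2 ^ t := by positivity
    rw [abs_le]; constructor <;> linarith

/-! ## Setup -/

theorem setup_spec {F : BlackBox} {m r N : ℕ} {ε α σ η : ℝ} {s : State} {w : Instr}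
    (h0 : s.iv 0 = m + 1) (h1 : s.iv 1 = r) (k0 : s.rv 0 = ε) (k1 : s.rv 1 = α)
    (hε' : ε ≤ 1) (hσ : σ = ε / (64 * (m + 1)))
    (hw : w = .rop 5 .div 0 13 ∧ η = ε / 8 ∨ w = .rop 5 .add 3 9 ∧ η = σ ^ 32)
    (hN : 4 / 2 ^ N ≤ ε / 16) :
    Reach F (setupProg w) s (N * 3 + 31) (fun s' => ∃ L ≤ N,
      Consts m r L α σ (4 / 2 ^ L) η s' ∧ 4 / 2 ^ L ≤ ε / 16 ∧ ε / 32 < 4 / 2 ^ L) := by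
  have hm : (64 : ℝ) * (m + 1) ≠ 0 := by positivity
  refine Reach.seq 30 (N * 3 + 1)
    (Q := fun s' => Consts m r 0 α σ 4 η s' ∧ s'.rv 16 = ε / 16)
    (Reach.block (by simp) ?_) (by omega) ?_
  · rcases hw with ⟨rfl, rfl⟩ | ⟨rfl, rfl⟩
    · simp [blockWP, Instr.Defined, Instr.cost, Instr.run, ROp.fn, h0, k0]
      refine ⟨by positivity, ?_⟩
      constructor <;> simp [h0, h1, k1, hσ]
      ring
    · simp [blockWP, Instr.Defined, Instr.cost, Instr.run, ROp.fn, h0, k0]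
      refine ⟨by positivity, ?_⟩
      constructor <;> simp [h0, h1, k1, hσ] <;> ring
  rintro s1 ⟨hs1, a1⟩ hf1
  -- The cell width is halved until it is at most `ε / 16`, so it stays above `ε / 32`. The upper
  -- bound limits the perturbation of the poles; the lower bound leaves room for all offsets in half
  -- a cell.
  refine (Reach.loop (fun t s' => s'.iv 4 = t ∧ s'.rv 6 = 4 / 2 ^ t ∧ ε / 32 < 4 / 2 ^ t) N 2
    le_rfl ⟨hs1.depth, by simp [hs1.cell], by norm_num; linarith⟩ ?_ ?_).mono le_rfl ?_
  · rintro t s2 hf2 ⟨-, b1, -⟩ ht hT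
    simp only [Test.Holds, b1, hf2.rv 16 (by decide), a1] at hT
    refine lt_of_le_of_ne ht ?_
    rintro rfl
    linarith
  · rintro t s2 ht hf2 ⟨b1, b2, b3⟩ hT
    simp only [Test.Holds, b2, hf2.rv 16 (by decide), a1] at hT
    have c1 : s2.rv 8 = 2 := (hf2.rv 8 (by decide)).trans hs1.two
    have c2 : s2.iv 2 = 1 := (hf2.iv 2 (by decide)).trans hs1.one
    have e : (4 : ℝ) / 2 ^ (t + 1) = 4 / 2 ^ t / 2 := by rw [pow_succ]; field_simp
    refine Reach.block (by simp) ?_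
    simp [blockWP, Instr.Defined, Instr.cost, Instr.run, ROp.fn, b1, b2, c1, c2, e]
    linarith
  · rintro s2 ⟨t, ht, ⟨b1, b2, b3⟩, hT⟩ hf
    have hf2 := frame_loop.1 hf
    simp only [Test.Holds, b2, hf2.rv 16 (by decide), a1, not_lt] at hT
    refine ⟨t, ht, ?_, hT, b3⟩
    have iv : ∀ a, a ≠ 4 → s2.iv a = s1.iv a := fun a ha =>
      hf2.iv a (by simp [Prog.targets, block, Instr.target, ha])
    have rv : ∀ a, a ≠ 6 → s2.rv a = s1.rv a := fun a ha =>
      hf2.rv a (by simp [Prog.targets, block, Instr.target, ha])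
    constructor
    any_goals assumption
    all_goals first | rw [iv _ (by norm_num)] | rw [rv _ (by norm_num)]
    exacts [hs1.size, hs1.cols, hs1.one, hs1.shaft, hs1.corner, hs1.sep, hs1.acc, hs1.bound,
      hs1.width, hs1.six, hs1.two, hs1.zero, hs1.four, hs1.eight, hs1.sixteen]

/-! ## Perturbed poles -/

/-- The poles: the `c`-th point of the leaf `g` is moved to distance `(c + 1) * σ` from the left end
of that leaf. -/
noncomputable def spread (g : ℕ → ℕ) (h σ : ℝ) (i : ℕ) : ℝ :=
  (g i : ℝ) * h - 6 + (Nat.count (fun j => g j = g i) i + 1 : ℕ) * σ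

/-- Within a leaf the offsets grow by at least `σ` from one insertion to the next. Across leaves,
the offset of `i` is at most `m * σ`, hence less than half a cell, while the next leaf starts a full
cell further on and its offsets are positive. -/
theorem spread_lt {g : ℕ → ℕ} {h σ : ℝ} {m i j : ℕ} (hσ : 0 < σ) (hm : (m + 1) * σ ≤ h / 2)
    (hi : i < m) (hij : g i < g j ∨ g i = g j ∧ i < j) :
    spread g h σ i + σ ≤ spread g h σ j := by
  have hc : ∀ k, (0 : ℝ) ≤ Nat.count (fun j => g j = g k) k := fun k => by positivity
  unfold spread
  rcases hij with hij | ⟨hij, hlt⟩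
  · have h1 : (g i : ℝ) + 1 ≤ g j := by exact_mod_cast hij
    have h2 : (Nat.count (fun j => g j = g i) i : ℝ) + 1 ≤ m := by
      have := Nat.count_le (p := fun j => g j = g i) (n := i)
      exact_mod_cast (by omega : Nat.count (fun j => g j = g i) i + 1 ≤ m)
    have h3 := hc j
    have h4 : 0 < h := by nlinarith [(Nat.cast_nonneg m : (0 : ℝ) ≤ m)]
    push_cast
    nlinarith
  · have h1 : Nat.count (fun k => g k = g i) i + 1 ≤ Nat.count (fun k => g k = g i) j :=
      Nat.count_strict_mono rfl hlt
    have h2 : (Nat.count (fun k => g k = g i) i : ℝ) + 1 ≤ Nat.count (fun k => g k = g j) j := by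
      rw [← hij]; exact_mod_cast h1
    rw [hij] at h2 ⊢
    push_cast
    nlinarith

/-- The perturbed poles are ordered lexicographically by leaf and insertion time, which is the order
that the tree search uses. -/
theorem spread_lt_iff {g : ℕ → ℕ} {h σ : ℝ} {m i j : ℕ} (hσ : 0 < σ) (hm : (m + 1) * σ ≤ h / 2)
    (hi : i < m) (hj : j < m) :
    spread g h σ i < spread g h σ j ↔ g i < g j ∨ g i = g j ∧ i < j := by
  refine ⟨fun hlt => ?_, fun hij => by linarith [spread_lt hσ hm hi hij]⟩
  by_contra hc
  rcases eq_or_ne i j with rfl | hne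
  · exact lt_irrefl _ hlt
  · have := spread_lt (g := g) hσ hm hj (j := i) (by omega)
    linarith

theorem spread_gap {g : ℕ → ℕ} {h σ : ℝ} {m i j : ℕ} (hσ : 0 < σ) (hm : (m + 1) * σ ≤ h / 2)
    (hi : i < m) (hj : j < m) (hlt : spread g h σ i < spread g h σ j) :
    spread g h σ i + σ ≤ spread g h σ j :=
  spread_lt hσ hm hi ((spread_lt_iff hσ hm hi hj).1 hlt)

/-- The rank of a pole among all perturbed poles splits into the points in earlier leaves and the
earlier insertions in the same leaf. These are the two quantities recorded by `HasRank`. -/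
theorem count_spread {g : ℕ → ℕ} {h σ : ℝ} {m i : ℕ} (hσ : 0 < σ) (hm : (m + 1) * σ ≤ h / 2)
    (hi : i < m) : ((Finset.range m).filter fun j => spread g h σ j < spread g h σ i).card =
      Nat.count (fun j => g j < g i) m + Nat.count (fun j => g j = g i) i := by
  rw [Nat.count_eq_card_filter_range, Nat.count_eq_card_filter_range,
    ← Finset.card_union_of_disjoint]
  · congr 1
    ext j
    simp only [Finset.mem_filter, Finset.mem_range, Finset.mem_union]
    constructor
    · rintro ⟨hj, hlt⟩
      rcases (spread_lt_iff hσ hm hj hi).1 hlt with h1 | h1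
      · exact .inl ⟨hj, h1⟩
      · exact .inr ⟨h1.2, h1.1⟩
    · rintro (⟨hj, h1⟩ | ⟨hj, h1⟩)
      · exact ⟨hj, (spread_lt_iff hσ hm hj hi).2 (.inl h1)⟩
      · exact ⟨by omega, (spread_lt_iff hσ hm (by omega) hi).2 (.inr ⟨h1, hj⟩)⟩
  · rw [Finset.disjoint_left]
    intro j h1 h2
    rw [Finset.mem_filter] at h1 h2
    omega

/-- The ends of the intervals between the poles `D i`. -/
structure IsLadder (m : ℕ) (σ : ℝ) (e D : ℕ → ℝ) : Prop where
  first : e 0 = -8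
  last : e (m + 1) = 8
  eq : ∀ k < m, ∃ i < m, e (k + 1) = D i
  gap : ∀ k ≤ m, e k + σ ≤ e (k + 1)
  avoid : ∀ k ≤ m, ∀ i < m, D i ≤ e k ∨ e (k + 1) ≤ D i

/-- The number of smaller poles is strictly monotone in the pole. Hence listing the poles by this
number sorts them, and no pole fits strictly between two consecutive ones. -/
theorem isLadder_of_rank {m : ℕ} {σ : ℝ} {e D : ℕ → ℝ} (hσ : σ ≤ 1) (first : e 0 = -8)
    (last : e (m + 1) = 8) (hD : ∀ i < m, |D i| ≤ 2)
    (hgap : ∀ i < m, ∀ j < m, D i < D j → D i + σ ≤ D j)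
    (hr : ∀ k < m, ∃ i < m, e (k + 1) = D i ∧
      ((Finset.range m).filter fun j => D j < D i).card = k) : IsLadder m σ e D := by
  have hmono : ∀ i < m, ∀ j, D i ≤ D j → ((Finset.range m).filter fun k => D k < D i).card ≤
      ((Finset.range m).filter fun k => D k < D j).card := fun i _ j hij =>
    Finset.card_le_card (Finset.monotone_filter_right _ fun k _ hk => lt_of_lt_of_le hk hij)
  have hstrict : ∀ i < m, ∀ j, D i < D j → ((Finset.range m).filter fun k => D k < D i).card <
      ((Finset.range m).filter fun k => D k < D j).card := fun i hi j hij =>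
    Finset.card_lt_card ⟨Finset.monotone_filter_right _ fun k _ hk => lt_trans hk hij, fun h => by
      have := h (Finset.mem_filter.2 ⟨Finset.mem_range.2 hi, hij⟩)
      simp at this⟩
  have hlt : ∀ i < m, ((Finset.range m).filter fun k => D k < D i).card < m := fun i hi => by
    refine lt_of_lt_of_eq (Finset.card_lt_card ⟨Finset.filter_subset _ _, fun h => ?_⟩)
      (Finset.card_range m)
    have := h (Finset.mem_range.2 hi)
    simp at this
  have hd : ∀ i < m, -2 ≤ D i ∧ D i ≤ 2 := fun i hi => abs_le.1 (hD i hi)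
  refine ⟨first, last, fun k hk => (hr k hk).imp fun i hi => ⟨hi.1, hi.2.1⟩, fun k hk => ?_,
    fun k hk j hj => ?_⟩
  · rcases hk.lt_or_eq with hk' | rfl
    · obtain ⟨i, hi, h1, h2⟩ := hr k hk'
      rw [h1]
      rcases k with _ | k
      · rw [first]; linarith [(hd i hi).1]
      · obtain ⟨i', hi', h1', h2'⟩ := hr k (by omega)
        rw [h1']
        refine hgap _ hi' _ hi ?_
        by_contra! hc
        have := hmono i hi i' hc
        omega
    · rw [last]
      rcases k with _ | k
      · rw [first]; linarith
      · obtain ⟨i', hi', h1', h2'⟩ := hr k (by omega)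
        rw [h1']; linarith [(hd i' hi').2]
  -- A pole strictly between the two ends would have rank at least `k`, as it exceeds the pole of
  -- rank `k - 1`, and less than `k`, as it is below the pole of rank `k`.
  · by_contra! hc
    obtain ⟨h1, h2⟩ := hc
    have hge : k ≤ ((Finset.range m).filter fun k => D k < D j).card := by
      rcases k with _ | k
      · omega
      · obtain ⟨i', hi', h1', h2'⟩ := hr k (by omega)
        rw [h1'] at h1
        have := hstrict i' hi' j h1
        omega
    rcases hk.lt_or_eq with hk' | rfl
    · obtain ⟨i, hi, h1', h2'⟩ := hr k hk'
      rw [h1'] at h2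
      have := hstrict j hj i h2
      omega
    · have := hlt j hj
      omega

/-- The counter includes the point itself, whence the `+ 1` in `spread`. The root has no counter, so
the leaves must lie strictly below it. -/
theorem treeCount_spread {y : ℕ → ℝ} {L i : ℕ} {h σ : ℝ} (h1 : ∀ j, 1 ≤ y j) (h2 : ∀ j, y j < 2)
    (hL : 0 < L) : (node (y i) L : ℝ) * h - 6 + treeCount y L (i + 1) (node (y i) L) * σ =
      spread (fun j => node (y j) L) h σ i := by
  obtain ⟨l, rfl⟩ : ∃ l, L = l + 1 := ⟨L - 1, by omega⟩
  obtain ⟨hv, hv'⟩ := node_bounds (h1 i) (h2 i) (l + 1)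
  rw [treeCount_eq (fun j _ => h1 j) (fun j _ => h2 j) (Nat.lt_succ_self l) hv hv', Nat.count_succ,
    if_pos rfl]
  rfl

/-- The left end of the leaf is less than one cell below `4 * y i - 6`, and the offset is at most
half a cell. -/
theorem spread_near {y : ℕ → ℝ} {L i m : ℕ} {σ : ℝ} (hy : 0 ≤ y i) (hσ : 0 < σ) (hi : i < m)
    (hm : (m + 1) * σ ≤ 4 / 2 ^ L / 2) :
    |spread (fun j => node (y j) L) (4 / 2 ^ L) σ i - (4 * y i - 6)| ≤ 4 / 2 ^ L := by
  have h1 := Nat.floor_le (a := y i * 2 ^ L) (by positivity)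
  have h2 := Nat.lt_floor_add_one (y i * 2 ^ L)
  have hp : (0 : ℝ) < 4 / 2 ^ L := by positivity
  have e : y i * 2 ^ L * (4 / 2 ^ L) = 4 * y i := by field_simp
  have h3 := mul_le_mul_of_nonneg_right h1 hp.le
  have h4 := mul_le_mul_of_nonneg_right h2.le hp.le
  rw [e] at h3 h4
  have h5 : (Nat.count (fun j => node (y j) L = node (y i) L) i : ℝ) + 1 ≤ m := by
    have := Nat.count_le (p := fun j => node (y j) L = node (y i) L) (n := i)
    exact_mod_cast (by omega : Nat.count (fun j => node (y j) L = node (y i) L) i + 1 ≤ m)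
  have h6 : (0 : ℝ) ≤ Nat.count (fun j => node (y j) L = node (y i) L) i := by positivity
  unfold spread
  unfold node at *
  push_cast
  have h7 := mul_le_mul_of_nonneg_right h5 hσ.le
  have h8 := mul_nonneg h6 hσ.le
  rw [abs_le]; constructor <;> nlinarith

theorem isLadder_spread {y : ℕ → ℝ} {L m : ℕ} {h σ : ℝ} {e : ℕ → ℝ} (hσ : 0 < σ) (hσ' : σ ≤ 1)
    (hm : (m + 1) * σ ≤ h / 2) (hD : ∀ i < m, |spread (fun j => node (y j) L) h σ i| ≤ 2)
    (first : e 0 = -8) (last : e (m + 1) = 8)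
    (hr : ∀ k < m, ∃ v q : ℕ, HasRank y m k L v q ∧
      e (k + 1) = (v : ℝ) * h - 6 + (q + 1 : ℕ) * σ) :
    IsLadder m σ e (spread (fun j => node (y j) L) h σ) := by
  refine isLadder_of_rank hσ' first last hD
    (fun i hi j hj hlt => spread_gap hσ hm hi hj hlt) fun k hk => ?_
  obtain ⟨v, q, ⟨h1, h2⟩, h3⟩ := hr k hk
  obtain ⟨i, hi, h4, h5⟩ := exists_count_eq _ h2
  refine ⟨i, hi, ?_, ?_⟩
  · rw [h3, spread, h4, h5]
  · rw [count_spread hσ hm hi, h4, h5, h1]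

/-! ## Roots of the secular function -/

/-- The reflection exchanges left and right ends, so that the sign needs to be estimated only near
left ends. -/
theorem secular_neg (m : ℕ) (α : ℝ) (W Y : ℕ → ℝ) (x : ℝ) :
    secular m (-α) W (fun j => -Y j) (-x) = -secular m α W Y x := by
  have : ∀ j, W j * (1 / (-x - -Y j)) = -(W j * (1 / (x - Y j))) := fun j => by
    rw [show -x - -Y j = -(x - Y j) by ring, div_neg]; ring
  simp only [secular, this, Finset.sum_neg_distrib]
  ring

/-- Next to a pole its own term is at least `σ ^ 2 / σ ^ 4`, while the poles to the right are at
distance at least `σ / 2` and contribute at least `-8 / σ`; since `1 / σ ≥ 128`, the first term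
wins. Next to `-8` the part `α - x` exceeds `6`, and the sum is at least `-4`. Poles of weight zero
are exempt because of the dummy source. -/
theorem secular_pos {m : ℕ} {α σ a x : ℝ} {W Y : ℕ → ℝ} (hα : |α| ≤ 1)
    (hW : ∀ j ≤ m, 0 ≤ W j) (hsum : ∑ j ∈ Finset.range (m + 1), W j ≤ 4) (hσ : 0 < σ)
    (hσ' : σ ≤ 1 / 128) (hx : x ≤ 8) (hax : a < x) (hxa : x ≤ a + σ ^ 4)
    (ha : a = -8 ∧ (∀ j ≤ m, W j ≠ 0 → -2 ≤ Y j) ∨ ∃ i ≤ m, Y i = a ∧ σ ^ 2 ≤ W i)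
    (hgap : ∀ j ≤ m, W j ≠ 0 → Y j ≤ a ∨ a + σ ≤ Y j) : 0 < secular m α W Y x := by
  have hα := abs_le.1 hα
  have h4 : σ ^ 4 ≤ σ / 2 := by
    have : σ ^ 3 ≤ (1 / 128) ^ 3 := pow_le_pow_left₀ hσ.le hσ' 3
    have : σ ^ 4 = σ * σ ^ 3 := by ring
    nlinarith
  unfold secular
  rcases ha with ⟨rfl, ha⟩ | ⟨i, hi, rfl, ha⟩
  · have : ∑ j ∈ Finset.range (m + 1), W j * (-1) ≤
        ∑ j ∈ Finset.range (m + 1), W j * (1 / (x - Y j)) := by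
      refine Finset.sum_le_sum fun j hj => ?_
      have hj : j ≤ m := by rw [Finset.mem_range] at hj; omega
      by_cases h0 : W j = 0
      · simp [h0]
      refine mul_le_mul_of_nonneg_left ?_ (hW j hj)
      have := ha j hj h0
      rw [le_div_iff_of_neg (by linarith)]
      linarith
    rw [← Finset.sum_mul] at this
    linarith
  -- Adding `2 / σ` makes every term nonnegative, so the term of the adjacent pole can be singled
  -- out from the sum.
  · have hpos : ∀ j ≤ m, 0 ≤ W j * (1 / (x - Y j) + 2 / σ) := by
      intro j hj
      by_cases h0 : W j = 0
      · simp [h0]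
      refine mul_nonneg (hW j hj) ?_
      rcases hgap j hj h0 with h | h
      · have : 0 < x - Y j := by linarith
        positivity
      · have h1 : 0 < Y j - x := by linarith
        have h2 : 1 / (Y j - x) ≤ 2 / σ := by
          rw [div_le_div_iff₀ h1 hσ]; linarith
        have h3 : 1 / (x - Y j) = -(1 / (Y j - x)) := by
          rw [show x - Y j = -(Y j - x) by ring, div_neg]
        linarith
    have h1 : W i * (1 / (x - Y i) + 2 / σ) ≤
        ∑ j ∈ Finset.range (m + 1), W j * (1 / (x - Y j) + 2 / σ) :=
      Finset.single_le_sum (f := fun j => W j * (1 / (x - Y j) + 2 / σ))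
        (fun j hj => hpos j (by rw [Finset.mem_range] at hj; omega))
        (Finset.mem_range.2 (by omega))
    simp only [mul_add, Finset.sum_add_distrib, ← Finset.sum_mul] at h1
    have h2 : 0 < x - Y i := by linarith
    have h3 : 1 / σ ^ 2 ≤ W i * (1 / (x - Y i)) := by
      rw [mul_one_div, div_le_div_iff₀ (by positivity) h2]
      have : σ ^ 4 = σ ^ 2 * σ ^ 2 := by ring
      nlinarith [pow_pos hσ 2]
    have h5 : 0 ≤ W i * (2 / σ) := mul_nonneg (hW i hi) (by positivity)
    have h6 : (∑ j ∈ Finset.range (m + 1), W j) * (2 / σ) ≤ 4 * (2 / σ) :=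
      mul_le_mul_of_nonneg_right hsum (by positivity)
    have h7 : 128 ≤ 1 / σ := by rw [le_div_iff₀ hσ]; linarith
    have h8 : 1 / σ ^ 2 = 1 / σ * (1 / σ) := by rw [pow_two]; field_simp
    have h9 : 4 * (2 / σ) = 8 * (1 / σ) := by ring
    have h10 : 128 * (1 / σ) ≤ 1 / σ * (1 / σ) := mul_le_mul_of_nonneg_right h7 (by positivity)
    linarith

/-- Away from the poles each fraction is decreasing, so the summand `-x` alone forces slope at most
`-1`. -/
theorem secular_sub {m : ℕ} {α x y : ℝ} {W Y : ℕ → ℝ} (hW : ∀ j ≤ m, 0 ≤ W j) (hxy : x ≤ y)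
    (hY : ∀ j ≤ m, Y j < x ∨ y < Y j) : y - x ≤ secular m α W Y x - secular m α W Y y := by
  have : ∑ j ∈ Finset.range (m + 1), W j * (1 / (y - Y j)) ≤
      ∑ j ∈ Finset.range (m + 1), W j * (1 / (x - Y j)) := by
    refine Finset.sum_le_sum fun j hj => ?_
    have hj : j ≤ m := by rw [Finset.mem_range] at hj; omega
    refine mul_le_mul_of_nonneg_left ?_ (hW j hj)
    rcases hY j hj with h | h
    · exact one_div_le_one_div_of_le (by linarith) (by linarith)
    · exact one_div_le_one_div_of_neg_of_le (by linarith) (by linarith)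
  unfold secular
  linarith

theorem secular_continuousOn {m : ℕ} {α : ℝ} {W Y : ℕ → ℝ} {S : Set ℝ}
    (hY : ∀ j ≤ m, ∀ x ∈ S, x ≠ Y j) : ContinuousOn (secular m α W Y) S := by
  unfold secular
  refine (by fun_prop : ContinuousOn (fun x : ℝ => α - x) S).add ?_
  refine continuousOn_finsetSum _ fun j hj => ?_
  refine continuousOn_const.mul (continuousOn_const.div (by fun_prop) fun x hx => ?_)
  exact sub_ne_zero.2 (hY j (by rw [Finset.mem_range] at hj; omega) x hx)

/-- The secular function changes sign between `e k + σ ^ 4` and `e (k + 1) - σ ^ 4`, which yields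
both the root and its margin. The comparisons `left` and `right` come from the slope bound. -/
theorem exists_secularRoots {m : ℕ} {α σ : ℝ} {e D W Y : ℕ → ℝ} (hl : IsLadder m σ e D)
    (hα : |α| ≤ 1) (hW : ∀ j ≤ m, 0 ≤ W j) (hsum : ∑ j ∈ Finset.range (m + 1), W j ≤ 4)
    (hσ : 0 < σ) (hσ' : σ ≤ 1 / 128) (hD : ∀ i < m, |D i| ≤ 2) (hYD : ∀ i < m, Y i = D i)
    (hYm : Y m = -16) (hWm : W m = 0) (hWσ : ∀ i < m, σ ^ 2 ≤ W i) :
    ∃ lam, SecularRoots m α σ e W Y lam ∧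
      ∀ k ≤ m, secular m α W Y (lam k) = 0 ∧ e k + σ ^ 4 ≤ lam k ∧ lam k + σ ^ 4 ≤ e (k + 1) := by
  have h4 : σ ^ 4 ≤ σ / 4 := by
    have : σ ^ 3 ≤ (1 / 128) ^ 3 := pow_le_pow_left₀ hσ.le hσ' 3
    have : σ ^ 4 = σ * σ ^ 3 := by ring
    nlinarith
  have h4' : 0 < σ ^ 4 := by positivity
  have hd : ∀ i < m, -2 ≤ D i ∧ D i ≤ 2 := fun i hi => abs_le.1 (hD i hi)
  have hlow : ∀ k ≤ m, -8 ≤ e k := by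
    rintro (_ | k) hk
    · rw [hl.first]
    · obtain ⟨i, hi, h⟩ := hl.eq k (by omega)
      rw [h]; linarith [(hd i hi).1]
  have hupp : ∀ k ≤ m, e (k + 1) ≤ 8 := by
    intro k hk
    rcases hk.lt_or_eq with hk | rfl
    · obtain ⟨i, hi, h⟩ := hl.eq k hk
      rw [h]; linarith [(hd i hi).2]
    · rw [hl.last]
  have hav : ∀ k ≤ m, ∀ j ≤ m, Y j ≤ e k ∨ e (k + 1) ≤ Y j := by
    intro k hk j hj
    rcases hj.lt_or_eq with hj | rfl
    · rw [hYD j hj]; exact hl.avoid k hk j hj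
    · left; rw [hYm]; linarith [hlow k hk]
  have hWj : ∀ j ≤ m, W j ≠ 0 → j < m := fun j hj h0 =>
    lt_of_le_of_ne hj fun h => h0 (by rw [h, hWm])
  have hIVT : ∀ k ≤ m, ∃ x, secular m α W Y x = 0 ∧ e k + σ ^ 4 ≤ x ∧ x + σ ^ 4 ≤ e (k + 1) := by
    intro k hk
    have hg := hl.gap k hk
    have hlo := hlow k hk
    have hup := hupp k hk
    have hp : 0 < secular m α W Y (e k + σ ^ 4) := by
      refine secular_pos hα hW hsum hσ hσ' (by linarith) (by linarith) le_rfl ?_ fun j hj _ => ?_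
      · rcases k with _ | k
        · left
          refine ⟨hl.first, fun j hj h0 => ?_⟩
          rw [hYD j (hWj j hj h0)]; exact (hd j (hWj j hj h0)).1
        · right
          obtain ⟨i, hi, h⟩ := hl.eq k (by omega)
          exact ⟨i, hi.le, by rw [h, hYD i hi], hWσ i hi⟩
      · rcases hav k hk j hj with h | h
        · exact .inl h
        · exact .inr (by linarith)
    have hn : secular m α W Y (e (k + 1) - σ ^ 4) < 0 := by
      -- The right end is treated as a left end of the reflected function.
      rw [← neg_pos, ← secular_neg]
      refine secular_pos (a := -e (k + 1)) (by rwa [abs_neg]) hW hsum hσ hσ' (by linarith)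
        (by linarith) (by linarith) ?_ fun j hj h0 => ?_
      · rcases hk.lt_or_eq with hk | rfl
        · right
          obtain ⟨i, hi, h⟩ := hl.eq k (by omega)
          exact ⟨i, hi.le, by rw [h, hYD i hi], hWσ i hi⟩
        · left
          refine ⟨by rw [hl.last], fun j hj h0 => ?_⟩
          rw [hYD j (hWj j hj h0)]; linarith [(hd j (hWj j hj h0)).2]
      · rcases hav k hk j hj with h | h
        · exact .inr (by linarith)
        · exact .inl (by linarith)
    have hc : ContinuousOn (secular m α W Y) (Set.Icc (e k + σ ^ 4) (e (k + 1) - σ ^ 4)) := by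
      refine secular_continuousOn fun j hj x hx => ?_
      rcases hav k hk j hj with h | h
      · exact (lt_of_le_of_lt h (by linarith [hx.1])).ne'
      · exact (lt_of_lt_of_le (by linarith [hx.2]) h).ne
    obtain ⟨x, hx, h0⟩ := intermediate_value_Icc' (by linarith) hc ⟨hn.le, hp.le⟩
    exact ⟨x, h0, hx.1, by linarith [hx.2]⟩
  choose! lam hlam using hIVT
  refine ⟨lam, ⟨hl.gap, hlow, hupp, ?_, ?_, ?_, ?_, ?_, ?_⟩, hlam⟩
  · intro k hk j hj x g h1 h2
    rcases hav k hk j hj with h | h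
    · exact le_trans (by linarith) (le_abs_self _)
    · exact le_trans (by linarith) (neg_le_abs _)
  · intro k hk x h1 h2
    have := secular_sub (α := α) hW h2 (Y := Y) fun j hj => by
      rcases hav k hk j hj with h | h
      · exact .inl (by linarith)
      · exact .inr (by linarith [(hlam k hk).2.2])
    rw [(hlam k hk).1] at this
    linarith
  · intro k hk x h1 h2
    have := secular_sub (α := α) hW h2 (Y := Y) fun j hj => by
      rcases hav k hk j hj with h | h
      · exact .inl (by linarith [(hlam k hk).2.1])
      · exact .inr (by linarith)
    rw [(hlam k hk).1] at this
    linarith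
  · exact fun k hk => ⟨by linarith [(hlam k hk).2.1], by linarith [(hlam k hk).2.2]⟩
  · intro j hj
    have : W j ≤ ∑ j ∈ Finset.range (m + 1), W j :=
      Finset.single_le_sum (f := W) (fun i hi => hW i (by rw [Finset.mem_range] at hi; omega))
        (Finset.mem_range.2 (by omega))
    rw [abs_of_nonneg (hW j hj)]; linarith
  · intro j hj
    rcases hj.lt_or_eq with hj | rfl
    · rw [hYD j hj]; linarith [hD j hj]
    · rw [hYm]; norm_num

/-! ## The eigenvalue program -/

/-- What the eigenvalue program achieves: a perturbed arrowhead matrix with poles `Y` and shaft `Z`,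
and approximations of its eigenvalues `lam` in the array `3`. -/
structure EigResult (m : ℕ) (ε α σ η : ℝ) (z d Z Y W e lam : ℕ → ℝ) (s : State) : Prop where
  poles : s.rm 6 = Y
  weights : s.rm 7 = W
  shaft : ∀ i < m, s.rm 8 i = Z i
  approx : ∀ k ≤ m, |s.rm 3 k - lam k| ≤ η + σ ^ 32
  weight_eq : ∀ i < m, W i = Z i ^ 2
  weight_last : W m = 0
  pole_last : Y m = -16
  shaft_near : ∀ i < m, |Z i - z i| ≤ σ
  pole_near : ∀ i < m, |Y i - d i| ≤ ε / 16
  roots : SecularRoots m α σ e W Y lam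
  root : ∀ k ≤ m, secular m α W Y (lam k) = 0
  margin : ∀ k ≤ m, e k + σ ^ 4 ≤ lam k ∧ lam k + σ ^ 4 ≤ e (k + 1)

theorem abs_pushAway_sub {σ x : ℝ} (hσ : 0 ≤ σ) : |pushAway σ x - x| ≤ σ := by
  unfold pushAway; split_ifs <;> rw [abs_le] <;> constructor <;> linarith

theorem sq_le_pushAway_sq {σ x : ℝ} (hσ : 0 ≤ σ) : σ ^ 2 ≤ pushAway σ x ^ 2 := by
  unfold pushAway; split_ifs <;> nlinarith

theorem pushAway_sq_le {σ x : ℝ} : pushAway σ x ^ 2 ≤ 2 * x ^ 2 + 2 * σ ^ 2 := by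
  unfold pushAway; split_ifs <;> nlinarith [sq_nonneg (x - σ), sq_nonneg (x + σ)]

theorem eigProg_spec {F : BlackBox} {m r N T Φ : ℕ} {ε α σ η : ℝ} {s : State} {w : Instr}
    {z d : ℕ → ℝ} (h0 : s.iv 0 = m + 1) (h1 : s.iv 1 = r) (k0 : s.rv 0 = ε) (k1 : s.rv 1 = α)
    (hz : s.rm 0 = z) (hd : s.rm 1 = d) (him : ∀ v, s.im 0 v = 0) (hε : 0 < ε) (hε' : ε ≤ 1)
    (hε'' : 2 * ε ≤ m + 1) (hσ : σ = ε / (64 * (m + 1)))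
    (hw : w = .rop 5 .div 0 13 ∧ η = ε / 8 ∨ w = .rop 5 .add 3 9 ∧ η = σ ^ 32)
    (hN : 4 / 2 ^ N ≤ ε / 16) (hT : 16 / 2 ^ T ≤ η) (hF : FmmBound F (m + 1) (σ ^ 32) Φ)
    (hα : |α| ≤ 1) (hd1 : ∀ i, |d i| ≤ 1) (hz1 : ∑ i ∈ Finset.range m, z i ^ 2 ≤ 1) :
    Reach F (eigProg w) s (100 * (N + 1) * (m + 1) + T * (Φ + 15 * (m + 1) + 7)) (fun s' =>
      ∃ L h Z Y W e lam, Consts m r L α σ h η s' ∧ EigResult m ε α σ η z d Z Y W e lam s') := by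
  have hσ0 : 0 < σ := by rw [hσ]; positivity
  -- This is where `2 * ε ≤ m + 1` enters. For `n ≥ 2` it follows from `ε ≤ 1`; for `n = 1` it says
  -- `ε ≤ 1 / 2`.
  have hσ1 : σ ≤ 1 / 128 := by
    rw [hσ, div_le_div_iff₀ (by positivity) (by norm_num)]; linarith
  have hmσ : (m + 1) * σ = ε / 64 := by rw [hσ]; field_simp
  have hη : σ ^ 32 ≤ η := by
    rcases hw with ⟨-, rfl⟩ | ⟨-, rfl⟩
    · calc σ ^ 32 ≤ σ ^ 1 := pow_le_pow_of_le_one hσ0.le (by linarith) (by norm_num)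
        _ ≤ ε / 8 := by
          rw [pow_one, hσ, div_le_div_iff₀ (by positivity) (by norm_num)]
          nlinarith [(Nat.cast_nonneg m : (0 : ℝ) ≤ m)]
    · exact le_rfl
  -- This maps `[-1, 1]` into `[1, 2)`, where the root of the tree has number `1`. The inverse is `4
  -- * y - 6`, so leaves at level `L` correspond to cells of width `4 / 2 ^ L`.
  set y : ℕ → ℝ := fun i => (d i + 6) / 4 with hy
  have hy1 : ∀ i, 1 ≤ y i := fun i => by
    have := abs_le.1 (hd1 i); simp only [hy]; linarith
  have hy2 : ∀ i, y i < 2 := fun i => by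
    have := abs_le.1 (hd1 i); simp only [hy]; linarith
  have hb : N * 3 + 31 + (m * (N * 11 + 22) + 2 + (m * (N * 7 + 16) + 8)) + 2 ≤
      100 * (N + 1) * (m + 1) := by nlinarith
  refine Reach.seq _
    (m * (N * 11 + 22) + 2 + (m * (N * 7 + 16) + 8 + (T * (Φ + 15 * (m + 1) + 7) + 2)))
    (setup_spec h0 h1 k0 k1 hε' hσ hw hN)
    (by linarith) ?_
  rintro s1 ⟨L, hL, hs1, hh, hh'⟩ hf1
  have hcell : ((m : ℝ) + 1) * σ ≤ 4 / 2 ^ L / 2 := by rw [hmσ]; linarith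
  have hL0 : 0 < L := by
    rcases L with _ | L
    · norm_num at hh; linarith
    · omega
  have r1 : ∀ A, s1.rm A = s.rm A := fun A => hf1.rm A (by
    rcases hw with ⟨rfl, -⟩ | ⟨rfl, -⟩ <;> simp [setupProg, Prog.targets, block, Instr.target])
  have i1 : s1.im 0 = s.im 0 := hf1.im 0 (by
    rcases hw with ⟨rfl, -⟩ | ⟨rfl, -⟩ <;> simp [setupProg, Prog.targets, block, Instr.target])
  refine Reach.seq (m * (N * 11 + 22) + 2) _ ((insert_spec hs1 (y := y)
    (fun i => by rw [r1, hd]) (fun i _ => hy1 i) (fun i _ => hy2 i) (by rw [i1]; exact him)).mono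
    (by gcongr) fun _ h _ => h) le_rfl ?_
  rintro s2 ⟨a1, a2, a3, a4⟩ hf2
  have hs2 := hs1.frame hf2
  refine Reach.seq (m * (N * 7 + 16) + 8) _ ((search_spec hs2 hy1 hy2 a1).mono (by gcongr)
    fun _ h _ => h) le_rfl ?_
  rintro s3 ⟨b1, b2, b3, b4, b5⟩ hf3
  have hs3 := hs2.frame hf3
  set D := spread (fun j => node (y j) L) (4 / 2 ^ L) σ with hD
  -- The left ends are in array 3. The last right end `8` is only in array 5, so it is supplied by
  -- hand.
  set e : ℕ → ℝ := fun k => if k = m + 1 then 8 else s3.rm 3 k with he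
  have hDd : ∀ i < m, |D i - d i| ≤ ε / 16 := fun i hi => by
    have := spread_near (y := y) (by linarith [hy1 i]) hσ0 hi hcell
    rw [show 4 * y i - 6 = d i by simp only [hy]; ring] at this
    exact this.trans hh
  have hD2 : ∀ i < m, |D i| ≤ 2 := fun i hi => by
    have h1 := abs_le.1 (hDd i hi)
    have h2 := abs_le.1 (hd1 i)
    rw [abs_le]; constructor <;> linarith
  have hlad : IsLadder m σ e D := by
    refine isLadder_spread hσ0 (by linarith) hcell hD2 (by simp [he, b2]) (by simp [he]) ?_
    intro k hk
    obtain ⟨v, q, hr, h1, h2⟩ := b1 k hk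
    exact ⟨v, q, hr, by simp [he, hk.ne, h2, h1]⟩
  have hYD : ∀ i < m, s3.rm 6 i = D i := fun i hi => by
    rw [b4, Function.update_of_ne hi.ne, a2 i hi, treeCount_spread hy1 hy2 hL0]
  have hWZ : ∀ i < m, s3.rm 7 i = pushAway σ (z i) ^ 2 := fun i hi => by
    rw [b5, Function.update_of_ne hi.ne, a4 i hi, r1, hz]
  have hWm : s3.rm 7 m = 0 := by rw [b5, Function.update_self]
  have hYm : s3.rm 6 m = -16 := by rw [b4, Function.update_self]
  have hW0 : ∀ j ≤ m, 0 ≤ s3.rm 7 j := fun j hj => by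
    rcases hj.lt_or_eq with hj | rfl
    · rw [hWZ j hj]; positivity
    · rw [hWm]
  -- `‖H‖ ≤ 1` bounds the squared shaft by `1`. Pushing away at most doubles this, up to `2 * m * σ
  -- ^ 2`, which is tiny.
  have hsum : ∑ j ∈ Finset.range (m + 1), s3.rm 7 j ≤ 4 := by
    rw [Finset.sum_range_succ, hWm, add_zero]
    calc ∑ j ∈ Finset.range m, s3.rm 7 j ≤ ∑ j ∈ Finset.range m, (2 * z j ^ 2 + 2 * σ ^ 2) :=
          Finset.sum_le_sum fun j hj => by
            rw [hWZ j (Finset.mem_range.1 hj)]; exact pushAway_sq_le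
      _ = 2 * ∑ j ∈ Finset.range m, z j ^ 2 + 2 * σ * (m * σ) := by
          rw [Finset.sum_add_distrib, ← Finset.mul_sum, Finset.sum_const, Finset.card_range,
            nsmul_eq_mul]; ring
      _ ≤ 4 := by nlinarith
  obtain ⟨lam, hlam, hroot⟩ := exists_secularRoots (W := s3.rm 7) (Y := s3.rm 6) hlad hα hW0 hsum
    hσ0 hσ1 hD2 hYD hYm hWm fun i hi => by rw [hWZ i hi]; exact sq_le_pushAway_sq hσ0.le
  have he3 : ∀ k ≤ m, s3.rm 3 k = e k := fun k hk => by
    simp only [he, if_neg (by omega : k ≠ m + 1)]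
  have he5 : ∀ k ≤ m, s3.rm 5 k = e (k + 1) := fun k hk => by
    rcases hk.lt_or_eq with hk | rfl
    · obtain ⟨v, q, hr, h1, h2⟩ := b1 k hk
      simp [he, hk.ne, h2]
    · simp [he, b3]
  refine (bisect_spec hs3 hF hlam hσ0 (by linarith) hη hT (fun _ _ => rfl) (fun _ _ => rfl) he3
    he5).mono le_rfl ?_
  intro s4 c1 hf4
  have hs4 := hs3.frame hf4
  refine ⟨L, _, fun i => pushAway σ (z i), s3.rm 6, s3.rm 7, e, lam, hs4, hf4.rm 6 (by decide),
    hf4.rm 7 (by decide), ?_, c1, hWZ, hWm, hYm, fun i _ => abs_pushAway_sub hσ0.le, ?_, hlam,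
    fun k hk => (hroot k hk).1, fun k hk => (hroot k hk).2⟩
  · intro i hi
    rw [hf4.rm 8 (by decide), hf3.rm 8 (by decide), a3 i hi, r1, hz]
  · intro i hi
    rw [hYD i hi]; exact hDd i hi

/-! ## The spectral norm -/

theorem norm_toLp_sq {n : ℕ} (x : Fin n → ℝ) : ‖WithLp.toLp 2 x‖ ^ 2 = x ⬝ᵥ x := by
  rw [EuclideanSpace.real_norm_sq_eq]
  simp [dotProduct, pow_two]

theorem specNorm_nonneg {n : ℕ} (A : Matrix (Fin n) (Fin n) ℝ) : 0 ≤ specNorm A := norm_nonneg _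

theorem mulVec_dotProduct_le {n : ℕ} (A : Matrix (Fin n) (Fin n) ℝ) (x : Fin n → ℝ) :
    (A.mulVec x) ⬝ᵥ (A.mulVec x) ≤ specNorm A ^ 2 * (x ⬝ᵥ x) := by
  rw [← norm_toLp_sq, ← norm_toLp_sq, ← mul_pow]
  refine pow_le_pow_left₀ (norm_nonneg _) ?_ 2
  have := (Matrix.toEuclideanCLM (n := Fin n) (𝕜 := ℝ) A).le_opNorm (WithLp.toLp 2 x)
  rwa [Matrix.toEuclideanCLM_toLp] at this

theorem specNorm_le {n : ℕ} {A : Matrix (Fin n) (Fin n) ℝ} {c : ℝ} (hc : 0 ≤ c)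
    (h : ∀ x, (A.mulVec x) ⬝ᵥ (A.mulVec x) ≤ c ^ 2 * (x ⬝ᵥ x)) : specNorm A ≤ c := by
  refine ContinuousLinearMap.opNorm_le_bound _ hc fun x => ?_
  obtain ⟨x, rfl⟩ := (WithLp.equiv 2 (Fin n → ℝ)).symm.surjective x
  have := h x
  rw [← norm_toLp_sq, ← norm_toLp_sq, ← mul_pow] at this
  have := abs_le_of_sq_le_sq this (by positivity)
  rw [abs_of_nonneg (norm_nonneg _)] at this
  exact this

theorem specNorm_add_le {n : ℕ} (A B : Matrix (Fin n) (Fin n) ℝ) :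
    specNorm (A + B) ≤ specNorm A + specNorm B := by
  unfold specNorm
  rw [map_add]
  exact norm_add_le _ _

theorem dotProduct_mulVec_le {n : ℕ} (A : Matrix (Fin n) (Fin n) ℝ) (x : Fin n → ℝ) :
    |x ⬝ᵥ A.mulVec x| ≤ specNorm A * (x ⬝ᵥ x) := by
  have h0 : 0 ≤ x ⬝ᵥ x := by rw [← norm_toLp_sq]; positivity
  refine abs_le_of_sq_le_sq ?_ (mul_nonneg (specNorm_nonneg A) h0)
  have h1 : (x ⬝ᵥ A.mulVec x) ^ 2 ≤ (x ⬝ᵥ x) * (A.mulVec x ⬝ᵥ A.mulVec x) := by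
    have := Finset.sum_mul_sq_le_sq_mul_sq Finset.univ x (A.mulVec x)
    simpa only [dotProduct, pow_two] using this
  have h2 := mul_le_mul_of_nonneg_left (mulVec_dotProduct_le A x) h0
  nlinarith

/-! ## Orthogonal diagonalization -/

/-- `A` is diagonalized by the orthogonal matrix `U`, with eigenvalues `lam`. -/
structure Diagonalizes {n : ℕ} (A U : Matrix (Fin n) (Fin n) ℝ) (lam : Fin n → ℝ) : Prop where
  orth : U ∈ Matrix.orthogonalGroup (Fin n) ℝ
  eq : A = U * Matrix.diagonal lam * U.transpose

theorem Diagonalizes.dotProduct_transpose {n : ℕ} {A U : Matrix (Fin n) (Fin n) ℝ}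
    {lam : Fin n → ℝ} (h : Diagonalizes A U lam) (x : Fin n → ℝ) :
    U.transpose.mulVec x ⬝ᵥ U.transpose.mulVec x = x ⬝ᵥ x := by
  have := (Matrix.mem_orthogonalGroup_iff (Fin n) ℝ).1 h.orth
  rw [Matrix.dotProduct_mulVec, Matrix.vecMul_transpose, Matrix.mulVec_mulVec]
  change (U * U.transpose).mulVec x ⬝ᵥ x = _
  rw [show U * U.transpose = 1 from this, Matrix.one_mulVec]

theorem Diagonalizes.dotProduct_mulVec {n : ℕ} {A U : Matrix (Fin n) (Fin n) ℝ}
    {lam : Fin n → ℝ} (h : Diagonalizes A U lam) (x : Fin n → ℝ) :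
    x ⬝ᵥ A.mulVec x = ∑ j, lam j * (U.transpose.mulVec x j) ^ 2 := by
  rw [h.eq, ← Matrix.mulVec_mulVec, ← Matrix.mulVec_mulVec, Matrix.dotProduct_mulVec,
    ← Matrix.mulVec_transpose, dotProduct]
  refine Finset.sum_congr rfl fun j _ => ?_
  rw [Matrix.mulVec_diagonal]; ring

/-- One half of Weyl's inequality. -/
theorem Diagonalizes.le_add {n : ℕ} {A B U V : Matrix (Fin n) (Fin n) ℝ} {lam mu : Fin n → ℝ}
    (hA : Diagonalizes A U lam) (hB : Diagonalizes B V mu) (hl : Monotone lam) (hm : Monotone mu)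
    (i : Fin n) : lam i ≤ mu i + specNorm (A - B) := by
  -- The zero row makes `M` singular, so some `x ≠ 0` is orthogonal to the first `i` eigenvectors of
  -- `A` and to the eigenvectors of `B` after the `i`-th. On this `x` the form of `A` is at least
  -- `lam i` and that of `B` at most `mu i`.
  set M : Matrix (Fin n) (Fin n) ℝ := Matrix.of fun j => if j < i then U.transpose j else
    if i < j then V.transpose j else 0 with hM
  have hdet : M.det = 0 := Matrix.det_eq_zero_of_row_eq_zero i fun k => by simp [hM]
  obtain ⟨x, hx, h0⟩ := Matrix.exists_mulVec_eq_zero_iff.2 hdet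
  have hU : ∀ j < i, U.transpose.mulVec x j = 0 := fun j hj => by
    have := congrFun h0 j
    simpa only [Matrix.mulVec, hM, Matrix.of_apply, if_pos hj, Pi.zero_apply] using this
  have hV : ∀ j, i < j → V.transpose.mulVec x j = 0 := fun j hj => by
    have := congrFun h0 j
    simpa only [Matrix.mulVec, hM, Matrix.of_apply, if_pos hj, if_neg hj.not_gt, Pi.zero_apply] using this
  have h1 : lam i * (x ⬝ᵥ x) ≤ x ⬝ᵥ A.mulVec x := by
    rw [hA.dotProduct_mulVec, ← hA.dotProduct_transpose, dotProduct, Finset.mul_sum]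
    refine Finset.sum_le_sum fun j _ => ?_
    rw [← pow_two]
    by_cases hj : j < i
    · simp [hU j hj]
    · exact mul_le_mul_of_nonneg_right (hl (not_lt.1 hj)) (sq_nonneg _)
  have h2 : x ⬝ᵥ B.mulVec x ≤ mu i * (x ⬝ᵥ x) := by
    rw [hB.dotProduct_mulVec, ← hB.dotProduct_transpose, dotProduct, Finset.mul_sum]
    refine Finset.sum_le_sum fun j _ => ?_
    rw [← pow_two]
    by_cases hj : i < j
    · simp [hV j hj]
    · exact mul_le_mul_of_nonneg_right (hm (not_lt.1 hj)) (sq_nonneg _)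
  have h3 := (abs_le.1 (dotProduct_mulVec_le (A - B) x)).2
  rw [Matrix.sub_mulVec, dotProduct_sub] at h3
  have h4 : 0 < x ⬝ᵥ x := by
    refine lt_of_le_of_ne (by rw [← norm_toLp_sq]; positivity) fun h => hx ?_
    exact dotProduct_self_eq_zero.1 h.symm
  have h5 : lam i * (x ⬝ᵥ x) ≤ (mu i + specNorm (A - B)) * (x ⬝ᵥ x) := by linarith
  exact le_of_mul_le_mul_right h5 h4

/-- Weyl's inequality. -/
theorem Diagonalizes.abs_sub_le {n : ℕ} {A B U V : Matrix (Fin n) (Fin n) ℝ} {lam mu : Fin n → ℝ}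
    (hA : Diagonalizes A U lam) (hB : Diagonalizes B V mu) (hl : Monotone lam) (hm : Monotone mu)
    {c : ℝ} (hc : specNorm (A - B) ≤ c) (i : Fin n) : |lam i - mu i| ≤ c := by
  have h1 := hA.le_add hB hl hm i
  have h2 := hB.le_add hA hm hl i
  have h3 : specNorm (B - A) = specNorm (A - B) := by
    unfold specNorm
    rw [map_sub, map_sub, norm_sub_rev]
  rw [abs_le]; constructor <;> linarith

theorem exists_sorted_diagonalizes {n : ℕ} {A : Matrix (Fin n) (Fin n) ℝ} (hA : A.IsHermitian) :
    ∃ U lam, Diagonalizes A U lam ∧ IsSortedSpectrum A lam := by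
  set U : Matrix (Fin n) (Fin n) ℝ := hA.eigenvectorUnitary.1 with hU
  have hs : A = U * Matrix.diagonal hA.eigenvalues * U.transpose := by
    conv_lhs => rw [hA.spectral_theorem, Unitary.conjStarAlgAut_apply]
    rfl
  have hUU : U * U.transpose = 1 := (Matrix.mem_orthogonalGroup_iff (Fin n) ℝ).1
    hA.eigenvectorUnitary.2
  -- The spectral theorem does not give the order needed here; sorting permutes the columns of `U`.
  set e := Tuple.sort hA.eigenvalues
  refine ⟨U.submatrix id e, hA.eigenvalues ∘ e, ⟨?_, ?_⟩, Tuple.monotone_sort _, ?_⟩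
  · rw [Matrix.mem_orthogonalGroup_iff]
    change U.submatrix id e * (U.submatrix id e).transpose = 1
    rw [Matrix.transpose_submatrix, Matrix.submatrix_mul_equiv, hUU]
    exact Matrix.submatrix_id_id _
  · rw [← Matrix.submatrix_diagonal_equiv, Matrix.transpose_submatrix, Matrix.submatrix_mul_equiv,
      Matrix.submatrix_mul_equiv, ← hs]
    rfl
  · rw [hA.charpoly_eq]
    exact (Equiv.prod_comp e fun i => Polynomial.X - Polynomial.C (hA.eigenvalues i)).symm

/-- The matrix with columns `q k`, normalized. -/
noncomputable def normalized {n : ℕ} (q : Fin n → Fin n → ℝ) : Matrix (Fin n) (Fin n) ℝ :=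
  Matrix.of fun i k => q k i / √(q k ⬝ᵥ q k)

/-- Eigenvectors of a symmetric matrix for distinct eigenvalues are orthogonal, so normalizing them
already gives an exactly orthogonal matrix. -/
theorem diagonalizes_of_eigenvectors {n : ℕ} {A : Matrix (Fin n) (Fin n) ℝ}
    (hA : A.transpose = A) {q : Fin n → Fin n → ℝ} {lam : Fin n → ℝ} (hq : ∀ k, q k ≠ 0)
    (hlam : Function.Injective lam) (h : ∀ k, A.mulVec (q k) = lam k • q k) :
    Diagonalizes A (normalized q) lam := by
  have hpos : ∀ k, 0 < q k ⬝ᵥ q k := fun k => by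
    refine lt_of_le_of_ne (by rw [← norm_toLp_sq]; positivity) fun h => hq k ?_
    exact dotProduct_self_eq_zero.1 h.symm
  have horth : ∀ k l, k ≠ l → q k ⬝ᵥ q l = 0 := by
    intro k l hkl
    have h1 : A.mulVec (q k) ⬝ᵥ q l = q k ⬝ᵥ A.mulVec (q l) := by
      rw [Matrix.dotProduct_mulVec, ← Matrix.mulVec_transpose, hA]
    rw [h, h, smul_dotProduct, dotProduct_smul, smul_eq_mul, smul_eq_mul] at h1
    have h2 : (lam k - lam l) * (q k ⬝ᵥ q l) = 0 := by linarith
    exact (mul_eq_zero.1 h2).resolve_left (sub_ne_zero.2 fun h => hkl (hlam h))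
  have h1 : (normalized q).transpose * normalized q = 1 := by
    ext k l
    have : ((normalized q).transpose * normalized q) k l =
        (q k ⬝ᵥ q l) / (√(q k ⬝ᵥ q k) * √(q l ⬝ᵥ q l)) := by
      rw [Matrix.mul_apply, dotProduct, Finset.sum_div]
      refine Finset.sum_congr rfl fun i _ => ?_
      simp only [normalized, Matrix.transpose_apply, Matrix.of_apply]
      rw [div_mul_div_comm]
    rw [this]
    by_cases hkl : k = l
    · subst hkl
      rw [Real.mul_self_sqrt (hpos k).le, div_self (hpos k).ne', Matrix.one_apply_eq]
    · rw [horth k l hkl, zero_div, Matrix.one_apply_ne hkl]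
  have h2 : normalized q * (normalized q).transpose = 1 := mul_eq_one_comm.1 h1
  have h3 : A * normalized q = normalized q * Matrix.diagonal lam := by
    ext i k
    have h4 := congrFun (h k) i
    rw [Matrix.mul_diagonal, Matrix.mul_apply]
    simp only [normalized, Matrix.of_apply, Matrix.mulVec, dotProduct, Pi.smul_apply,
      smul_eq_mul] at h4 ⊢
    simp only [← mul_div_assoc]
    rw [← Finset.sum_div, h4]; ring
  refine ⟨(Matrix.mem_orthogonalGroup_iff (Fin n) ℝ).2 h2, ?_⟩
  rw [← h3, Matrix.mul_assoc, h2, Matrix.mul_one]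

/-! ## Arrowhead matrices -/

theorem arrowhead_mulVec_zero {m : ℕ} (α : ℝ) (z d : Fin m → ℝ) (x : Fin (m + 1) → ℝ) :
    (arrowhead α z d).mulVec x 0 = α * x 0 + ∑ i, z i * x i.succ := by
  simp [arrowhead, Matrix.mulVec, dotProduct, Fin.sum_univ_succ]

theorem arrowhead_mulVec_succ {m : ℕ} (α : ℝ) (z d : Fin m → ℝ) (x : Fin (m + 1) → ℝ)
    (i : Fin m) : (arrowhead α z d).mulVec x i.succ = z i * x 0 + d i * x i.succ := by
  simp [arrowhead, Matrix.mulVec, dotProduct, Fin.sum_univ_succ, Matrix.diagonal_apply]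

theorem arrowhead_transpose {m : ℕ} (α : ℝ) (z d : Fin m → ℝ) :
    (arrowhead α z d).transpose = arrowhead α z d := by
  ext i j
  refine Fin.cases ?_ (fun i => ?_) i <;> refine Fin.cases ?_ (fun j => ?_) j
  all_goals simp [arrowhead, Matrix.diagonal_apply]
  by_cases h : i = j
  · subst h; rfl
  · simp [h, Ne.symm h]

theorem arrowhead_isHermitian {m : ℕ} (α : ℝ) (z d : Fin m → ℝ) :
    (arrowhead α z d).IsHermitian := arrowhead_transpose α z d

theorem arrowhead_sub {m : ℕ} (α : ℝ) (z d z' d' : Fin m → ℝ) :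
    arrowhead α z d - arrowhead α z' d' = arrowhead 0 (z - z') (d - d') := by
  ext i j
  refine Fin.cases ?_ (fun i => ?_) i <;> refine Fin.cases ?_ (fun j => ?_) j
  all_goals simp [arrowhead, Matrix.diagonal_apply]
  split_ifs <;> simp

/-- Cauchy–Schwarz bounds the first entry of the image, and `(u + v) ^ 2 ≤ 2 * u ^ 2 + 2 * v ^ 2`
the others. In total `x 0 ^ 2` has coefficient `2 * a` and the remaining squares have coefficient `a
+ 2 * b`. -/
theorem specNorm_arrowhead_le {m : ℕ} {z d : Fin m → ℝ} {a b c : ℝ} (hc : 0 ≤ c)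
    (hz : ∑ i, z i ^ 2 ≤ a) (hd : ∀ i, d i ^ 2 ≤ b) (hb : a + 2 * b ≤ c ^ 2)
    (ha : 2 * a ≤ c ^ 2) : specNorm (arrowhead 0 z d) ≤ c := by
  refine specNorm_le hc fun x => ?_
  simp only [dotProduct, Fin.sum_univ_succ, arrowhead_mulVec_zero, arrowhead_mulVec_succ, zero_mul,
    zero_add, ← pow_two]
  have h0 : 0 ≤ ∑ i : Fin m, x i.succ ^ 2 := Finset.sum_nonneg fun i _ => sq_nonneg _
  have h1 := Finset.sum_mul_sq_le_sq_mul_sq Finset.univ z (fun i : Fin m => x i.succ)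
  have h2 : ∑ i : Fin m, (z i * x 0 + d i * x i.succ) ^ 2 ≤
      2 * x 0 ^ 2 * ∑ i, z i ^ 2 + 2 * b * ∑ i : Fin m, x i.succ ^ 2 := by
    rw [Finset.mul_sum, Finset.mul_sum, ← Finset.sum_add_distrib]
    refine Finset.sum_le_sum fun i _ => ?_
    have := mul_le_mul_of_nonneg_right (hd i) (sq_nonneg (x i.succ))
    nlinarith [sq_nonneg (z i * x 0 - d i * x i.succ)]
  have h3 := mul_le_mul_of_nonneg_right hz h0
  have h4 := mul_le_mul_of_nonneg_left hz (sq_nonneg (x 0))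
  have h5 := mul_le_mul_of_nonneg_right hb h0
  have h6 := mul_le_mul_of_nonneg_right ha (sq_nonneg (x 0))
  nlinarith

/-- Each column of a matrix of norm at most `1` has Euclidean norm at most `1`; apply this to the
basis vectors. -/
theorem arrowhead_bounds {m : ℕ} {α : ℝ} {z d : Fin m → ℝ} (h : specNorm (arrowhead α z d) ≤ 1) :
    |α| ≤ 1 ∧ (∀ i, |d i| ≤ 1) ∧ ∑ i, z i ^ 2 ≤ 1 := by
  have key : ∀ x, (arrowhead α z d).mulVec x ⬝ᵥ (arrowhead α z d).mulVec x ≤ x ⬝ᵥ x := fun x => by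
    refine (mulVec_dotProduct_le _ x).trans ?_
    have h0 : 0 ≤ x ⬝ᵥ x := by rw [← norm_toLp_sq]; positivity
    have := specNorm_nonneg (arrowhead α z d)
    refine mul_le_of_le_one_left h0 ?_
    nlinarith
  have h0 := key (Pi.single 0 1)
  simp only [dotProduct, Fin.sum_univ_succ, arrowhead_mulVec_zero, arrowhead_mulVec_succ,
    Pi.single_eq_same, Pi.single_eq_of_ne (Fin.succ_ne_zero _), mul_zero, mul_one, add_zero,
    Finset.sum_const_zero, ← pow_two] at h0
  norm_num at h0
  have hz : 0 ≤ ∑ i, z i ^ 2 := Finset.sum_nonneg fun i _ => sq_nonneg _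
  refine ⟨abs_le_one_iff_mul_self_le_one.2 (by nlinarith), fun i => ?_, by nlinarith⟩
  have h1 := key (Pi.single i.succ 1)
  simp only [dotProduct, Fin.sum_univ_succ, arrowhead_mulVec_zero, arrowhead_mulVec_succ,
    Pi.single_apply, Fin.succ_inj, (Fin.succ_ne_zero i).symm, if_false, mul_ite, mul_zero, mul_one,
    zero_add, Finset.sum_ite_eq', Finset.mem_univ, if_true, ← pow_two, ite_pow] at h1
  have h2 : d i ^ 2 ≤ ∑ j, (if j = i then d j else 0) ^ 2 := by
    refine le_trans (le_of_eq ?_) (Finset.single_le_sum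
      (f := fun j => (if j = i then d j else 0) ^ 2) (fun j _ => sq_nonneg _) (Finset.mem_univ i))
    simp
  simp [ite_pow] at h1 h2
  rw [abs_le_one_iff_mul_self_le_one]
  nlinarith [sq_nonneg (z i)]

/-! ## The columns -/

/-- The requirements of an AFMM call with evaluation points `X` and sources `Y`. -/
structure Separated (m : ℕ) (δ : ℝ) (X Y : ℕ → ℝ) : Prop where
  left_lt : ∀ k < m + 1, |X k| < 32
  right_lt : ∀ j < m + 1, |Y j| < 32
  sep : ∀ k < m + 1, ∀ j < m + 1, δ ^ 2 ≤ |X k - Y j|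

theorem norm_spec {F : BlackBox} {m r L Φ : ℕ} {α σ h η : ℝ} {s : State}
    {X W Y : ℕ → ℝ} (hs : Consts m r L α σ h η s) (hF : FmmBound F (m + 1) (σ ^ 32) Φ)
    (hσ : 0 < σ) (hσ' : σ ^ 32 < 1 / 2) (h3 : s.rm 3 = X) (h6 : s.rm 6 = Y) (h7 : s.rm 7 = W)
    (hXY : Separated m (σ ^ 32) X Y) (hW : ∀ j < m + 1, |W j| < 32) (hW0 : ∀ j < m + 1, 0 ≤ W j) :
    Reach F normProg s (Φ + 6 * (m + 1) + 4) (fun s' => ∀ k < m + 1, ∃ g,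
      |g - ∑ j ∈ Finset.range (m + 1), W j * (1 / (X k - Y j) ^ 2)| ≤ σ ^ 32 ∧
      s'.rm 11 k = √(1 + g)) := by
  refine Reach.seq (Φ + 1) (6 * (m + 1) + 3) (fmm_spec hF (by omega) (by positivity) hσ' hs.acc
    hs.bound hs.size (by rw [h3]; exact hXY.left_lt) (by rw [h7]; exact hW)
    (by rw [h6]; exact hXY.right_lt) (by rw [h3, h6]; exact hXY.sep)) (by omega) ?_
  rw [h3, h6, h7]
  intro s1 a1 hf1
  have hs1 := hs.frame hf1
  refine Reach.seq 2 (6 * (m + 1) + 1) (Q := fun s' => s'.iv 5 = 0 ∧ s'.rv 18 = 1)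
    (Reach.block (by simp) ?_) (by omega) ?_
  · simp [blockWP, Instr.Defined, Instr.cost, Instr.run, hs1.one]
  rintro s2 ⟨b1, b2⟩ hf2
  have hs2 := hs1.frame hf2
  have g10 : s2.rm 10 = s1.rm 10 := hf2.rm 10 (by decide)
  refine (Reach.count (fun k s' => ∀ i < k, s'.rm 11 i = √(1 + s1.rm 10 i)) (m + 1) 5
    (by linarith) b1 hs2.size (by decide) (by simp) ?_).mono le_rfl
    fun s' h' _ k hk => ⟨_, a1 k hk, h' k hk⟩
  intro k s3 hk hf3 c1 e5
  have hs3 := hs2.frame hf3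
  have g10' : s3.rm 10 = s1.rm 10 := (hf3.rm 10 (by decide)).trans g10
  have e18 : s3.rv 18 = 1 := (hf3.rv 18 (by decide)).trans b2
  -- The exact sum is nonnegative and its error is below `1 / 2`, so the square root is allowed.
  have hpos : 0 ≤ 1 + s1.rm 10 k := by
    have h1 := (abs_le.1 (a1 k hk)).1
    have h2 : 0 ≤ ∑ j ∈ Finset.range (m + 1), W j * Kernel.invSq.fn (X k - Y j) :=
      Finset.sum_nonneg fun j hj => mul_nonneg (hW0 j (Finset.mem_range.1 hj))
        (one_div_nonneg.2 (sq_nonneg _))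
    linarith
  refine Reach.block (by simp) ?_
  simp only [blockWP, Instr.Defined, Instr.cost, Instr.run, ROp.fn]
  simp only [Function.update_self, ne_eq, Nat.reduceEqDiff, not_false_eq_true,
    Function.update_of_ne, e5, g10', e18, hs3.one, true_and]
  refine ⟨by linarith, fun i hi => ?_⟩
  rw [Function.update_apply]
  split_ifs with h
  · rw [h, add_comm]
  · exact c1 i (by omega)

/-- There is no integer multiplication, so the index runs down column `c` in steps of `r`. It starts
at `c + r` because row `0` of `B` meets the corner and belongs to no pole. -/
theorem weights_spec {F : BlackBox} {m r L c : ℕ} {α σ h η : ℝ} {s : State}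
    (hs : Consts m r L α σ h η s) (h5 : s.iv 5 = 0) (h11 : s.iv 11 = c + r) :
    Reach F (.loop (.ilt 5 3) weightStepProg) s (7 * m + 1) (fun s' =>
      ∀ j < m, s'.rm 12 j = s.rm 8 j * s.rm 2 (c + r * (j + 1))) := by
  refine (Reach.count (fun i s' => s'.iv 11 = c + r * (i + 1) ∧
    ∀ j < i, s'.rm 12 j = s.rm 8 j * s.rm 2 (c + r * (j + 1))) m 6 (by linarith) h5 hs.shaft
    (by decide) (by simp [h11]) ?_).mono le_rfl fun s' h' _ => h'.2
  rintro i s1 hi hf1 ⟨a1, a2⟩ e5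
  have hs1 := hs.frame hf1
  have g8 : s1.rm 8 = s.rm 8 := hf1.rm 8 (by decide)
  have g2 : s1.rm 2 = s.rm 2 := hf1.rm 2 (by decide)
  refine Reach.block (by simp) ?_
  simp only [blockWP, Instr.Defined, Instr.cost, Instr.run, ROp.fn]
  simp only [Function.update_self, ne_eq, Nat.reduceEqDiff, not_false_eq_true,
    Function.update_of_ne, e5, g8, g2, a1, hs1.one, hs1.cols, true_and]
  refine ⟨by ring, fun j hj => ?_⟩
  rw [Function.update_apply]
  split_ifs with h
  · rw [h]
  · exact a2 j (by omega)

/-- The indices written are those congruent to `c` modulo `r`; the second conclusion protects the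
columns that are already finished. -/
theorem entries_spec {F : BlackBox} {m r L c : ℕ} {α σ h η : ℝ} {s : State}
    (hs : Consts m r L α σ h η s) (h5 : s.iv 5 = 0) (h11 : s.iv 11 = c) (hc : c < r)
    (hN : ∀ k < m + 1, s.rm 11 k ≠ 0) :
    Reach F (.loop (.ilt 5 0) entryStepProg) s (8 * (m + 1) + 1) (fun s' =>
      (∀ k < m + 1, s'.rm 4 (c + r * k) = (s.rm 10 k + s.rv 19) / s.rm 11 k) ∧
      ∀ a, a % r ≠ c → s'.rm 4 a = s.rm 4 a) := by
  refine (Reach.count (fun i s' => s'.iv 11 = c + r * i ∧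
      (∀ k < i, s'.rm 4 (c + r * k) = (s.rm 10 k + s.rv 19) / s.rm 11 k) ∧
      ∀ a, a % r ≠ c → s'.rm 4 a = s.rm 4 a) (m + 1) 7 (by linarith) h5 hs.size
    (by decide) (by simp [h11]) ?_).mono le_rfl fun s' h' _ => h'.2
  rintro i s1 hi hf1 ⟨a1, a2, a3⟩ e5
  have hs1 := hs.frame hf1
  have g10 : s1.rm 10 = s.rm 10 := hf1.rm 10 (by decide)
  have g11 : s1.rm 11 = s.rm 11 := hf1.rm 11 (by decide)
  have e19 : s1.rv 19 = s.rv 19 := hf1.rv 19 (by decide)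
  refine Reach.block (by simp) ?_
  simp only [blockWP, Instr.Defined, Instr.cost, Instr.run, ROp.fn]
  simp only [Function.update_self, ne_eq, Nat.reduceEqDiff, not_false_eq_true,
    Function.update_of_ne, e5, g10, g11, e19, a1, hs1.one, hs1.cols, true_and]
  refine ⟨hN i hi, by ring, fun k hk => ?_, fun a ha => ?_⟩
  · rw [Function.update_apply]
    split_ifs with h
    · have : k = i := by
        have := Nat.eq_of_mul_eq_mul_left (by omega) (Nat.add_left_cancel h)
        exact this
      rw [this]
    · exact a2 k (by
        rcases Nat.lt_succ_iff_lt_or_eq.1 hk with h' | rfl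
        · exact h'
        · exact absurd rfl h)
  · rw [Function.update_of_ne]
    · exact a3 a ha
    · rintro rfl
      rw [Nat.add_mul_mod_self_left, Nat.mod_eq_of_lt hc] at ha
      exact ha rfl

theorem columnStep_spec {F : BlackBox} {m r L c Φ : ℕ} {α σ h η : ℝ} {s : State}
    {X Y Z b : ℕ → ℝ} (hs : Consts m r L α σ h η s) (hF : FmmBound F (m + 1) (σ ^ 32) Φ)
    (hσ : 0 < σ) (hσ' : σ ^ 32 < 1 / 2) (h2 : s.rm 2 = b) (h3 : s.rm 3 = X) (h6 : s.rm 6 = Y)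
    (h8 : ∀ j < m, s.rm 8 j = Z j) (hXY : Separated m (σ ^ 32) X Y)
    (hZ : ∀ j < m, ∀ a, |Z j * b a| < 32) (hN : ∀ k < m + 1, s.rm 11 k ≠ 0) (hi : s.iv 6 = c)
    (hc : c < r) :
    Reach F columnStepProg s (Φ + 15 * (m + 1) + 10) (fun s' => s'.iv 6 = c + 1 ∧
      (∀ k < m + 1, ∃ g,
        |g - ∑ j ∈ Finset.range m, Z j * b (c + r * (j + 1)) * (1 / (X k - Y j))| ≤ σ ^ 32 ∧
        s'.rm 4 (c + r * k) = (b c + g) / s.rm 11 k) ∧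
      ∀ a, a % r ≠ c → s'.rm 4 a = s.rm 4 a) := by
  refine Reach.seq 3 (Φ + 15 * (m + 1) + 7) (Q := fun s' => s'.rv 19 = b c ∧ s'.iv 11 = c + r ∧
    s'.iv 5 = 0) (Reach.block (by simp) ?_) (by omega) ?_
  · simp [blockWP, Instr.Defined, Instr.cost, Instr.run, hi, h2, hs.cols]
  rintro s1 ⟨a1, a2, a3⟩ hf1
  have hs1 := hs.frame hf1
  refine Reach.seq (7 * m + 1) (Φ + 8 * (m + 1) + 6) (weights_spec hs1 a3 a2) (by omega) ?_
  rintro s2 b1 hf2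
  have hs2 := hs1.frame hf2
  refine Reach.seq 1 (Φ + 8 * (m + 1) + 5) (Q := fun s' => s'.rm 12 = Function.update (s2.rm 12) m 0)
    (Reach.instr trivial (by simp [Instr.cost]) (by simp [Instr.run, hs2.shaft, hs2.zero]))
    (by omega) ?_
  rintro s3 c1 hf3
  have hs3 := hs2.frame hf3
  have g : ∀ A, A ≠ 12 → s3.rm A = s.rm A := fun A hA => by
    rw [hf3.rm A (by simp [Prog.targets, Instr.target, hA]),
      hf2.rm A (by simp [weightStepProg, block, Prog.targets, Instr.target, hA]),
      hf1.rm A (by simp [block, Prog.targets, Instr.target])]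
  have hV : ∀ j < m, s3.rm 12 j = Z j * b (c + r * (j + 1)) := fun j hj => by
    rw [c1, Function.update_of_ne hj.ne, b1 j hj, hf1.rm 8 (by decide), hf1.rm 2 (by decide), h2,
      h8 j hj]
  have hVm : s3.rm 12 m = 0 := by rw [c1, Function.update_self]
  refine Reach.seq (Φ + 1) (8 * (m + 1) + 4) (fmm_spec hF (by omega) (by positivity) hσ' hs3.acc
    hs3.bound hs3.size (by rw [g 3 (by norm_num), h3]; exact hXY.left_lt) ?_
    (by rw [g 6 (by norm_num), h6]; exact hXY.right_lt)
    (by rw [g 3 (by norm_num), g 6 (by norm_num), h3, h6]; exact hXY.sep)) (by omega) ?_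
  · intro j hj
    rcases Nat.lt_succ_iff_lt_or_eq.1 hj with hj | rfl
    · rw [hV j hj]; exact hZ j hj _
    · rw [hVm]; norm_num
  rw [g 3 (by norm_num), g 6 (by norm_num), h3, h6]
  intro s4 d1 hf4
  have hs4 := hs3.frame hf4
  have e6 : s4.iv 6 = c := by
    rw [hf4.iv 6 (by decide), hf3.iv 6 (by decide), hf2.iv 6 (by decide), hf1.iv 6 (by decide), hi]
  refine Reach.seq 2 (8 * (m + 1) + 2) (Q := fun s' => s'.iv 5 = 0 ∧ s'.iv 11 = c)
    (Reach.block (by simp) ?_) (by omega) ?_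
  · simp [blockWP, Instr.Defined, Instr.cost, Instr.run, e6]
  rintro s5 ⟨f1, f2⟩ hf5
  have hs5 := hs4.frame hf5
  have k11 : s5.rm 11 = s.rm 11 := by
    rw [hf5.rm 11 (by decide), hf4.rm 11 (by decide), g 11 (by norm_num)]
  have k4 : s5.rm 4 = s.rm 4 := by
    rw [hf5.rm 4 (by decide), hf4.rm 4 (by decide), g 4 (by norm_num)]
  have k10 : s5.rm 10 = s4.rm 10 := hf5.rm 10 (by decide)
  have k19 : s5.rv 19 = b c := by
    rw [hf5.rv 19 (by decide), hf4.rv 19 (by decide), hf3.rv 19 (by decide),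
      hf2.rv 19 (by decide), a1]
  refine Reach.seq (8 * (m + 1) + 1) 1 (entries_spec hs5 f1 f2 hc (by rw [k11]; exact hN))
    (by omega) ?_
  rintro s6 ⟨l1, l2⟩ hf6
  have hs6 := hs5.frame hf6
  rw [k4] at l2
  rw [k10, k11, k19] at l1
  have e6' : s6.iv 6 = c := by rw [hf6.iv 6 (by decide), hf5.iv 6 (by decide), e6]
  refine Reach.instr trivial (by simp [Instr.cost]) ⟨by simp [Instr.run, e6', hs6.one], ?_, l2⟩
  intro k hk
  refine ⟨s4.rm 10 k, le_trans (le_of_eq ?_) (d1 k hk), (l1 k hk).trans (by rw [add_comm])⟩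
  rw [Finset.sum_range_succ, hVm, zero_mul, add_zero]
  congr 2
  exact Finset.sum_congr rfl fun j hj => by rw [hV j (Finset.mem_range.1 hj)]; rfl

theorem columns_spec {F : BlackBox} {m r L Φ : ℕ} {α σ h η : ℝ} {s : State}
    {X Y Z b : ℕ → ℝ} (hs : Consts m r L α σ h η s) (hF : FmmBound F (m + 1) (σ ^ 32) Φ)
    (hσ : 0 < σ) (hσ' : σ ^ 32 < 1 / 2) (h2 : s.rm 2 = b) (h3 : s.rm 3 = X) (h6 : s.rm 6 = Y)
    (h8 : ∀ j < m, s.rm 8 j = Z j) (hXY : Separated m (σ ^ 32) X Y)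
    (hZ : ∀ j < m, ∀ a, |Z j * b a| < 32) (hN : ∀ k < m + 1, s.rm 11 k ≠ 0) :
    Reach F columnsProg s (r * (Φ + 15 * (m + 1) + 11) + 2) (fun s' =>
      ∀ c < r, ∀ k < m + 1, ∃ g,
        |g - ∑ j ∈ Finset.range m, Z j * b (c + r * (j + 1)) * (1 / (X k - Y j))| ≤ σ ^ 32 ∧
        s'.rm 4 (c + r * k) = (b c + g) / s.rm 11 k) := by
  refine Reach.seq 1 (r * (Φ + 15 * (m + 1) + 11) + 1) (Q := fun s' => s'.iv 6 = 0)
    (Reach.instr trivial (by simp [Instr.cost]) (by simp [Instr.run])) (by omega) ?_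
  intro s1 a1 hf1
  have hs1 := hs.frame hf1
  refine Reach.count (fun i s' => ∀ c < i, ∀ k < m + 1, ∃ g,
        |g - ∑ j ∈ Finset.range m, Z j * b (c + r * (j + 1)) * (1 / (X k - Y j))| ≤ σ ^ 32 ∧
        s'.rm 4 (c + r * k) = (b c + g) / s.rm 11 k) r (Φ + 15 * (m + 1) + 10) le_rfl a1 hs1.cols
    (by decide) (by simp) ?_
  intro c s2 hc hf2 b1 e6
  have hs2 := hs1.frame hf2
  have k11 : s2.rm 11 = s.rm 11 := by rw [hf2.rm 11 (by decide), hf1.rm 11 (by decide)]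
  refine (columnStep_spec hs2 hF hσ hσ' (by rw [hf2.rm 2 (by decide), hf1.rm 2 (by decide), h2])
    (by rw [hf2.rm 3 (by decide), hf1.rm 3 (by decide), h3])
    (by rw [hf2.rm 6 (by decide), hf1.rm 6 (by decide), h6])
    (by rw [hf2.rm 8 (by decide), hf1.rm 8 (by decide)]; exact h8) hXY hZ (by rw [k11]; exact hN)
    e6 hc).mono le_rfl ?_
  rintro s3 ⟨c1, c2, c3⟩ _
  refine ⟨c1, fun c' hc' k hk => ?_⟩
  rcases Nat.lt_succ_iff_lt_or_eq.1 hc' with h | rfl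
  · obtain ⟨g, d1, d2⟩ := b1 c' h k hk
    refine ⟨g, d1, ?_⟩
    rw [c3 _ (by rw [Nat.add_mul_mod_self_left, Nat.mod_eq_of_lt (by omega)]; omega), d2]
  · rw [← k11]; exact c2 k hk

/-! ## The perturbed arrowhead matrix -/

/-- The eigenvector for the eigenvalue `x` of the arrowhead matrix with shaft `Z` and poles `Y`. -/
noncomputable def arrowVec (m : ℕ) (Z Y : ℕ → ℝ) (x : ℝ) : Fin (m + 1) → ℝ :=
  Fin.cons 1 fun j : Fin m => Z j / (x - Y j)

theorem arrowhead_mulVec_arrowVec {m : ℕ} {α x : ℝ} {Z W Y : ℕ → ℝ} (hW : ∀ i < m, W i = Z i ^ 2)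
    (hWm : W m = 0) (hx : secular m α W Y x = 0) (hY : ∀ j < m, x - Y j ≠ 0) :
    (arrowhead α (fun i : Fin m => Z i) (fun i : Fin m => Y i)).mulVec (arrowVec m Z Y x) =
      x • arrowVec m Z Y x := by
  ext i
  refine Fin.cases ?_ (fun j => ?_) i
  · rw [arrowhead_mulVec_zero]
    simp only [arrowVec, Fin.cons_zero, Fin.cons_succ, Pi.smul_apply, smul_eq_mul, mul_one]
    rw [secular, Finset.sum_range_succ, hWm, zero_mul, add_zero, Finset.sum_range] at hx
    have : ∀ j : Fin m, W j * (1 / (x - Y j)) = Z j * (Z j / (x - Y j)) := fun j => by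
      rw [hW j j.2]; ring
    simp only [this] at hx
    linarith
  · rw [arrowhead_mulVec_succ]
    simp only [arrowVec, Fin.cons_zero, Fin.cons_succ, Pi.smul_apply, smul_eq_mul, mul_one]
    have := hY j j.2
    field_simp
    ring

theorem arrowVec_ne_zero (m : ℕ) (Z Y : ℕ → ℝ) (x : ℝ) : arrowVec m Z Y x ≠ 0 := fun h => by
  have := congrFun h 0
  simp [arrowVec] at this

theorem arrowVec_dotProduct_self (m : ℕ) (Z Y : ℕ → ℝ) (x : ℝ) :
    arrowVec m Z Y x ⬝ᵥ arrowVec m Z Y x =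
      1 + ∑ j ∈ Finset.range m, Z j ^ 2 * (1 / (x - Y j) ^ 2) := by
  rw [dotProduct, Fin.sum_univ_succ, Finset.sum_range]
  simp only [arrowVec, Fin.cons_zero, Fin.cons_succ, mul_one]
  congr 1
  exact Finset.sum_congr rfl fun j _ => by rw [← pow_two, div_pow]; ring

section

variable {m : ℕ} {ε α σ η : ℝ} {z d Z Y W e lam : ℕ → ℝ} {s : State}

theorem EigResult.dist (h : EigResult m ε α σ η z d Z Y W e lam s) {k j : ℕ} (hk : k ≤ m)
    (hj : j ≤ m) : σ ^ 4 ≤ |lam k - Y j| :=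
  h.roots.pole k hk j hj _ _ (h.margin k hk).1 (h.margin k hk).2

theorem EigResult.strictMono (h : EigResult m ε α σ η z d Z Y W e lam s) (hσ : 0 < σ) :
    StrictMono fun k : Fin (m + 1) => lam k := by
  rw [Fin.strictMono_iff_lt_succ]
  intro k
  have h1 := (h.margin k (by omega)).2
  have h2 := (h.margin (k + 1) (by omega)).1
  have : 0 < σ ^ 4 := by positivity
  simp only [Fin.val_castSucc, Fin.val_succ]
  linarith

theorem EigResult.diagonalizes (h : EigResult m ε α σ η z d Z Y W e lam s) (hσ : 0 < σ) :
    Diagonalizes (arrowhead α (fun i : Fin m => Z i) (fun i : Fin m => Y i))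
      (normalized fun k : Fin (m + 1) => arrowVec m Z Y (lam k)) (fun k => lam k) := by
  refine diagonalizes_of_eigenvectors (arrowhead_transpose _ _ _)
    (fun k => arrowVec_ne_zero _ _ _ _) (h.strictMono hσ).injective fun k => ?_
  refine arrowhead_mulVec_arrowVec h.weight_eq h.weight_last (h.root k (by omega)) fun j hj h0 => ?_
  have := h.dist (k := k) (j := j) (by omega) (by omega)
  rw [h0, abs_zero] at this
  have : 0 < σ ^ 4 := by positivity
  linarith

theorem EigResult.specNorm_sub_le (h : EigResult m ε α σ η z d Z Y W e lam s) (hε : 0 < ε)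
    (hmσ : (m + 1) * σ = ε / 64) :
    specNorm (arrowhead α (fun i : Fin m => z i) (fun i : Fin m => d i) -
      arrowhead α (fun i : Fin m => Z i) (fun i : Fin m => Y i)) ≤ ε / 8 := by
  rw [arrowhead_sub]
  have hm : (0 : ℝ) ≤ m := Nat.cast_nonneg m
  refine specNorm_arrowhead_le (a := (ε / 64) ^ 2) (b := (ε / 16) ^ 2) (by linarith) ?_
    (fun i => ?_) (by nlinarith) (by nlinarith)
  · calc ∑ i : Fin m, ((fun i : Fin m => z i) - fun i : Fin m => Z i) i ^ 2
        ≤ ∑ _i : Fin m, σ ^ 2 := Finset.sum_le_sum fun i _ => by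
          rw [← sq_abs]
          exact pow_le_pow_left₀ (abs_nonneg _)
            (by simpa [abs_sub_comm] using h.shaft_near i i.2) 2
      _ = m * σ ^ 2 := by simp
      _ ≤ (ε / 64) ^ 2 := by rw [← hmσ]; nlinarith [mul_nonneg hm (sq_nonneg σ), sq_nonneg (m * σ)]
  · rw [← sq_abs]
    exact pow_le_pow_left₀ (abs_nonneg _)
      (by simpa [abs_sub_comm] using h.pole_near i i.2) 2

end

/-! ## Error analysis -/

theorem abs_inv_sub_le {σ x y : ℝ} (hσ : 0 < σ) (hσ' : σ ≤ 1 / 128) (hx : σ ^ 4 ≤ |x|)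
    (hxy : |y - x| ≤ 2 * σ ^ 32) : σ ^ 5 ≤ |y| ∧ |1 / y - 1 / x| ≤ 2 * σ ^ 23 ∧
      |1 / y ^ 2 - 1 / x ^ 2| ≤ 4 * σ ^ 18 := by
  have h5 : σ ^ 5 ≤ σ ^ 4 / 128 := by
    have : σ ^ 5 = σ ^ 4 * σ := by ring
    rw [this]
    nlinarith [pow_pos hσ 4]
  have h32 : σ ^ 32 ≤ σ ^ 5 := pow_le_pow_of_le_one hσ.le (by linarith) (by norm_num)
  have hp5 : 0 < σ ^ 5 := by positivity
  have hy : σ ^ 5 ≤ |y| := by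
    have := abs_sub_abs_le_abs_sub x y
    rw [abs_sub_comm] at this
    linarith
  have hx0 : 0 < |x| := lt_of_lt_of_le (by positivity) hx
  have hy0 : 0 < |y| := lt_of_lt_of_le hp5 hy
  have hx' : x ≠ 0 := abs_pos.1 hx0
  have hy' : y ≠ 0 := abs_pos.1 hy0
  have h1 : |1 / y - 1 / x| ≤ 2 * σ ^ 23 := by
    have : 1 / y - 1 / x = -(y - x) / (y * x) := by field_simp; ring
    rw [this, abs_div, abs_neg, abs_mul, div_le_iff₀ (by positivity)]
    calc |y - x| ≤ 2 * σ ^ 32 := hxy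
      _ = 2 * σ ^ 23 * (σ ^ 5 * σ ^ 4) := by ring
      _ ≤ 2 * σ ^ 23 * (|y| * |x|) := by gcongr
  refine ⟨hy, h1, ?_⟩
  have h2 : |1 / y + 1 / x| ≤ 2 / σ ^ 5 := by
    refine (abs_add_le _ _).trans ?_
    rw [abs_div, abs_div, abs_one]
    have a1 : 1 / |y| ≤ 1 / σ ^ 5 := one_div_le_one_div_of_le hp5 hy
    have a2 : 1 / |x| ≤ 1 / σ ^ 5 := one_div_le_one_div_of_le hp5 (by linarith)
    have a3 : 2 / σ ^ 5 = 1 / σ ^ 5 + 1 / σ ^ 5 := by ring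
    linarith
  have h3 : 1 / y ^ 2 - 1 / x ^ 2 = (1 / y - 1 / x) * (1 / y + 1 / x) := by ring
  rw [h3, abs_mul]
  calc |1 / y - 1 / x| * |1 / y + 1 / x| ≤ 2 * σ ^ 23 * (2 / σ ^ 5) := by gcongr
    _ = 4 * σ ^ 18 := by field_simp; ring

theorem abs_sum_sub_sum_le {m : ℕ} {c f g : ℕ → ℝ} {C t : ℝ} (hC : 0 ≤ C)
    (hc : ∀ j < m, |c j| ≤ C) (hfg : ∀ j < m, |f j - g j| ≤ t) :
    |∑ j ∈ Finset.range m, c j * f j - ∑ j ∈ Finset.range m, c j * g j| ≤ m * (C * t) := by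
  rw [← Finset.sum_sub_distrib]
  refine (Finset.abs_sum_le_sum_abs _ _).trans ?_
  refine (Finset.sum_le_sum fun j hj => ?_).trans_eq
    (by rw [Finset.sum_const, Finset.card_range, nsmul_eq_mul])
  rw [Finset.mem_range] at hj
  rw [← mul_sub, abs_mul]
  exact mul_le_mul (hc j hj) (hfg j hj) (abs_nonneg _) hC

theorem abs_div_sqrt_sub_le {a a' G G' t : ℝ} (hG : 0 ≤ G) (ht : t ≤ 1 / 2)
    (ha : |a - a'| ≤ t) (hGG : |G - G'| ≤ t) (h1 : |a / √(1 + G)| ≤ 1) :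
    |a / √(1 + G) - a' / √(1 + G')| ≤ 4 * t := by
  have hG' := abs_le.1 hGG
  have hb : 1 ≤ √(1 + G) := Real.one_le_sqrt.2 (by linarith)
  have hb' : 1 / 2 ≤ √(1 + G') := Real.le_sqrt_of_sq_le (by linarith)
  have hbb : |√(1 + G) - √(1 + G')| ≤ t := by
    have e : (√(1 + G) - √(1 + G')) * (√(1 + G) + √(1 + G')) = G - G' := by
      have e1 := Real.sq_sqrt (show 0 ≤ 1 + G by linarith)
      have e2 := Real.sq_sqrt (show 0 ≤ 1 + G' by linarith)
      nlinarith
    have e' : |√(1 + G) - √(1 + G')| * (√(1 + G) + √(1 + G')) ≤ t := by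
      rw [← abs_of_nonneg (show 0 ≤ √(1 + G) + √(1 + G') by positivity), ← abs_mul, e]
      exact hGG
    refine le_trans (le_mul_of_one_le_right (abs_nonneg _) (by linarith)) e'
  have hb0 : √(1 + G') ≠ 0 := by linarith
  have hb0' : √(1 + G) ≠ 0 := by linarith
  have e : a / √(1 + G) - a' / √(1 + G') =
      ((a - a') - a / √(1 + G) * (√(1 + G) - √(1 + G'))) / √(1 + G') := by
    field_simp; ring
  rw [e, abs_div, abs_of_pos (show 0 < √(1 + G') by linarith), div_le_iff₀ (by linarith)]
  have h3 : |a / √(1 + G) * (√(1 + G) - √(1 + G'))| ≤ t := by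
    rw [abs_mul]
    exact (mul_le_of_le_one_left (abs_nonneg _) h1).trans hbb
  have h4 := abs_sub (a - a') (a / √(1 + G) * (√(1 + G) - √(1 + G')))
  have h5 := (abs_nonneg _).trans ha
  nlinarith

/-- The content of the array that holds the matrix `B`. -/
noncomputable def matrixArray {n r : ℕ} (B : Matrix (Fin n) (Fin r) ℝ) : ℕ → ℝ :=
  toArray (fun a => B (finProdFinEquiv.symm a).1 (finProdFinEquiv.symm a).2)

theorem matrixArray_apply {n r : ℕ} (B : Matrix (Fin n) (Fin r) ℝ) (i : Fin n) (c : Fin r) :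
    matrixArray B (c + r * i) = B i c := by
  have h : (c : ℕ) + r * i = (finProdFinEquiv (i, c) : Fin (n * r)) := rfl
  rw [matrixArray, h, toArray, dif_pos (finProdFinEquiv (i, c)).2, Fin.eta,
    Equiv.symm_apply_apply]

theorem abs_toArray_le {n : ℕ} {v : Fin n → ℝ} {C : ℝ} (hC : 0 ≤ C) (h : ∀ i, |v i| ≤ C) (a : ℕ) :
    |toArray v a| ≤ C := by
  unfold toArray
  split_ifs with ha
  · exact h _
  · simpa using hC

theorem abs_matrixArray_le {n r : ℕ} {B : Matrix (Fin n) (Fin r) ℝ}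
    (hB : ∀ j, ‖WithLp.toLp 2 (fun i => B i j)‖ ≤ 1) (a : ℕ) : |matrixArray B a| ≤ 1 :=
  abs_toArray_le zero_le_one (fun b => by
    set j := (finProdFinEquiv.symm b).2
    exact (PiLp.norm_apply_le (WithLp.toLp 2 fun i => B i j) (finProdFinEquiv.symm b).1).trans
      (hB j)) a

theorem toArray_val {n : ℕ} (v : Fin n → ℝ) (i : Fin n) : toArray v i = v i := by
  rw [toArray, dif_pos i.2]

theorem Diagonalizes.specNorm_le {n : ℕ} {A U : Matrix (Fin n) (Fin n) ℝ} {lam mu : Fin n → ℝ}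
    (h : Diagonalizes A U lam) {c : ℝ} (hc : 0 ≤ c) (hmu : ∀ i, |lam i - mu i| ≤ c) :
    specNorm (A - U * Matrix.diagonal mu * U.transpose) ≤ c := by
  have e : A - U * Matrix.diagonal mu * U.transpose =
      U * Matrix.diagonal (fun i => lam i - mu i) * U.transpose := by
    rw [h.eq, ← Matrix.sub_mul, ← Matrix.mul_sub, Matrix.diagonal_sub]
  have hU : U.transpose * U = 1 := (Matrix.mem_orthogonalGroup_iff' (Fin n) ℝ).1 h.orth
  rw [e]
  refine _root_.specNorm_le hc fun x => ?_
  rw [← h.dotProduct_transpose x, ← h.dotProduct_transpose (Matrix.mulVec _ x),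
    Matrix.mulVec_mulVec, Matrix.mul_assoc, ← Matrix.mul_assoc U.transpose, hU, Matrix.one_mul,
    ← Matrix.mulVec_mulVec, dotProduct, dotProduct, Finset.mul_sum]
  refine Finset.sum_le_sum fun i _ => ?_
  rw [Matrix.mulVec_diagonal]
  have h1 : (lam i - mu i) ^ 2 ≤ c ^ 2 := by
    rw [← sq_abs]; exact pow_le_pow_left₀ (abs_nonneg _) (hmu i) 2
  nlinarith [mul_le_mul_of_nonneg_right h1 (sq_nonneg (U.transpose.mulVec x i))]

theorem Diagonalizes.abs_transpose_mul_le {n r : ℕ} {A U : Matrix (Fin n) (Fin n) ℝ}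
    {lam : Fin n → ℝ} (h : Diagonalizes A U lam) {B : Matrix (Fin n) (Fin r) ℝ}
    (hB : ∀ j, ‖WithLp.toLp 2 (fun i => B i j)‖ ≤ 1) (k : Fin n) (c : Fin r) :
    |(U.transpose * B) k c| ≤ 1 := by
  have h1 := h.dotProduct_transpose fun i => B i c
  rw [← norm_toLp_sq (fun i => B i c), ← norm_toLp_sq] at h1
  have h2 := PiLp.norm_apply_le (WithLp.toLp 2 (U.transpose.mulVec fun i => B i c)) k
  rw [(pow_left_inj₀ (norm_nonneg _) (norm_nonneg _) two_ne_zero).1 h1] at h2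
  exact h2.trans (hB c)

theorem normalized_transpose_mul {m r : ℕ} (B : Matrix (Fin (m + 1)) (Fin r) ℝ) (Z Y lam : ℕ → ℝ)
    (k : Fin (m + 1)) (c : Fin r) :
    ((normalized fun k : Fin (m + 1) => arrowVec m Z Y (lam k)).transpose * B) k c =
      (matrixArray B c + ∑ j ∈ Finset.range m,
        Z j * matrixArray B (c + r * (j + 1)) * (1 / (lam k - Y j))) /
        √(1 + ∑ j ∈ Finset.range m, Z j ^ 2 * (1 / (lam k - Y j) ^ 2)) := by
  rw [Matrix.mul_apply, ← arrowVec_dotProduct_self]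
  simp only [normalized, Matrix.transpose_apply, Matrix.of_apply, div_mul_eq_mul_div]
  rw [← Finset.sum_div, Fin.sum_univ_succ, Finset.sum_range]
  congr 2
  · have := matrixArray_apply B 0 c
    rw [Fin.val_zero, mul_zero, add_zero] at this
    simp [arrowVec, this]
  · refine Finset.sum_congr rfl fun j _ => ?_
    have := matrixArray_apply B j.succ c
    rw [Fin.val_succ] at this
    rw [this]
    simp only [arrowVec, Fin.cons_succ]
    ring

theorem diagProg_spec {F : BlackBox} {m r N T Φ : ℕ} {ε α σ : ℝ} {z d : Fin m → ℝ}
    {B : Matrix (Fin (m + 1)) (Fin r) ℝ} (hε : 0 < ε) (hε' : ε ≤ 1)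
    (hε'' : 2 * ε ≤ m + 1) (hσ : σ = ε / (64 * (m + 1)))
    (hN : 4 / 2 ^ N ≤ ε / 16) (hT : 16 / 2 ^ T ≤ σ ^ 32) (hF : FmmBound F (m + 1) (σ ^ 32) Φ)
    (hH : specNorm (arrowhead α z d) ≤ 1) (hB : ∀ j, ‖WithLp.toLp 2 (fun i => B i j)‖ ≤ 1) :
    Reach F (diagProg (.rop 5 .add 3 9)) (diagInput ε α z d B)
      (100 * (N + 1) * (m + 1) + T * (Φ + 15 * (m + 1) + 7) +
        ((Φ + 6 * (m + 1) + 4) + (r * (Φ + 15 * (m + 1) + 11) + 2))) (fun s =>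
        ∃ Q ∈ Matrix.orthogonalGroup (Fin (m + 1)) ℝ,
            specNorm (arrowhead α z d -
              Q * Matrix.diagonal (outVector s (m + 1)) * Q.transpose) ≤ ε ∧
            ∀ i j, |(Q.transpose * B - outMatrix s (m + 1) r) i j| ≤
              ε / ((m + 1 : ℕ) : ℝ) ^ 2) := by
  obtain ⟨hα, hd, hz⟩ := arrowhead_bounds hH
  have hm0 : (0 : ℝ) ≤ m := Nat.cast_nonneg m
  have hσ0 : 0 < σ := by rw [hσ]; positivity
  have hσ1 : σ ≤ 1 / 128 := by
    rw [hσ, div_le_div_iff₀ (by positivity) (by norm_num)]; linarith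
  have hmσ : (m + 1) * σ = ε / 64 := by rw [hσ]; field_simp
  have hle : ∀ {k l : ℕ}, k ≤ l → σ ^ l ≤ σ ^ k := fun hkl =>
    pow_le_pow_of_le_one hσ0.le (by linarith) hkl
  have hδ : σ ^ 32 < 1 / 2 := (hle (show 1 ≤ 32 by norm_num)).trans_lt (by linarith)
  refine Reach.seq _ _ (eigProg_spec (ε := ε) (α := α) (r := r) (z := toArray z)
    (d := toArray d) (s := diagInput ε α z d B) rfl rfl rfl rfl
    rfl rfl (fun _ => rfl) hε hε' hε'' hσ (.inr ⟨rfl, rfl⟩) hN hT hF hα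
    (abs_toArray_le zero_le_one hd)
    (by rw [Finset.sum_range]; simpa only [toArray_val] using hz)) le_rfl ?_
  rintro s1 ⟨L, h, Z, Y, W, e, lam, hs1, hE⟩ hf1
  have hX : ∀ k ≤ m, |s1.rm 3 k - lam k| ≤ 2 * σ ^ 32 := fun k hk =>
    (hE.approx k hk).trans_eq (by ring)
  have hdist := fun k (hk : k ≤ m) j (hj : j ≤ m) => abs_inv_sub_le hσ0 hσ1 (hE.dist hk hj)
    (y := s1.rm 3 k - Y j) (by rw [sub_sub_sub_cancel_right]; exact hX k hk)
  have hsep : Separated m (σ ^ 32) (s1.rm 3) Y := by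
    refine ⟨fun k hk => ?_, fun j hj => hE.roots.pole_lt j (by omega), fun k hk j hj => ?_⟩
    · have h1 := abs_le.1 (hX k (by omega))
      have h2 := hE.roots.mem k (by omega)
      have h3 := hE.roots.lower k (by omega)
      have h4 := hE.roots.upper k (by omega)
      rw [abs_lt]; constructor <;> linarith
    · rw [← pow_mul]
      exact (hle (by norm_num)).trans (hdist k (by omega) j (by omega)).1
  have hZ2 : ∀ j < m, |Z j| ≤ 2 := fun j hj => by
    have h1 := abs_le.1 (hE.shaft_near j hj)
    have h2 : toArray z j ^ 2 ≤ 1 := by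
      refine le_trans ?_ hz
      rw [show toArray z j = z ⟨j, hj⟩ from toArray_val z ⟨j, hj⟩]
      exact Finset.single_le_sum (f := fun i => z i ^ 2) (fun i _ => sq_nonneg _)
        (Finset.mem_univ _)
    have h3 := abs_le.1 ((sq_le_one_iff_abs_le_one _).1 h2)
    rw [abs_le]; constructor <;> linarith
  have hW0 : ∀ j < m + 1, 0 ≤ W j := fun j hj => by
    rcases Nat.lt_succ_iff_lt_or_eq.1 hj with hj | rfl
    · rw [hE.weight_eq j hj]; positivity
    · rw [hE.weight_last]
  refine Reach.seq _ _ (norm_spec hs1 hF hσ0 hδ rfl hE.poles hE.weights hsep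
    (fun j hj => hE.roots.weight j (by omega)) hW0) le_rfl ?_
  intro s2 hn hf2
  have hs2 := hs1.frame hf2
  have hg0 : ∀ k < m + 1, ∀ g, |g - ∑ j ∈ Finset.range (m + 1),
      W j * (1 / (s1.rm 3 k - Y j) ^ 2)| ≤ σ ^ 32 → 0 < 1 + g := by
    intro k hk g hg
    have h1 := (abs_le.1 hg).1
    have h2 : 0 ≤ ∑ j ∈ Finset.range (m + 1), W j * (1 / (s1.rm 3 k - Y j) ^ 2) :=
      Finset.sum_nonneg fun j hj => mul_nonneg (hW0 j (Finset.mem_range.1 hj))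
        (one_div_nonneg.2 (sq_nonneg _))
    linarith
  refine (columns_spec (X := s1.rm 3) (Y := Y) (Z := Z) (b := matrixArray B) hs2 hF hσ0 hδ ?_
    (hf2.rm 3 (by decide)) ((hf2.rm 6 (by decide)).trans hE.poles)
    (by rw [hf2.rm 8 (by decide)]; exact hE.shaft) hsep ?_ ?_).mono le_rfl ?_
  · rw [hf2.rm 2 (by decide), hf1.rm 2 (by decide)]; rfl
  · intro j hj a
    rw [abs_mul]
    nlinarith [hZ2 j hj, abs_matrixArray_le hB a, abs_nonneg (Z j), abs_nonneg (matrixArray B a)]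
  · intro k hk
    obtain ⟨g, h1, h2⟩ := hn k hk
    rw [h2]
    exact (Real.sqrt_pos.2 (hg0 k hk g h1)).ne'
  intro s3 hc hf3
  have hD := hE.diagonalizes hσ0
  refine ⟨_, hD.orth, ?_, ?_⟩
  · have h1 := hE.specNorm_sub_le hε hmσ
    have h2 := hD.specNorm_le (mu := outVector s3 (m + 1)) (c := 2 * σ ^ 32) (by positivity)
      fun k => by
        rw [abs_sub_comm, outVector, hf3.rm 3 (by decide), hf2.rm 3 (by decide)]
        exact hX k (by omega)
    simp only [toArray_val] at h1
    rw [← sub_add_sub_cancel _ (arrowhead α (fun i : Fin m => Z i) (fun i : Fin m => Y i))]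
    refine (specNorm_add_le _ _).trans ?_
    have h3 := hle (show 1 ≤ 32 by norm_num)
    nlinarith
  · intro k c
    obtain ⟨g, h1, h2⟩ := hc c c.2 k k.2
    obtain ⟨g', h3, h4⟩ := hn k k.2
    have hub := hD.abs_transpose_mul_le hB k c
    rw [normalized_transpose_mul] at hub
    rw [Matrix.sub_apply, normalized_transpose_mul, outMatrix, Matrix.of_apply, h2, h4]
    rw [Finset.sum_range_succ, hE.weight_last, zero_mul, add_zero] at h3
    have hW : ∑ j ∈ Finset.range m, W j * (1 / (s1.rm 3 k - Y j) ^ 2) =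
        ∑ j ∈ Finset.range m, Z j ^ 2 * (1 / (s1.rm 3 k - Y j) ^ 2) :=
      Finset.sum_congr rfl fun j hj => by rw [hE.weight_eq j (Finset.mem_range.1 hj)]
    rw [hW] at h3
    have hmσ' : m * σ ≤ 1 / 64 := by nlinarith
    have e1 := abs_sum_sub_sum_le (C := 2) (c := fun j => Z j * matrixArray B (c + r * (j + 1)))
      (f := fun j => 1 / (s1.rm 3 k - Y j)) (g := fun j => 1 / (lam k - Y j)) (t := 2 * σ ^ 23)
      (by norm_num) (fun j hj => by
        rw [abs_mul]
        have := abs_matrixArray_le hB (c + r * (j + 1))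
        nlinarith [hZ2 j hj, abs_nonneg (Z j), abs_nonneg (matrixArray B (c + r * (j + 1)))])
      (fun j hj => (hdist k (by omega) j (by omega)).2.1)
    have e2 := abs_sum_sub_sum_le (C := 4) (c := fun j => Z j ^ 2)
      (f := fun j => 1 / (s1.rm 3 k - Y j) ^ 2) (g := fun j => 1 / (lam k - Y j) ^ 2)
      (t := 4 * σ ^ 18) (by norm_num) (fun j hj => by
        rw [abs_pow]; nlinarith [hZ2 j hj, abs_nonneg (Z j)])
      (fun j hj => (hdist k (by omega) j (by omega)).2.2)
    have t1 : m * (2 * (2 * σ ^ 23)) ≤ σ ^ 17 := by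
      have e : m * (2 * (2 * σ ^ 23)) = 4 * σ ^ 22 * (m * σ) := by ring
      have := mul_le_mul_of_nonneg_left hmσ' (show 0 ≤ 4 * σ ^ 22 by positivity)
      have := hle (show 17 ≤ 22 by norm_num)
      have : 0 < σ ^ 17 := by positivity
      rw [e]; linarith
    have t2 : m * (4 * (4 * σ ^ 18)) ≤ σ ^ 17 := by
      have e : m * (4 * (4 * σ ^ 18)) = 16 * σ ^ 17 * (m * σ) := by ring
      have := mul_le_mul_of_nonneg_left hmσ' (show 0 ≤ 16 * σ ^ 17 by positivity)
      have : 0 < σ ^ 17 := by positivity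
      rw [e]; linarith
    have t3 := hle (show 17 ≤ 32 by norm_num)
    have t4 := hle (show 1 ≤ 17 by norm_num)
    refine (abs_div_sqrt_sub_le (t := 2 * σ ^ 17) (Finset.sum_nonneg fun j _ => by positivity)
      (by linarith) ?_ ?_ hub).trans ?_
    · rw [add_sub_add_left_eq_sub, abs_sub_comm]
      refine (abs_sub_le _ _ _).trans (add_le_add h1 (e1.trans t1) |>.trans ?_)
      linarith
    · rw [abs_sub_comm]
      refine (abs_sub_le _ _ _).trans (add_le_add h3 (e2.trans t2) |>.trans ?_)
      linarith
    · have u1 : ε / ((m + 1 : ℕ) : ℝ) ^ 2 = 64 * σ / (m + 1) := by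
        rw [hσ]; push_cast; field_simp
      have u2 : σ ≤ 1 / (m + 1) := by rw [le_div_iff₀ (by positivity)]; linarith
      have u3 := hle (show 2 ≤ 17 by norm_num)
      have u4 : σ * σ ≤ σ * (1 / (m + 1)) := mul_le_mul_of_nonneg_left u2 hσ0.le
      rw [u1, mul_div_assoc, div_eq_mul_one_div σ]
      nlinarith

/-! ## Costs -/

theorem half_lt_log_two : (1 : ℝ) / 2 < Real.log 2 := by
  have := Real.log_two_gt_d9; linarith

theorem exists_two_pow_ge {x : ℝ} (hx : 2 ≤ x) {k : ℕ} {y : ℝ} (hy : 1 ≤ y) (hyx : y ≤ x ^ k) :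
    ∃ N : ℕ, y ≤ 2 ^ N ∧ (N : ℝ) ≤ (2 * k + 2) * Real.log x := by
  have h2 := half_lt_log_two
  have hl : Real.log 2 ≤ Real.log x := Real.log_le_log (by norm_num) hx
  have hly : Real.log y ≤ k * Real.log x := by
    rw [← Real.log_pow]; exact Real.log_le_log (by linarith) hyx
  have hly0 := Real.log_nonneg hy
  refine ⟨⌈Real.logb 2 y⌉₊, ?_, ?_⟩
  · calc y = 2 ^ Real.logb 2 y := (Real.rpow_logb (by norm_num) (by norm_num) (by linarith)).symm
      _ ≤ 2 ^ ((⌈Real.logb 2 y⌉₊ : ℕ) : ℝ) :=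
        Real.rpow_le_rpow_of_exponent_le (by norm_num) (Nat.le_ceil _)
      _ = 2 ^ ⌈Real.logb 2 y⌉₊ := Real.rpow_natCast _ _
  · have h3 : Real.logb 2 y ≤ 2 * Real.log y := by
      rw [Real.logb, div_le_iff₀ (by linarith)]
      nlinarith
    have h4 := Nat.ceil_lt_add_one (a := Real.logb 2 y)
      (Real.logb_nonneg (by norm_num) hy)
    nlinarith

/-- The cost of an AFMM call. -/
theorem exists_fmmBound {F : BlackBox} {ξ : ℝ} (hξ : 1 ≤ ξ) (hF : F.IsAFMM ξ) :
    ∃ A : ℝ, 0 ≤ A ∧ ∀ (m : ℕ) (ε σ : ℝ), 0 < ε → ε ≤ 1 → 2 * ε ≤ m + 1 →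
      σ = ε / (64 * (m + 1)) → ∃ Φ : ℕ, FmmBound F (m + 1) (σ ^ 32) Φ ∧
        (Φ : ℝ) ≤ A * ((m + 1) * Real.log ((m + 1) / ε) ^ ξ) := by
  obtain ⟨K, hK⟩ := hF 32 1 (by norm_num) one_pos 2
  refine ⟨|K| * 225 ^ ξ, by positivity, fun m ε σ hε hε' hε'' hσ => ?_⟩
  have hσ0 : 0 < σ := by rw [hσ]; positivity
  have hm0 : (0 : ℝ) ≤ m := Nat.cast_nonneg m
  set x : ℝ := (m + 1) / ε with hx
  have hx2 : 2 ≤ x := by rw [hx, le_div_iff₀ hε]; exact hε''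
  have hmx : (m : ℝ) + 1 ≤ x := by rw [hx, le_div_iff₀ hε]; nlinarith
  have hσx : σ = (64 * x)⁻¹ := by rw [hσ, hx]; field_simp
  have hn : ((m + 1 : ℕ) : ℝ) / σ ^ 32 ≤ x ^ 225 := by
    rw [hσx, inv_pow, div_inv_eq_mul]
    push_cast
    have h64 : (64 : ℝ) ≤ x ^ 6 := by
      have := pow_le_pow_left₀ (by norm_num) hx2 6
      linarith
    calc ((m : ℝ) + 1) * (64 * x) ^ 32 ≤ x * (x ^ 6 * x) ^ 32 := by gcongr
      _ = x ^ 225 := by rw [← pow_succ, ← pow_mul, ← pow_succ']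
  have hlog : Real.log (((m + 1 : ℕ) : ℝ) / σ ^ 32) ≤ 225 * Real.log x := by
    refine (Real.log_le_log (by positivity) hn).trans_eq ?_
    rw [Real.log_pow]; norm_num
  have hlog0 : 0 ≤ Real.log (((m + 1 : ℕ) : ℝ) / σ ^ 32) := by
    refine Real.log_nonneg ?_
    rw [le_div_iff₀ (by positivity), one_mul]
    have : σ ^ 32 ≤ 1 := pow_le_one₀ hσ0.le (by
      rw [hσ, div_le_one (by positivity)]; nlinarith)
    push_cast; linarith
  have hlx : 0 ≤ Real.log x := Real.log_nonneg (by linarith)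
  have hpow : Real.log (((m + 1 : ℕ) : ℝ) / σ ^ 32) ^ ξ ≤ 225 ^ ξ * Real.log x ^ ξ := by
    rw [← Real.mul_rpow (by norm_num) hlx]
    exact Real.rpow_le_rpow hlog0 hlog (by linarith)
  have hn0 : (0 : ℝ) ≤ ((m + 1 : ℕ) : ℝ) * Real.log (((m + 1 : ℕ) : ℝ) / σ ^ 32) ^ ξ :=
    mul_nonneg (by positivity) (Real.rpow_nonneg hlog0 _)
  refine ⟨⌊|K| * (((m + 1 : ℕ) : ℝ) * Real.log (((m + 1 : ℕ) : ℝ) / σ ^ 32) ^ ξ)⌋₊, ?_, ?_⟩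
  · intro q hq hqn hqa
    obtain ⟨h1, h2⟩ := hK q hq
    rw [hqa] at h1 h2
    rw [hqn] at h2
    refine ⟨h1, Nat.le_floor (h2.trans ?_)⟩
    exact mul_le_mul_of_nonneg_right (le_abs_self K) hn0
  · refine (Nat.floor_le (mul_nonneg (abs_nonneg _) hn0)).trans ?_
    rw [mul_assoc]
    refine mul_le_mul_of_nonneg_left ?_ (abs_nonneg _)
    calc ((m + 1 : ℕ) : ℝ) * Real.log (((m + 1 : ℕ) : ℝ) / σ ^ 32) ^ ξ
        ≤ ((m + 1 : ℕ) : ℝ) * (225 ^ ξ * Real.log x ^ ξ) := by gcongr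
      _ = 225 ^ ξ * ((m + 1) * Real.log x ^ ξ) := by push_cast; ring

theorem one_le_rpow_mul {x ξ : ℝ} (hξ : 1 ≤ ξ) (hx : 2 ≤ x) :
    1 ≤ 2 ^ ξ * Real.log x ^ ξ := by
  have h2 := half_lt_log_two
  have hl : Real.log 2 ≤ Real.log x := Real.log_le_log (by norm_num) hx
  rw [← Real.mul_rpow (by norm_num) (by linarith)]
  exact Real.one_le_rpow (by linarith) (by linarith)

theorem eigProg_correct {F : BlackBox} {ξ : ℝ} (hξ : 1 ≤ ξ) (hF : F.IsAFMM ξ) :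
    ∃ K : ℝ, ∀ (m : ℕ) (ε α : ℝ) (z d : Fin m → ℝ), 0 < ε → ε ≤ 1 / 2 →
      specNorm (arrowhead α z d) ≤ 1 →
      ∃ (s : State) (t : ℕ), Exec F (eigProg (.rop 5 .div 0 13)) (eigInput ε α z d) s t ∧
        (t : ℝ) ≤ K * ((m + 1 : ℕ) * Real.log (1 / ε) * Real.log ((m + 1 : ℕ) / ε) ^ ξ) ∧
        ∃ lam : Fin (m + 1) → ℝ, IsSortedSpectrum (arrowhead α z d) lam ∧
          ∀ i, |lam i - outVector s (m + 1) i| ≤ ε := by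
  obtain ⟨A, hA, hΦ⟩ := exists_fmmBound hξ hF
  refine ⟨2500 * 2 ^ ξ + 18 * A, fun m ε α z d hε hε' hH => ?_⟩
  have hm0 : (0 : ℝ) ≤ m := Nat.cast_nonneg m
  obtain ⟨hα, hd, hz⟩ := arrowhead_bounds hH
  set σ := ε / (64 * ((m : ℝ) + 1)) with hσ
  have hσ0 : 0 < σ := by rw [hσ]; positivity
  have hmσ : (m + 1) * σ = ε / 64 := by rw [hσ]; field_simp
  have hε'' : 2 * ε ≤ m + 1 := by linarith
  obtain ⟨Φ, hΦ1, hΦ2⟩ := hΦ m ε σ hε (by linarith) hε'' hσ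
  have hx : 2 ≤ 1 / ε := by rw [le_div_iff₀ hε]; linarith
  have h64 : (64 : ℝ) ≤ (1 / ε) ^ 6 := by
    have := pow_le_pow_left₀ (by norm_num) hx 6
    linarith
  obtain ⟨N, hN1, hN2⟩ := exists_two_pow_ge hx (k := 7) (y := 64 / ε)
    (by rw [le_div_iff₀ hε]; linarith) (by
      calc 64 / ε = 64 * (1 / ε) := by ring
        _ ≤ (1 / ε) ^ 6 * (1 / ε) := by gcongr
        _ = (1 / ε) ^ 7 := by ring)
  obtain ⟨T, hT1, hT2⟩ := exists_two_pow_ge hx (k := 8) (y := 128 / ε)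
    (by rw [le_div_iff₀ hε]; linarith) (by
      calc 128 / ε = 64 * 2 * (1 / ε) := by ring
        _ ≤ (1 / ε) ^ 6 * (1 / ε) * (1 / ε) := by gcongr
        _ = (1 / ε) ^ 8 := by ring)
  rw [div_le_iff₀ hε] at hN1 hT1
  obtain ⟨s, t, hex, ht, L, h, Z, Y, W, e, lam, -, hE⟩ := eigProg_spec (F := F) (ε := ε) (α := α)
    (r := 0) (z := toArray z) (d := toArray d) (s := eigInput ε α z d) (N := N) (T := T) rfl rfl
    rfl rfl rfl rfl (fun _ => rfl) hε (by linarith) hε'' hσ (.inl ⟨rfl, rfl⟩)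
    (by rw [div_le_iff₀ (by positivity)]; linarith)
    (by rw [div_le_iff₀ (by positivity)]; linarith) hΦ1 hα
    (abs_toArray_le zero_le_one hd)
    (by rw [Finset.sum_range]; simpa only [toArray_val] using hz)
  refine ⟨s, t, hex, ?_, ?_⟩
  · have hxx : 2 ≤ ((m : ℝ) + 1) / ε := by rw [le_div_iff₀ hε]; linarith
    have h1 := one_le_rpow_mul hξ hxx
    have h2 := half_lt_log_two
    have h3 : Real.log 2 ≤ Real.log (1 / ε) := Real.log_le_log (by norm_num) hx
    have ht' : (t : ℝ) ≤ 100 * (N + 1) * (m + 1) + T * (Φ + 15 * (m + 1) + 7) := by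
      exact_mod_cast ht
    push_cast at hN2 hT2 ⊢
    set l := Real.log (1 / ε)
    set p := Real.log (((m : ℝ) + 1) / ε) ^ ξ with hp
    set c : ℝ := 2 ^ ξ with hc
    have hc0 : 0 ≤ c := by positivity
    have hl0 : 0 ≤ l := by linarith
    have hnl : 0 ≤ ((m : ℝ) + 1) * l := by positivity
    have e1 : ((m : ℝ) + 1) * l ≤ ((m : ℝ) + 1) * l * (c * p) := le_mul_of_one_le_right hnl h1
    have e2 : (T : ℝ) * (Φ + 15 * (m + 1) + 7) ≤
        (2 * 8 + 2) * l * (A * ((m + 1) * p) + 22 * (m + 1)) :=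
      mul_le_mul hT2 (by linarith) (by positivity) (by positivity)
    have e3 : 100 * ((N : ℝ) + 1) * (m + 1) ≤ 100 * (18 * l) * (m + 1) := by
      gcongr
      linarith
    have e4 : (2 * 8 + 2) * l * (A * ((m + 1) * p) + 22 * (m + 1)) =
      18 * A * ((m + 1) * l * p) + 396 * ((m + 1) * l) := by ring
    have e5 : 0 ≤ ((m : ℝ) + 1) * l * (c * p) := hnl.trans e1
    calc (t : ℝ) ≤ 18 * A * ((m + 1) * l * p) + 2500 * ((m + 1) * l * (c * p)) := by linarith
      _ = (2500 * c + 18 * A) * ((m + 1) * l * p) := by ring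
  · obtain ⟨U, mu, hU, hmu⟩ := exists_sorted_diagonalizes (arrowhead_isHermitian α z d)
    refine ⟨mu, hmu, fun i => ?_⟩
    have h1 := hE.specNorm_sub_le hε hmσ
    simp only [toArray_val] at h1
    have h2 := hU.abs_sub_le (hE.diagonalizes hσ0) hmu.1 (hE.strictMono hσ0).monotone h1 i
    have h3 := hE.approx i (by omega)
    rw [abs_sub_comm] at h3
    have h4 : σ ^ 32 ≤ σ ^ 1 := pow_le_pow_of_le_one hσ0.le (by nlinarith) (by norm_num)
    refine (abs_sub_le _ _ _).trans ((add_le_add h2 h3).trans ?_)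
    nlinarith

theorem diag_cost {A c p l r n N T Φ t : ℝ} (hA : 0 ≤ A) (hc : 0 < c) (hp : 0 ≤ p)
    (hl : 1 / 2 ≤ l) (hr : 1 ≤ r) (hn : 1 ≤ n) (hcp : 1 ≤ c * p) (hN : N ≤ 16 * l)
    (hT : T ≤ 458 * l) (hΦ0 : 0 ≤ Φ) (hΦ : Φ ≤ A * (n * p))
    (ht : t ≤ 100 * (N + 1) * n + T * (Φ + 15 * n + 7) +
      ((Φ + 6 * n + 4) + (r * (Φ + 15 * n + 11) + 2))) :
    t ≤ (12000 * c + 462 * A) * (n * r * (p * l)) := by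
  have hn0 : 0 ≤ n := by linarith
  have hl0 : 0 ≤ l := by linarith
  have b : n ≤ n * (c * p) := le_mul_of_one_le_right hn0 hcp
  have f1 : Φ + 15 * n + 11 ≤ (A + 26 * c) * (n * p) := by linarith
  have f2 : Φ + 15 * n + 7 ≤ (A + 22 * c) * (n * p) := by linarith
  have f3 : Φ + 6 * n + 4 ≤ (A + 10 * c) * (n * p) := by linarith
  have hnp : 0 ≤ n * p := by positivity
  have hnpl : 0 ≤ n * p * l := by positivity
  have hr1 : n * p * l ≤ r * (n * p * l) := le_mul_of_one_le_left hnpl hr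
  have hl1 : n * p ≤ 2 * (n * p * l) := by nlinarith
  have g1 : 100 * (N + 1) * n ≤ 1800 * c * (r * (n * p * l)) := by
    calc 100 * (N + 1) * n ≤ 100 * (18 * l) * (n * (c * p)) := by
          refine mul_le_mul (by linarith) b hn0 (by linarith)
      _ = 1800 * c * (n * p * l) := by ring
      _ ≤ 1800 * c * (r * (n * p * l)) := mul_le_mul_of_nonneg_left hr1 (by positivity)
  have g2 : T * (Φ + 15 * n + 7) ≤ 458 * (A + 22 * c) * (r * (n * p * l)) := by
    calc T * (Φ + 15 * n + 7) ≤ (458 * l) * ((A + 22 * c) * (n * p)) :=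
          mul_le_mul hT f2 (by linarith) (by linarith)
      _ = 458 * (A + 22 * c) * (n * p * l) := by ring
      _ ≤ 458 * (A + 22 * c) * (r * (n * p * l)) := mul_le_mul_of_nonneg_left hr1 (by positivity)
  have g3 : Φ + 6 * n + 4 ≤ 2 * (A + 10 * c) * (r * (n * p * l)) := by
    calc Φ + 6 * n + 4 ≤ (A + 10 * c) * (2 * (n * p * l)) :=
          f3.trans (mul_le_mul_of_nonneg_left hl1 (by positivity))
      _ = 2 * (A + 10 * c) * (n * p * l) := by ring
      _ ≤ 2 * (A + 10 * c) * (r * (n * p * l)) := mul_le_mul_of_nonneg_left hr1 (by positivity)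
  have g4 : r * (Φ + 15 * n + 11) ≤ 2 * (A + 26 * c) * (r * (n * p * l)) := by
    calc r * (Φ + 15 * n + 11) ≤ r * ((A + 26 * c) * (2 * (n * p * l))) :=
          mul_le_mul_of_nonneg_left (f1.trans (mul_le_mul_of_nonneg_left hl1 (by positivity)))
            (by linarith)
      _ = 2 * (A + 26 * c) * (r * (n * p * l)) := by ring
  have g5 : 2 ≤ 4 * c * (r * (n * p * l)) := by
    have h1 : 1 ≤ c * (n * p) := by linarith
    have h2 := mul_le_mul_of_nonneg_left (hl1.trans (by linarith : _ ≤ 2 * (r * (n * p * l)))) hc.le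
    linarith
  have hfin : 0 ≤ c * (r * (n * p * l)) := by positivity
  have e : (12000 * c + 462 * A) * (n * r * (p * l)) =
      12000 * (c * (r * (n * p * l))) + 462 * (A * (r * (n * p * l))) := by ring
  rw [e]
  linarith

theorem diagProg_correct {F : BlackBox} {ξ : ℝ} (hξ : 1 ≤ ξ) (hF : F.IsAFMM ξ) :
    ∃ K : ℝ, ∀ (m r : ℕ) (ε α : ℝ) (z d : Fin m → ℝ) (B : Matrix (Fin (m + 1)) (Fin r) ℝ),
      1 ≤ r → 0 < ε → ε < 1 → 2 * ε ≤ (m + 1 : ℕ) → specNorm (arrowhead α z d) ≤ 1 →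
      (∀ j, ‖WithLp.toLp 2 (fun i => B i j)‖ ≤ 1) →
      ∃ (s : State) (t : ℕ),
        Exec F (diagProg (.rop 5 .add 3 9)) (diagInput ε α z d B) s t ∧
        (t : ℝ) ≤ K * ((m + 1 : ℕ) * r * Real.log ((m + 1 : ℕ) / ε) ^ (ξ + 1)) ∧
        ∃ Q ∈ Matrix.orthogonalGroup (Fin (m + 1)) ℝ,
          specNorm (arrowhead α z d -
            Q * Matrix.diagonal (outVector s (m + 1)) * Q.transpose) ≤ ε ∧
          ∀ i j, |(Q.transpose * B - outMatrix s (m + 1) r) i j| ≤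
            ε / ((m + 1 : ℕ) : ℝ) ^ 2 := by
  obtain ⟨A, hA, hΦ⟩ := exists_fmmBound hξ hF
  refine ⟨12000 * 2 ^ ξ + 462 * A, fun m r ε α z d B hr hε hε' hε'' hH hB => ?_⟩
  have hm0 : (0 : ℝ) ≤ m := Nat.cast_nonneg m
  push_cast at hε''
  set σ := ε / (64 * ((m : ℝ) + 1)) with hσ
  have hσ0 : 0 < σ := by rw [hσ]; positivity
  obtain ⟨Φ, hΦ1, hΦ2⟩ := hΦ m ε σ hε hε'.le hε'' hσ
  set x : ℝ := ((m : ℝ) + 1) / ε with hxdef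
  have hx : 2 ≤ x := by rw [hxdef, le_div_iff₀ hε]; exact hε''
  have h64 : (64 : ℝ) ≤ x ^ 6 := by
    have := pow_le_pow_left₀ (by norm_num) hx 6
    linarith
  have h16 : (16 : ℝ) ≤ x ^ 4 := by
    have := pow_le_pow_left₀ (by norm_num) hx 4
    linarith
  have hσx : σ = (64 * x)⁻¹ := by rw [hσ, hxdef]; field_simp
  have hεx : 1 / ε ≤ x := by rw [hxdef]; gcongr; linarith
  obtain ⟨N, hN1, hN2⟩ := exists_two_pow_ge hx (k := 7) (y := 64 / ε)
    (by rw [le_div_iff₀ hε]; linarith) (by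
      calc 64 / ε = 64 * (1 / ε) := by ring
        _ ≤ x ^ 6 * x := by gcongr
        _ = x ^ 7 := by ring)
  have hσinv : 16 / σ ^ 32 = 16 * (64 * x) ^ 32 := by
    rw [hσx, inv_pow, div_inv_eq_mul]
  obtain ⟨T, hT1, hT2⟩ := exists_two_pow_ge hx (k := 228) (y := 16 / σ ^ 32)
    (by
      rw [hσinv]
      have : 1 ≤ (64 * x) ^ 32 := one_le_pow₀ (by linarith)
      linarith) (by
      rw [hσinv]
      calc 16 * (64 * x) ^ 32 ≤ x ^ 4 * (x ^ 6 * x) ^ 32 := by gcongr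
        _ = x ^ 228 := by rw [← pow_succ, ← pow_mul, ← pow_add])
  rw [div_le_iff₀ (by positivity)] at hN1 hT1
  obtain ⟨s, t, hex, ht, hQ⟩ := diagProg_spec (F := F) (N := N) (T := T) hε hε'.le hε'' hσ
    (by rw [div_le_iff₀ (by positivity)]; linarith)
    (by rw [div_le_iff₀ (by positivity)]; linarith) hΦ1 hH hB
  refine ⟨s, t, hex, ?_, hQ⟩
  have h1 := one_le_rpow_mul hξ hx
  have h2 := half_lt_log_two
  have h3 : Real.log 2 ≤ Real.log x := Real.log_le_log (by norm_num) hx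
  have ht' : (t : ℝ) ≤ 100 * (N + 1) * (m + 1) + T * (Φ + 15 * (m + 1) + 7) +
      ((Φ + 6 * (m + 1) + 4) + (r * (Φ + 15 * (m + 1) + 11) + 2)) := by
    exact_mod_cast ht
  push_cast at hN2 hT2 ⊢
  rw [← hxdef, Real.rpow_add_one (by linarith)]
  exact diag_cost hA (by positivity) (Real.rpow_nonneg (by linarith) _) (by linarith)
    (by exact_mod_cast hr) (by linarith) h1 (by linarith) (by linarith) (Nat.cast_nonneg Φ) hΦ2 ht'

theorem mainTheorem6 :
    (∃ P : Prog, ∀ (F : BlackBox) (ξ : ℝ), 1 ≤ ξ → F.IsAFMM ξ →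
      ∃ K : ℝ, ∀ (m r : ℕ) (ε α : ℝ) (z d : Fin m → ℝ) (B : Matrix (Fin (m + 1)) (Fin r) ℝ),
        1 ≤ r → 0 < ε → ε < 1 → 2 * ε ≤ (m + 1 : ℕ) →
        specNorm (arrowhead α z d) ≤ 1 →
        (∀ j, ‖WithLp.toLp 2 (fun i => B i j)‖ ≤ 1) →
        ∃ (s : State) (t : ℕ), Exec F P (diagInput ε α z d B) s t ∧
          (t : ℝ) ≤ K * ((m + 1 : ℕ) * r * Real.log ((m + 1 : ℕ) / ε) ^ (ξ + 1)) ∧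
          ∃ Q ∈ Matrix.orthogonalGroup (Fin (m + 1)) ℝ,
            specNorm (arrowhead α z d -
              Q * Matrix.diagonal (outVector s (m + 1)) * Q.transpose) ≤ ε ∧
            ∀ i j, |(Q.transpose * B - outMatrix s (m + 1) r) i j| ≤ ε / ((m + 1 : ℕ) : ℝ) ^ 2) ∧
    (∃ P : Prog, ∀ (F : BlackBox) (ξ : ℝ), 1 ≤ ξ → F.IsAFMM ξ →
      ∃ K : ℝ, ∀ (m : ℕ) (ε α : ℝ) (z d : Fin m → ℝ),
        0 < ε → ε ≤ 1 / 2 →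
        specNorm (arrowhead α z d) ≤ 1 →
        ∃ (s : State) (t : ℕ), Exec F P (eigInput ε α z d) s t ∧
          (t : ℝ) ≤ K * ((m + 1 : ℕ) * Real.log (1 / ε) * Real.log ((m + 1 : ℕ) / ε) ^ ξ) ∧
          ∃ lam : Fin (m + 1) → ℝ, IsSortedSpectrum (arrowhead α z d) lam ∧
            ∀ i, |lam i - outVector s (m + 1) i| ≤ ε) :=
  ⟨⟨_, fun _ _ hξ hF => diagProg_correct hξ hF⟩, ⟨_, fun _ _ hξ hF => eigProg_correct hξ hF⟩⟩
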